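/- Let $n\ge 2$, $\zeta=\exp(2\pi i/n)$, $G=\mathbb{C}^*$ acting on $X=\mathbb{C}^2\setminus\{0\}$ by $t\cdot(z_0,z_1)=(tz_0,t^nz_1)$, so that $\mathbb{P}(1,n)=[X/G]$. For $m\in\mathbb{Z}/n$ let $X^m\subseteq X$ be the fixed locus of $\zeta^m$; the inertia manifold is $I_GX=\coprod_m X^m$. Let $K(I\mathbb{P}(1,n))_{\mathbb{C}}=\bigoplus_{m}K_G(X^m)\otimes\mathbb{C}$, where $K_G$ denotes the Grothendieck ring of $G$-equivariant algebraic vector bundles, and equip it with the virtual product $$a*b=\mu_*\bigl(e_1^*a\cdot e_2^*b\cdot \mathrm{eu}(\mathbb{T}^{virt})\bigr),$$ where $e_1,e_2,\mu: \coprod_{m_1,m_2}X^{m_1}\cap X^{m_2}\to I_GX$ are the inclusions into $X^{m_1}$, $X^{m_2}$, $X^{m_1+m_2}$, $\mathbb{T}^{virt}=\mathbb{T}+\mathbb{T}_{I^2}-e_1^*\mathbb{T}_{I}-e_2^*\mathbb{T}_{I}$ (with $\mathbb{T},\mathbb{T}_I,\mathbb{T}_{I^2}$ the tangent bundles of $[X/G]$,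 of its inertia orbifold and of its double inertia orbifold, restricted to $\coprod X^{m_1}\cap X^{m_2}$), and $\mathrm{eu}(V)=\lambda_{-1}(V^*)$. The unit is $\mathbf 1=1_{X^0}$. The virtual Adams operations are $\widetilde\psi^k(a)=\psi^k(a)\cdot\theta^k(S^*)$, $k\ge 1$, where $\psi^k$ are the ($\mathbb{C}$-linearly extended) Adams operations of $K_G$, $S$ is the normal bundle of $I_GX\to X$, and $\theta^k$ is the multiplicative class with $\theta^k(L)=\sum_{i=0}^{k-1}L^i$ for line bundles. A virtual line element is a $*$-invertible $\mathcal L$ with $\widetilde\psi^k(\mathcal L)=\mathcal L^{*k}$ for all $k\ge1$. Let $x_m\in K_G(X^m)$ be the class of the trivial line bundle on which $G$ acts by the character $t\mapsto t$. In the ordinary rings $K_G(X^m)\otimes\mathbb{C}$ put $P_{ml}=\prod_{i\ne l}(x_m-\zeta^i)$ and $$1_{00}=\tfrac1{2n}\bigl((1-n)x_0+(1+n)\bigr)P_{00},\qquad x_{00}=\tfrac1{2n}\bigl((3-n)x_0+(n-1)\bigr)P_{00},$$ $$1_{0l}=\tfrac{\zeta^l}{n(\zeta^l-1)}(x_0-1)P_{0l}\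 (l\ne0),\qquad 1_{ml}=\tfrac{\zeta^l}{n}P_{ml}\ (m\neq0);$$ these are the components of $1_m$ (and of $x_0$) in the localizations at the characters vanishing at $\zeta^l$. Put $\hat 1_{ml}=(1-\zeta^{-l})^{-1}1_{ml}$ if $m,l\ne0$ and $\hat1_{ml}=1_{ml}$ otherwise; $u_l^q=\frac1n\sum_{i=0}^{n-1}\zeta^{-iq}\hat1_{il}$ for $l\ne0$, $u_0^0=x_{00}-1_{00}$, and $u_0^q=1_{q0}$ for $q\ne0$ $(0\le l,q\le n-1)$. For $f\in(\mathbb{Z}/n)^n$ and $\beta\in\mathbb{C}^n$ let $$\mathcal L(f;\beta)=\mathbf 1+\sum_{q=0}^{n-1}\sum_{l=1}^{n-1}(\zeta^{lf_q}-1)u_l^q+\sum_{q=0}^{n-1}\beta_qu_0^q ,$$ and let $\sigma_i=\mathcal L(\mathbf e_i;0)$ and $\nu_j=\mathcal L(0;\mathbf e_j)$, where $\mathbf e_i$ is the $i$-th standard basis vector, $0\le i,j\le n-1$. Theorem. The $\sigma_i$ and $\nu_j$ are virtual line elements, and sending the variables $\sigma_i,\nu_j$ to these elements defines an isomorphism of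 unital $\mathbb{C}$-algebras $$\mathbb{C}[\sigma_0^{\pm1},\ldots,\sigma_{n-1}^{\pm1},\nu_0^{\pm1},\ldots,\nu_{n-1}^{\pm1}]/I\ \xrightarrow{\ \sim\ }\ \bigl(K(I\mathbb{P}(1,n))_{\mathbb{C}},*\bigr),$$ where $I$ is the ideal generated by $\sigma_i^n-1$, $(\nu_i-1)(\nu_j-1)$ and $\sigma_i(\nu_j-1)-(\nu_j-1)$ for all $i,j$, and $(\sigma_i-1)(\sigma_j-1)$ for $i\ne j$. -/

import Mathlib

noncomputable section

namespace VirtualK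

/-! ### Equivariant vector bundles on coordinate subspaces minus the origin

The torus `G = ℂˣ` acts on `V = ℂ²` by `t · (z₀, z₁) = (t ^ w 0 * z₀, t ^ w 1 * z₁)`.
For `J ⊆ {0, 1}` let `V_J = {z | z j = 0 for j ∉ J}` and `X_J = V_J ∖ {0}`. -/

/-- The coordinate ring of the linear subspace `V_J`. -/
abbrev Coord (J : Set (Fin 2)) : Type := MvPolynomial J ℂ

/-- The action of `G` on functions on `V_J`: `(t · f) z = f (t⁻¹ · z)`. -/
def translate (w : Fin 2 → ℕ) (J : Set (Fin 2)) (t : ℂˣ) : Coord J →ₐ[ℂ] Coord J :=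
  MvPolynomial.aeval fun j => MvPolynomial.C (((t⁻¹ : ℂˣ) : ℂ) ^ w j) * MvPolynomial.X j

/-- A `G`-equivariant algebraic vector bundle on the quasi-affine variety `X_J`, presented by
a `G`-equivariant coherent sheaf on the affine space `V_J` (that is, a finitely generated module
of sections with a compatible rational action of `G`) whose restriction to `X_J` is locally free.
Every equivariant vector bundle on the open subvariety `X_J` is such a restriction; the part of
the module supported at the origin is irrelevant, and is ignored by the relations imposed below. -/
structure EquivBundle (w : Fin 2 → ℕ) (J : Set (Fin 2)) where
  /-- the module of sections -/
  carrier : Type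
  [addCommGroup : AddCommGroup carrier]
  [module : Module (Coord J) carrier]
  [finite : Module.Finite (Coord J) carrier]
  /-- the action of `G` on sections -/
  act : ℂˣ →* AddMonoid.End carrier
  act_smul : ∀ (t : ℂˣ) (f : Coord J) (s : carrier),
    act t (f • s) = translate w J t f • act t s
  /-- the action is algebraic: the module is spanned by weight vectors -/
  rational : AddSubgroup.closure
    {s : carrier | ∃ a : ℤ, ∀ t : ℂˣ,
      act t s = (MvPolynomial.C ((t ^ a : ℂˣ) : ℂ) : Coord J) • s} = ⊤
  /-- the restriction to each basic open set `{z j ≠ 0}` of `X_J` is a vector bundle -/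
  locallyFree : ∀ j : J, Module.Projective
    (Localization (Submonoid.powers (MvPolynomial.X j : Coord J)))
    (LocalizedModule (Submonoid.powers (MvPolynomial.X j : Coord J)) carrier)

attribute [instance] EquivBundle.addCommGroup EquivBundle.module EquivBundle.finite

variable {w : Fin 2 → ℕ} {J J' : Set (Fin 2)}

/-- The sequence `0 → M' → M → M'' → 0` of modules over the coordinate ring of `V_J` is exact
on `X_J`, i.e. on each of the open sets `{z j ≠ 0}`, `j ∈ J`, which cover `X_J`. -/
def ShortExactOnX {M' M M'' : Type} [AddCommGroup M'] [AddCommGroup M] [AddCommGroup M'']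
    [Module (Coord J) M'] [Module (Coord J) M] [Module (Coord J) M'']
    (f : M' →ₗ[Coord J] M) (g : M →ₗ[Coord J] M'') : Prop :=
  ∀ j : J,
    Function.Injective (LocalizedModule.map (Submonoid.powers (MvPolynomial.X j : Coord J)) f) ∧
    Function.Exact (LocalizedModule.map (Submonoid.powers (MvPolynomial.X j : Coord J)) f)
      (LocalizedModule.map (Submonoid.powers (MvPolynomial.X j : Coord J)) g) ∧
    Function.Surjective (LocalizedModule.map (Submonoid.powers (MvPolynomial.X j : Coord J)) g)

/-- `0 → M' → M → M'' → 0` can be made a short exact sequence of equivariant bundles on `X_J`. -/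
def IsExtension (M' M M'' : EquivBundle w J) : Prop :=
  ∃ (f : M'.carrier →ₗ[Coord J] M.carrier) (g : M.carrier →ₗ[Coord J] M''.carrier),
    (∀ t s, f (M'.act t s) = M.act t (f s)) ∧ (∀ t s, g (M.act t s) = M''.act t (g s)) ∧
    ShortExactOnX f g

/-- `T` is the tensor product of the equivariant bundles `M` and `N`. -/
def IsTensor (M N T : EquivBundle w J) : Prop :=
  ∃ b : M.carrier →ₗ[Coord J] N.carrier →ₗ[Coord J] T.carrier,
    IsTensorProduct b ∧ ∀ t x y, b (M.act t x) (N.act t y) = T.act t (b x y)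

/-- `T` is the `k`-th exterior power of the equivariant bundle `M`. -/
def IsExteriorPower (k : ℕ) (M T : EquivBundle w J) : Prop :=
  ∃ f : M.carrier [⋀^Fin k]→ₗ[Coord J] T.carrier,
    Function.Bijective (exteriorPower.alternatingMapLinearEquiv f) ∧
    ∀ (t : ℂˣ) (x : Fin k → M.carrier), f (fun i => M.act t (x i)) = T.act t (f x)

theorem translate_one : translate w J 1 = AlgHom.id ℂ _ := by
  apply MvPolynomial.algHom_ext
  intro j
  simp [translate]

theorem translate_mul (s t : ℂˣ) (f : Coord J) :
    translate w J (s * t) f = translate w J s (translate w J t f) := by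
  have h : translate w J (s * t) = (translate w J s).comp (translate w J t) := by
    apply MvPolynomial.algHom_ext
    intro j
    simp [translate, mul_pow, MvPolynomial.algHom_C, MvPolynomial.algebraMap_eq]
    ring
  rw [h]; rfl

theorem translate_monomial (t : ℂˣ) (s : J →₀ ℕ) (c : ℂ) :
    translate w J t (MvPolynomial.monomial s c) =
      MvPolynomial.C ((t ^ (-(s.sum fun j k => (w j * k : ℤ))) : ℂˣ) : ℂ) *
        MvPolynomial.monomial s c := by
  have h : ((t ^ (-(s.sum fun j k => (w j * k : ℤ))) : ℂˣ) : ℂ) =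
      s.prod fun j k => ((((t⁻¹ : ℂˣ) : ℂ)) ^ w j) ^ k := by
    have h2 : (s.sum fun j k => (w j * k : ℤ)) = ((s.sum fun j k => w j * k : ℕ) : ℤ) := by
      simp [Finsupp.sum]
    rw [h2, ← inv_zpow', zpow_natCast, Units.val_pow_eq_pow_val, Finsupp.sum,
      ← Finset.prod_pow_eq_pow_sum, Finsupp.prod]
    exact Finset.prod_congr rfl fun j _ => pow_mul _ _ _
  rw [h, translate, MvPolynomial.aeval_monomial]
  rw [MvPolynomial.monomial_eq]
  simp only [mul_pow, Finsupp.prod_mul, MvPolynomial.algebraMap_eq]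
  simp only [Finsupp.prod, map_prod, map_pow]
  ring

/-- The equivariant line bundle on `X_J` with total space `X_J × ℂ`, where `G` acts on the
factor `ℂ` through the character `t ↦ t ^ a`. -/
def lineBundle (w : Fin 2 → ℕ) (J : Set (Fin 2)) (a : ℤ) : EquivBundle w J where
  carrier := Coord J
  act :=
    { toFun := fun t =>
        (AddMonoidHom.mulLeft (MvPolynomial.C ((t ^ a : ℂˣ) : ℂ))).comp
          (translate w J t).toRingHom.toAddMonoidHom
      map_one' := by
        apply AddMonoidHom.ext
        intro f
        change MvPolynomial.C (((1 : ℂˣ) ^ a : ℂˣ) : ℂ) * translate w J 1 f = f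
        simp [translate_one]
      map_mul' := by
        intro s t
        apply AddMonoidHom.ext
        intro f
        have h : translate w J s (MvPolynomial.C ((t ^ a : ℂˣ) : ℂ)) =
          MvPolynomial.C ((t ^ a : ℂˣ) : ℂ) := (translate w J s).commutes _
        change MvPolynomial.C (((s * t) ^ a : ℂˣ) : ℂ) * translate w J (s * t) f =
          MvPolynomial.C ((s ^ a : ℂˣ) : ℂ) *
            translate w J s (MvPolynomial.C ((t ^ a : ℂˣ) : ℂ) * translate w J t f)
        rw [map_mul, h, translate_mul, mul_zpow, Units.val_mul, map_mul]
        ring }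
  act_smul := by
    intro t f s
    change MvPolynomial.C ((t ^ a : ℂˣ) : ℂ) * translate w J t (f * s) =
      translate w J t f * (MvPolynomial.C ((t ^ a : ℂˣ) : ℂ) * translate w J t s)
    rw [map_mul]
    ring
  rational := by
    rw [eq_top_iff]
    intro f _
    induction f using MvPolynomial.induction_on' with
    | monomial s c =>
      apply AddSubgroup.subset_closure
      refine ⟨a - s.sum fun j k => (w j * k : ℤ), fun t => ?_⟩
      change MvPolynomial.C ((t ^ a : ℂˣ) : ℂ) * translate w J t (MvPolynomial.monomial s c) =
        MvPolynomial.C _ * MvPolynomial.monomial s c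
      rw [translate_monomial, ← mul_assoc, ← map_mul, ← Units.val_mul, ← zpow_add,
        ← sub_eq_add_neg]
    | add p q hp hq => exact add_mem (hp trivial) (hq trivial)
  locallyFree := fun j => Module.projective_of_isLocalizedModule
    (Submonoid.powers (MvPolynomial.X j : Coord J))
    (LocalizedModule.mkLinearMap (Submonoid.powers (MvPolynomial.X j : Coord J)) (Coord J))

/-! ### Equivariant K-theory with complex coefficients -/

/-- The relations of the Grothendieck ring of equivariant vector bundles on `X_J`. -/
inductive KRel (w : Fin 2 → ℕ) (J : Set (Fin 2)) : MvPolynomial (EquivBundle w J) ℂ → Prop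
  | extension (M' M M'' : EquivBundle w J) (h : IsExtension M' M M'') :
      KRel w J (MvPolynomial.X M - (MvPolynomial.X M' + MvPolynomial.X M''))
  | tensor (M N T : EquivBundle w J) (h : IsTensor M N T) :
      KRel w J (MvPolynomial.X M * MvPolynomial.X N - MvPolynomial.X T)
  | unit : KRel w J (MvPolynomial.X (lineBundle w J 0) - 1)

/-- `K_G(X_J) ⊗ ℂ`: the commutative `ℂ`-algebra generated by the classes of equivariant vector
bundles, with `[M] = [M'] + [M'']` for short exact sequences, `[M ⊗ N] = [M] [N]`, and the
structure sheaf as the unit. As products of classes are classes of tensor products, this is the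
Grothendieck group of equivariant vector bundles, tensored with `ℂ`, with its usual product. -/
abbrev K (w : Fin 2 → ℕ) (J : Set (Fin 2)) : Type 1 :=
  MvPolynomial (EquivBundle w J) ℂ ⧸ Ideal.span {p | KRel w J p}

/-- The class of an equivariant vector bundle. -/
def cls (M : EquivBundle w J) : K w J := Ideal.Quotient.mk _ (MvPolynomial.X M)

/-- The class `x ^ a` of the line bundle attached to the character `t ↦ t ^ a`. -/
def x (w : Fin 2 → ℕ) (J : Set (Fin 2)) (a : ℤ) : K w J := cls (lineBundle w J a)

open Classical in
/-- Restriction of functions from `V_J'` to its subspace `V_J`, for `J ⊆ J'`. -/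
def restrict (J J' : Set (Fin 2)) : Coord J' →ₐ[ℂ] Coord J :=
  MvPolynomial.aeval fun j => if h : (j : Fin 2) ∈ J then MvPolynomial.X ⟨j, h⟩ else 0

/-- `N` is the restriction to `X_J` of the equivariant bundle `M` on `X_J'`, for `J ⊆ J'`:
its sections are those of `M`, modulo the ideal of `V_J` in `V_J'`. -/
def IsRestriction (M : EquivBundle w J') (N : EquivBundle w J) : Prop :=
  ∃ r : M.carrier →+ N.carrier,
    (∀ f s, r (f • s) = restrict J J' f • r s) ∧ (∀ t s, r (M.act t s) = N.act t (r s)) ∧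
    Function.Surjective r ∧
    ∀ s, r s = 0 ↔ s ∈ (RingHom.ker (restrict J J') • ⊤ : Submodule (Coord J') M.carrier)

/-- The pullback `i^* : K_G(X_J') ⊗ ℂ → K_G(X_J) ⊗ ℂ` along the inclusion `i : X_J → X_J'`,
for `J ⊆ J'`: the linear map taking the class of a bundle to the class of its restriction. -/
def pull (w : Fin 2 → ℕ) (J J' : Set (Fin 2)) : K w J' →ₗ[ℂ] K w J :=
  Classical.epsilon fun f => ∀ (M : EquivBundle w J') (N : EquivBundle w J),
    IsRestriction M N → f (cls M) = cls N

/-- The sections of the direct image sheaf of a bundle on `X_J` under `X_J → X_J'`. -/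
def DirectImage (_J' : Set (Fin 2)) (E : EquivBundle w J) : Type := E.carrier

instance (E : EquivBundle w J) : AddCommGroup (DirectImage J' E) :=
  inferInstanceAs (AddCommGroup E.carrier)

instance (E : EquivBundle w J) : Module (Coord J') (DirectImage J' E) :=
  Module.compHom E.carrier (restrict J J').toRingHom

/-- `0 → F₁ → F₀ → i_* E → 0` can be made an equivariant resolution on `X_J'` of the direct
image of `E` under `i : X_J → X_J'` by vector bundles. -/
def IsResolution (F₁ F₀ : EquivBundle w J') (E : EquivBundle w J) : Prop :=
  ∃ (f : F₁.carrier →ₗ[Coord J'] F₀.carrier) (g : F₀.carrier →ₗ[Coord J'] DirectImage J' E),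
    (∀ t s, f (F₁.act t s) = F₀.act t (f s)) ∧
    (∀ t s, g (F₀.act t s) = E.act t (g s : E.carrier)) ∧
    ShortExactOnX f g

/-- The pushforward `i_* : K_G(X_J) ⊗ ℂ → K_G(X_J') ⊗ ℂ` along the closed embedding
`i : X_J → X_J'`, for `J ⊆ J'` of codimension at most one: the linear map taking the class of a
bundle `E` to `[F₀] - [F₁]` for each resolution of `i_* E` by vector bundles. -/
def push (w : Fin 2 → ℕ) (J J' : Set (Fin 2)) : K w J →ₗ[ℂ] K w J' :=
  Classical.epsilon fun f => ∀ (F₁ F₀ : EquivBundle w J') (E : EquivBundle w J),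
    IsResolution F₁ F₀ E → f (cls E) = cls F₀ - cls F₁

/-- The Adams operations `ψ k`, `k ≥ 1`, on `K_G(X_J) ⊗ ℂ`: the linear maps with
`∑ₖ tᵏ [Λᵏ M] = exp (∑ₖ (-1)^(k-1) (tᵏ / k) ψ k [M])` for every equivariant bundle `M`.
Comparing coefficients after taking logarithmic derivatives, this is Newton's identity below. -/
def adams (w : Fin 2 → ℕ) (J : Set (Fin 2)) : ℕ → K w J →ₗ[ℂ] K w J :=
  Classical.epsilon fun ψ => ∀ (M : EquivBundle w J) (T : ℕ → EquivBundle w J),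
    (∀ i, IsExteriorPower i M (T i)) → ∀ k : ℕ, 1 ≤ k →
      (k : K w J) * cls (T k) =
        ∑ i ∈ Finset.Icc 1 k, (-1) ^ (i - 1) * cls (T (k - i)) * ψ i (cls M)

/-- The K-theoretic Euler class `λ₋₁(L^*) = 1 - L^*` of the line bundle `L = x ^ a`. -/
def euler (w : Fin 2 → ℕ) (J : Set (Fin 2)) (a : ℤ) : K w J := 1 - x w J (-a)

/-- The Bott class `θᵏ(L^*) = ∑_{i < k} L^{-i}` of the dual of the line bundle `L = x ^ a`. -/
def bottDual (w : Fin 2 → ℕ) (J : Set (Fin 2)) (k : ℕ) (a : ℤ) : K w J :=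
  ∑ i ∈ Finset.range k, x w J (-a) ^ i

/-! ### The virtual K-theory of the inertia orbifold of `ℙ(1, n)`

From now on `w = (1, n)`, and `X = ℂ² ∖ {0}`, so that `ℙ(1, n) = [X / ℂˣ]`. The inertia manifold
is the disjoint union of the fixed loci `X ^ m` of `ζ ^ m ∈ ℂˣ`, for `m ∈ ℤ/n`. -/

/-- The weights of the action on `ℂ²` defining `ℙ(1, n)`. -/
def wt (n : ℕ) : Fin 2 → ℕ := ![1, n]

/-- `ζ = exp(2πi/n)`. -/
def zeta (n : ℕ) : ℂ := Complex.exp (2 * Real.pi * Complex.I / n)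

/-- The coordinates of `ℂ²` that are fixed by `ζ ^ m`, so that `X ^ m = X_J`, `J = fixedBy n m`. -/
def fixedBy (n : ℕ) (m : ZMod n) : Set (Fin 2) := {j | (zeta n ^ m.val) ^ wt n j = 1}

/-- `K_G(X ^ m) ⊗ ℂ`. -/
abbrev Sector (n : ℕ) (m : ZMod n) : Type 1 := K (wt n) (fixedBy n m)

/-- `K(Iℙ(1, n))_ℂ = K_G(I_G X) ⊗ ℂ`, the direct sum over the components of the inertia manifold. -/
abbrev KI (n : ℕ) : Type 1 := ∀ m : ZMod n, Sector n m

/-- The coordinates fixed by both `ζ ^ m₁` and `ζ ^ m₂`: the corresponding component of the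
double inertia manifold is `X ^ m₁ ∩ X ^ m₂`. -/
def fixedBy₂ (n : ℕ) (m₁ m₂ : ZMod n) : Set (Fin 2) := fixedBy n m₁ ∩ fixedBy n m₂

/-- The multiplicity of the `j`-th coordinate line bundle in the virtual obstruction class
`𝕋 + 𝕋_{I²} - e₁^* 𝕋_I - e₂^* 𝕋_I` on the component `X ^ m₁ ∩ X ^ m₂` of the double inertia
manifold. (The tangent bundle of `X_J` is the sum over `j ∈ J` of the bundles `x ^ w j`; the
Lie algebra of `G`, by which tangent bundles of the quotients differ, cancels.) -/
def obstructionMult (n : ℕ) (m₁ m₂ : ZMod n) (j : Fin 2) : ℤ :=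
  1 + (fixedBy₂ n m₁ m₂).indicator 1 j
    - (fixedBy n m₁).indicator 1 j - (fixedBy n m₂).indicator 1 j

/-- The Euler class of the virtual obstruction class. -/
def eulerObstruction (n : ℕ) (m₁ m₂ : ZMod n) : K (wt n) (fixedBy₂ n m₁ m₂) :=
  ∏ j : Fin 2, euler _ _ (wt n j) ^ (obstructionMult n m₁ m₂ j).toNat

/-- The virtual product `a * b = μ_*(e₁^* a · e₂^* b · eu(𝕋^virt))`, where on the component of the
double inertia manifold with index `(m₁, m₂)` the maps `e₁`, `e₂` and `μ` are the inclusions of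
`X ^ m₁ ∩ X ^ m₂` in `X ^ m₁`, `X ^ m₂` and `X ^ (m₁ + m₂)`. -/
def vmul (n : ℕ) [NeZero n] (a b : KI n) : KI n := fun m =>
  ∑ m₁ : ZMod n, ∑ m₂ : ZMod n, if m₁ + m₂ = m then
    push (wt n) (fixedBy₂ n m₁ m₂) (fixedBy n m)
      (pull (wt n) (fixedBy₂ n m₁ m₂) (fixedBy n m₁) (a m₁) *
        pull (wt n) (fixedBy₂ n m₁ m₂) (fixedBy n m₂) (b m₂) *
        eulerObstruction n m₁ m₂)
  else 0

/-- The unit of the virtual product: the structure sheaf of the untwisted sector. -/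
def vone (n : ℕ) : KI n := Pi.single 0 1

/-- Powers with respect to the virtual product. -/
def vpow (n : ℕ) [NeZero n] (a : KI n) : ℕ → KI n
  | 0 => vone n
  | k + 1 => vmul n (vpow n a k) a

open Classical in
/-- The virtual Adams operation `ψᵏ(a) · θᵏ(S^*)`, where `S` is the normal bundle of `I_G X → X`,
i.e. the sum of the bundles `x ^ w j` over the coordinates `j` not fixed by `ζ ^ m`. -/
def virtualAdams (n k : ℕ) (a : KI n) : KI n := fun m =>
  adams (wt n) (fixedBy n m) k (a m) *
    ∏ j : Fin 2, if j ∈ fixedBy n m then 1 else bottDual _ _ k (wt n j)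

/-- Virtual line elements: the invertible `L` with `ψ̃ᵏ(L) = Lᵏ` for all `k ≥ 1`. -/
def IsVirtualLineElement (n : ℕ) [NeZero n] (L : KI n) : Prop :=
  (∃ L' : KI n, vmul n L L' = vone n ∧ vmul n L' L = vone n) ∧
    ∀ k : ℕ, 1 ≤ k → virtualAdams n k L = vpow n L k

/-! ### The generators coming from the localization -/

/-- `(x_m ^ n - 1) / (x_m - ζ ^ l) = ∏_{i ≠ l} (x_m - ζ ^ i)` in the ordinary ring `K_G(X ^ m)`. -/
def cyclo (n : ℕ) [NeZero n] (m l : ZMod n) : Sector n m :=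
  ∏ i ∈ (Finset.univ : Finset (ZMod n)).erase l,
    (x _ _ 1 - algebraMap ℂ _ (zeta n ^ i.val))

/-- The element `1_{ml}` of `K_G(X ^ m) ⊗ ℂ`: the component of the unit in the summand given by
localization at the maximal ideal of `ζ ^ l` in the representation ring of `G`. -/
def oneLoc (n : ℕ) [NeZero n] (m l : ZMod n) : Sector n m :=
  if m = 0 then
    if l = 0 then
      (1 / (2 * n) : ℂ) • (((1 - n : ℂ) • x _ _ 1 + (1 + n : ℂ) • 1) * cyclo n m l)
    else
      (zeta n ^ l.val / (n * (zeta n ^ l.val - 1))) • ((x _ _ 1 - 1) * cyclo n m l)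
  else (zeta n ^ l.val / n) • cyclo n m l

/-- The element `x_{00}`: the component of `x_0` in the localization at `1`. -/
def xLoc (n : ℕ) [NeZero n] : Sector n 0 :=
  (1 / (2 * n) : ℂ) • (((3 - n : ℂ) • x _ _ 1 + (n - 1 : ℂ) • 1) * cyclo n 0 0)

/-- The rescaled elements: `1_{ml} / (1 - ζ ^ (-l))` if `m` and `l` are nonzero, else `1_{ml}`. -/
def oneHat (n : ℕ) [NeZero n] (m l : ZMod n) : Sector n m :=
  if m ≠ 0 ∧ l ≠ 0 then (1 / (1 - (zeta n ^ l.val)⁻¹)) • oneLoc n m l else oneLoc n m l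

/-- The generators `u_l^q`: for `l ≠ 0` the average `(1/n) ∑ᵢ ζ^(-iq) 1̂_{il}`, while
`u_0^0 = x_{00} - 1_{00}`, and `u_0^q = 1_{q0}` for `q ≠ 0`. -/
def u (n : ℕ) [NeZero n] (l q : ZMod n) : KI n :=
  if l = 0 then
    if q = 0 then Pi.single 0 (xLoc n - oneLoc n 0 0) else Pi.single q (oneLoc n q 0)
  else (1 / n : ℂ) • ∑ i : ZMod n,
    (zeta n ^ (i.val * q.val))⁻¹ • (Pi.single i (oneHat n i l) : KI n)

/-- The elements
`L(f; β) = 1 + ∑_q ∑_{l ≠ 0} (ζ ^ (l f_q) - 1) u_l^q + ∑_q β_q u_0^q`. -/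
def lineElt (n : ℕ) [NeZero n] (f : ZMod n → ZMod n) (β : ZMod n → ℂ) : KI n :=
  vone n
    + ∑ q : ZMod n, ∑ l ∈ (Finset.univ : Finset (ZMod n)).erase 0,
        (zeta n ^ (l.val * (f q).val) - 1) • u n l q
    + ∑ q : ZMod n, β q • u n 0 q

/-- `σ_i = L(0, …, 1, …, 0; 0, …, 0)`. -/
def sigma (n : ℕ) [NeZero n] (i : ZMod n) : KI n := lineElt n (Pi.single i 1) 0

/-- `ν_j = 1 + δ_j` with `δ_j = L(0, …, 0; 0, …, 1, …, 0) - 1`. -/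
def nu (n : ℕ) [NeZero n] (j : ZMod n) : KI n :=
  vone n + (lineElt n 0 (Pi.single j 1) - vone n)

/-! ### The presentation -/

/-- `ℂ[σ_0^±, …, σ_{n-1}^±, ν_0^±, …, ν_{n-1}^±]`, with the indices `0, …, n-1` taken in `ℤ/n`. -/
abbrev LaurentRing (n : ℕ) : Type := AddMonoidAlgebra ℂ (ZMod n ⊕ ZMod n →₀ ℤ)

/-- The variable `σ_i`. -/
def sigmaVar (n : ℕ) (i : ZMod n) : LaurentRing n :=
  AddMonoidAlgebra.single (Finsupp.single (Sum.inl i) 1) 1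

/-- The variable `ν_j`. -/
def nuVar (n : ℕ) (j : ZMod n) : LaurentRing n :=
  AddMonoidAlgebra.single (Finsupp.single (Sum.inr j) 1) 1

/-- The ideal of relations. -/
def relIdeal (n : ℕ) : Ideal (LaurentRing n) :=
  Ideal.span
    ({p | ∃ i, p = sigmaVar n i ^ n - 1} ∪
      {p | ∃ i j, p = (nuVar n i - 1) * (nuVar n j - 1)} ∪
      {p | ∃ i j, p = sigmaVar n i * (nuVar n j - 1) - (nuVar n j - 1)} ∪
      {p | ∃ i j, i ≠ j ∧ p = (sigmaVar n i - 1) * (sigmaVar n j - 1)})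

end VirtualK

end

/-!
The group `K_G(X_J) ⊗ ℂ` is first computed for every coordinate subspace `V_J` that contains the
`z₁`-axis. The dual of the module of sections of an equivariant bundle is a finitely generated
graded module on which the coordinates form a regular sequence (`GrMod.dual_depth`), so that it has
a basis of weight vectors (`GrMod.exists_weight_basis`): by minimality of the generators,
the coefficients of a homogeneous relation vanish at the origin, and regularity expresses it through
relations of greater weight, which vanish by induction. Hence every equivariant bundle is a sum of
line bundles `x ^ a` attached to characters (`exists_splits`), and these line bundles span
`K_G(X_J) ⊗ ℂ`. The Koszul complex of the coordinates gives the relation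
`(x ^ n - 1) (x - 1) = 0` if `0 ∈ J`, and `x ^ n - 1 = 0` otherwise (`x_relation`). There are no
others: the dimensions of the spaces of sections of weight `c`, for `c` sufficiently negative, are
additive on sequences that are exact away from the origin (`GrMod.finrank_weight_add`), and they
determine `∑ i, u ^ a i` for the exponents `a` of a bundle and every unit `u` of a ring that
satisfies the relation (`sum_zpow_eq_of_hilb`). This gives `K_G(X_J) ⊗ ℂ` a universal property
(`lift`). The same computation shows that restrictions, direct images and Adams operations, which
are specified by their effect on classes of bundles, exist, and gives their values on `x ^ a`
(`pull_x`, `push_x`, `adams_x`).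

By the universal property, `x` may be evaluated at each `ζ ^ l` (`evalAt`), and, if `0 ∈ J`,
differentiated at `1` (`derivAt`). An element of `K_G(X_J) ⊗ ℂ` is determined by these numbers. The
restrictions preserve them, while direct images from `X ^ m`, `m ≠ 0`, to `X ^ 0` multiply the
evaluation at `ζ ^ l` by `1 - ζ ^ (-l)`. So in the evaluations at `ζ ^ l`, `l ≠ 0`, rescaled by
`1 - ζ ^ (-l)` on the twisted sectors, the virtual product is the convolution product on the group
`ℤ/n` of sectors (`scale_mul_structConst`), which the Fourier transform `fourier` turns into a
product of copies of `ℂ`. For `l = 0` the factor vanishes, and the products of two twisted sectors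
disappear: what remains is the evaluation at `1` on the untwisted sector, together with the
derivative there and the evaluations at `1` on the twisted sectors, which span an ideal of square
zero (`nilpart_vmul`). Altogether `evaluation` identifies the virtual K-theory with
`ℂ ^ (n (n - 1)) × ℂ[ε_0, …, ε_{n-1}] / (ε_i ε_j)`, and the elements `u_l^q` are its standard basis
(`fourier_u`, `nilpart_u_zero`), apart from the unit of the second factor.

The element `L(f; β)` has the components `ζ ^ (l f_q)` and `1 + ∑ j, β j ε_j`, and the `k`-th
virtual Adams operation replaces the Fourier coefficients at `l` by those at `k l` and multiplies
the nilpotent part by `k`: the Bott class changes the rescaling factor for `l` into the one for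
`k l` (`scale_mul_ev_virtualAdams`). Thus the elements `L(f; β)` are virtual line elements, and
they multiply by adding `f` and `β` (`vmul_lineElt`). Finally the monomials in the variables `σ_i`
and `ν_j` are taken to such elements, this homomorphism kills the given relations and is onto
(`presentationHom_surjective`), and modulo the relations the Laurent polynomials are spanned by
`n ^ 2 + 1` elements (`span_spanningFamily`), which is the dimension of the split algebra.
-/

noncomputable section

namespace VirtualK

variable {w : Fin 2 → ℕ} {J J' : Set (Fin 2)}

/-! ### Graded modules over the coordinate ring -/

/-- The weight of the coordinate function `z j` on `V_J`, as a vector for the action of `G` on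
functions. It is the negative of the weight of the coordinate itself. -/
def negWt (w : Fin 2 → ℕ) (J : Set (Fin 2)) (j : J) : ℤ := -(w j : ℤ)

/-- The functions on `V_J` of weight `c`. -/
abbrev polyWeight (w : Fin 2 → ℕ) (J : Set (Fin 2)) (c : ℤ) : Submodule ℂ (Coord J) :=
  MvPolynomial.weightedHomogeneousSubmodule ℂ (negWt w J) c

theorem weight_negWt (s : J →₀ ℕ) :
    Finsupp.weight (negWt w J) s = -(s.sum fun j k => (w j * k : ℤ)) := by
  rw [Finsupp.weight_apply, Finsupp.sum, Finsupp.sum, ← Finset.sum_neg_distrib]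
  refine Finset.sum_congr rfl fun j _ => ?_
  simp [negWt]; ring

theorem coeff_translate (t : ℂˣ) (f : Coord J) (s : J →₀ ℕ) :
    (translate w J t f).coeff s =
      ((t ^ (Finsupp.weight (negWt w J) s) : ℂˣ) : ℂ) * f.coeff s := by
  induction f using MvPolynomial.induction_on' with
  | monomial s' c =>
    rw [translate_monomial, MvPolynomial.coeff_C_mul, ← weight_negWt]
    by_cases h : s' = s
    · rw [h]
    · simp [MvPolynomial.coeff_monomial, h]
  | add p q hp hq => rw [map_add, MvPolynomial.coeff_add, hp, hq, MvPolynomial.coeff_add, mul_add]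

/-- The number `2` has pairwise distinct integral powers, so that its action on a representation of
`G` separates the weights. -/
theorem two_zpow_injective {a b : ℤ}
    (h : (((Units.mk0 2 two_ne_zero : ℂˣ) ^ a : ℂˣ) : ℂ) =
      ((Units.mk0 2 two_ne_zero : ℂˣ) ^ b : ℂˣ)) :
    a = b := by
  have h2 : ((2 : ℝ) ^ a : ℝ) = 2 ^ b := by
    have : ((2 : ℂ) ^ a : ℂ) = 2 ^ b := by simpa using h
    exact Complex.ofReal_injective (by push_cast; exact this)
  exact zpow_right_injective₀ (by norm_num) (by norm_num) h2

/-- The functions of weight `c`, defined by the monomials that occur, are the eigenvectors of `G`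
with character `t ↦ t ^ c`. -/
theorem mem_polyWeight_iff {c : ℤ} {f : Coord J} :
    f ∈ polyWeight w J c ↔ ∀ t : ℂˣ, translate w J t f = MvPolynomial.C ((t ^ c : ℂˣ) : ℂ) * f := by
  constructor
  · intro h t
    ext s
    rw [coeff_translate, MvPolynomial.coeff_C_mul]
    by_cases hs : f.coeff s = 0
    · simp [hs]
    · rw [h hs]
  · intro h s hs
    have := congrArg (MvPolynomial.coeff s) (h (Units.mk0 2 two_ne_zero))
    rw [coeff_translate, MvPolynomial.coeff_C_mul] at this
    exact two_zpow_injective (mul_right_cancel₀ hs this)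

/-- A `G`-equivariant coherent sheaf on `V_J`: a finitely generated module with a compatible
rational action of `G`. The `ℂ`-module structure is carried along in order to have a choice of
its definitional form. -/
structure GrMod (w : Fin 2 → ℕ) (J : Set (Fin 2)) where
  /-- the module of sections -/
  carrier : Type
  [addCommGroup : AddCommGroup carrier]
  [module : Module (Coord J) carrier]
  [moduleC : Module ℂ carrier]
  [tower : IsScalarTower ℂ (Coord J) carrier]
  [finite : Module.Finite (Coord J) carrier]
  /-- the action of `G` on sections -/
  act : ℂˣ →* AddMonoid.End carrier
  act_smul : ∀ (t : ℂˣ) (f : Coord J) (s : carrier),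
    act t (f • s) = translate w J t f • act t s
  rational : AddSubgroup.closure
    {s : carrier | ∃ a : ℤ, ∀ t : ℂˣ, act t s = ((t ^ a : ℂˣ) : ℂ) • s} = ⊤

attribute [instance] GrMod.addCommGroup GrMod.module GrMod.moduleC GrMod.tower GrMod.finite

theorem C_smul {M : Type*} [AddCommGroup M] [Module (Coord J) M] [Module ℂ M]
    [IsScalarTower ℂ (Coord J) M] (c : ℂ) (m : M) : (MvPolynomial.C c : Coord J) • m = c • m := by
  rw [← MvPolynomial.algebraMap_eq, algebraMap_smul]

namespace GrMod

variable (M N : GrMod w J)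

theorem act_smulC (t : ℂˣ) (c : ℂ) (m : M.carrier) : M.act t (c • m) = c • M.act t m := by
  rw [← C_smul (J := J), M.act_smul, ← C_smul (J := J)]
  congr 1
  exact (translate w J t).commutes c

/-- The sections of weight `a`. -/
def weight (a : ℤ) : Submodule ℂ M.carrier where
  carrier := {m | ∀ t : ℂˣ, M.act t m = ((t ^ a : ℂˣ) : ℂ) • m}
  add_mem' := fun {x y} hx hy t => by rw [map_add, hx, hy, smul_add]
  zero_mem' := fun t => by rw [map_zero, smul_zero]
  smul_mem' := fun c x hx t => by rw [act_smulC, hx, smul_comm]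

variable {M N}

variable (M) in
theorem iSupIndep_weight : iSupIndep M.weight := by
  let T : Module.End ℂ M.carrier :=
    { toFun := M.act (Units.mk0 2 two_ne_zero)
      map_add' := map_add _
      map_smul' := fun c m => M.act_smulC _ c m }
  have h := (Module.End.eigenspaces_iSupIndep T).comp
    (f := fun a : ℤ => (((Units.mk0 2 two_ne_zero : ℂˣ) ^ a : ℂˣ) : ℂ))
    (fun a b h => two_zpow_injective h)
  refine h.mono fun a m hm => ?_
  rw [Function.comp_apply, Module.End.mem_eigenspace_iff]
  exact hm _

variable (M) in
theorem isInternal_weight : DirectSum.IsInternal M.weight := by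
  rw [DirectSum.isInternal_submodule_iff_iSupIndep_and_iSup_eq_top]
  refine ⟨iSupIndep_weight M, ?_⟩
  rw [eq_top_iff]
  intro m _
  have hm : m ∈ AddSubgroup.closure
    {s : M.carrier | ∃ a : ℤ, ∀ t : ℂˣ, M.act t s = ((t ^ a : ℂˣ) : ℂ) • s} := by
    rw [M.rational]; trivial
  have hle : AddSubgroup.closure
    {s : M.carrier | ∃ a : ℤ, ∀ t : ℂˣ, M.act t s = ((t ^ a : ℂˣ) : ℂ) • s} ≤
      (⨆ a, M.weight a).toAddSubgroup := by
    rw [AddSubgroup.closure_le]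
    rintro s ⟨a, ha⟩
    exact Submodule.mem_iSup_of_mem (p := M.weight) a ha
  exact hle hm

instance : DirectSum.Decomposition M.weight := (isInternal_weight M).chooseDecomposition

variable (M) in
/-- The projection to the sections of weight `a`. -/
def proj (a : ℤ) : M.carrier →ₗ[ℂ] M.carrier :=
  (M.weight a).subtype ∘ₗ DirectSum.component ℂ ℤ _ a ∘ₗ
    (DirectSum.decomposeLinearEquiv M.weight).toLinearMap

theorem proj_mem (a : ℤ) (m : M.carrier) : M.proj a m ∈ M.weight a := Subtype.coe_prop _

theorem proj_of_mem {a : ℤ} {m : M.carrier} (h : m ∈ M.weight a) : M.proj a m = m :=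
  DirectSum.decompose_of_mem_same _ h

theorem proj_of_mem_ne {a b : ℤ} {m : M.carrier} (h : m ∈ M.weight a) (hab : a ≠ b) :
    M.proj b m = 0 :=
  DirectSum.decompose_of_mem_ne _ h hab

/-- An element is the sum of its components. As only finitely many of them are nonzero, any
sufficiently large range of summation will do. -/
theorem exists_sum_proj (m : M.carrier) : ∃ A : Finset ℤ, ∀ B : Finset ℤ, A ⊆ B →
    ∑ a ∈ B, M.proj a m = m := by
  classical
  refine ⟨(DirectSum.decompose M.weight m).support, fun B hB => ?_⟩
  conv_rhs => rw [← DirectSum.sum_support_decompose M.weight m]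
  symm
  refine Finset.sum_subset hB fun a _ ha => ?_
  rw [DFinsupp.notMem_support_iff] at ha
  rw [ha]; rfl

theorem weight_induction {p : M.carrier → Prop} (hw : ∀ a, ∀ m ∈ M.weight a, p m)
    (hadd : ∀ m m', p m → p m' → p (m + m')) (m : M.carrier) : p m := by
  obtain ⟨A, hA⟩ := exists_sum_proj m
  rw [← hA A subset_rfl]
  exact Finset.sum_induction _ p hadd (hw 0 0 (zero_mem _)) fun a _ => hw a _ (proj_mem a m)

theorem smul_mem_weight {c a : ℤ} {f : Coord J} (hf : f ∈ polyWeight w J c) {m : M.carrier}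
    (hm : m ∈ M.weight a) : f • m ∈ M.weight (c + a) := by
  intro t
  rw [M.act_smul, mem_polyWeight_iff.1 hf, hm t, mul_smul, C_smul, zpow_add, Units.val_mul, mul_smul,
    smul_comm f]

theorem proj_smul {c : ℤ} {f : Coord J} (hf : f ∈ polyWeight w J c) (a : ℤ) (m : M.carrier) :
    M.proj (c + a) (f • m) = f • M.proj a m := by
  induction m using weight_induction with
  | hw b m hm =>
    by_cases h : b = a
    · subst h
      rw [proj_of_mem hm, proj_of_mem (smul_mem_weight hf hm)]
    · rw [proj_of_mem_ne hm h, proj_of_mem_ne (smul_mem_weight hf hm) (by omega), smul_zero]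
  | hadd m m' h h' => rw [smul_add, map_add, map_add, h, h', smul_add]

variable (w J) in
theorem sum_polyComponent (f : Coord J) : ∃ A : Finset ℤ,
    ∑ a ∈ A, MvPolynomial.weightedHomogeneousComponent (negWt w J) a f = f := by
  have h := MvPolynomial.weightedHomogeneousComponent_finsupp (w := negWt w J) f
  refine ⟨h.toFinset, ?_⟩
  conv_rhs => rw [← MvPolynomial.sum_weightedHomogeneousComponent (negWt w J) f]
  rw [finsum_eq_sum_of_support_subset]
  intro a ha
  exact (Set.Finite.mem_toFinset h).2 ha

theorem proj_smul_of_mem {b : ℤ} {m : M.carrier} (hm : m ∈ M.weight b) (a : ℤ) (f : Coord J) :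
    M.proj a (f • m) = MvPolynomial.weightedHomogeneousComponent (negWt w J) (a - b) f • m := by
  obtain ⟨A, hA⟩ := sum_polyComponent w J f
  conv_lhs => rw [← hA, Finset.sum_smul, map_sum]
  have key : ∀ c, M.proj a ((MvPolynomial.weightedHomogeneousComponent (negWt w J) c f) • m) =
      if c = a - b then MvPolynomial.weightedHomogeneousComponent (negWt w J) (a - b) f • m
        else 0 := by
    intro c
    have hc := smul_mem_weight (MvPolynomial.weightedHomogeneousComponent_mem (negWt w J) f c) hm
    split_ifs with h
    · subst h
      exact proj_of_mem (by simpa using hc)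
    · exact proj_of_mem_ne hc (by omega)
  rw [Finset.sum_congr rfl fun c _ => key c, Finset.sum_ite_eq']
  split_ifs with h
  · rfl
  · have h0 : MvPolynomial.weightedHomogeneousComponent (negWt w J) (a - b)
        (∑ c ∈ A, MvPolynomial.weightedHomogeneousComponent (negWt w J) c f) = 0 := by
      rw [map_sum]
      refine Finset.sum_eq_zero fun c hc => ?_
      rw [MvPolynomial.IsWeightedHomogeneous.weightedHomogeneousComponent_ne (a - b) (m := c)
        (MvPolynomial.weightedHomogeneousComponent_mem (negWt w J) f c)]
      rintro rfl
      exact h hc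
    rw [hA] at h0
    rw [h0, zero_smul]

/-- An equivariant linear map preserves weights, also if it is only semilinear over a ring
homomorphism fixing the scalars. -/
theorem map_proj {J' : Set (Fin 2)} {M : GrMod w J} {N : GrMod w J'} (f : M.carrier →+ N.carrier)
    (hC : ∀ (c : ℂ) m, f (c • m) = c • f m)
    (hf : ∀ t m, f (M.act t m) = N.act t (f m)) (a : ℤ) (m : M.carrier) :
    f (M.proj a m) = N.proj a (f m) := by
  have hmem : ∀ b, ∀ m ∈ M.weight b, f m ∈ N.weight b := fun b m hm t => by
    rw [← hf, hm t, hC]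
  induction m using weight_induction with
  | hw b m hm =>
    by_cases h : b = a
    · subst h
      rw [proj_of_mem hm, proj_of_mem (hmem _ m hm)]
    · rw [proj_of_mem_ne hm h, proj_of_mem_ne (hmem _ m hm) h, map_zero]
  | hadd m m' h h' => rw [map_add, map_add, map_add, map_add, h, h']

variable (M) in
/-- A graded submodule is generated by finitely many weight vectors. -/
theorem exists_weight_generators (P : Submodule (Coord J) M.carrier)
    (hP : ∀ a, ∀ m ∈ P, M.proj a m ∈ P) :
    ∃ (r : ℕ) (e : Fin r → M.carrier) (a : Fin r → ℤ), (∀ i, e i ∈ M.weight (a i)) ∧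
      Submodule.span (Coord J) (Set.range e) = P := by
  classical
  obtain ⟨G, hG⟩ : P.FG := IsNoetherian.noetherian P
  choose A hA using fun m : M.carrier => exists_sum_proj m
  let F : Finset (M.carrier × ℤ) :=
    G.biUnion fun m => (A m).image fun a => (M.proj a m, a)
  let ε := F.equivFin
  refine ⟨F.card, fun i => (ε.symm i).1.1, fun i => (ε.symm i).1.2, fun i => ?_, ?_⟩
  · obtain ⟨m, -, h⟩ := Finset.mem_biUnion.1 (ε.symm i).2
    obtain ⟨a, -, h⟩ := Finset.mem_image.1 h
    simp only [← h]
    exact proj_mem a m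
  · apply le_antisymm
    · rw [Submodule.span_le]
      rintro _ ⟨i, rfl⟩
      obtain ⟨m, hm, h⟩ := Finset.mem_biUnion.1 (ε.symm i).2
      obtain ⟨a, -, h⟩ := Finset.mem_image.1 h
      simp only [← h]
      exact hP a m (hG ▸ Submodule.subset_span hm)
    · rw [← hG, Submodule.span_le]
      intro m hm
      rw [← hA m _ subset_rfl]
      refine Submodule.sum_mem _ fun a ha => Submodule.subset_span ?_
      refine ⟨ε ⟨(M.proj a m, a), Finset.mem_biUnion.2 ⟨m, hm, Finset.mem_image.2 ⟨a, ha, rfl⟩⟩⟩, ?_⟩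
      simp

end GrMod

/-! ### Homogeneous polynomials -/

theorem polyComponent_mul {c : ℤ} {f : Coord J} (hf : f ∈ polyWeight w J c) (d : ℤ) (g : Coord J) :
    MvPolynomial.weightedHomogeneousComponent (negWt w J) (d + c) (f * g) =
      f * MvPolynomial.weightedHomogeneousComponent (negWt w J) d g := by
  classical
  ext s
  rw [MvPolynomial.coeff_weightedHomogeneousComponent, MvPolynomial.coeff_mul,
    MvPolynomial.coeff_mul]
  rw [show ∀ (P : Prop) [Decidable P] (F : (J →₀ ℕ) × (J →₀ ℕ) → ℂ) (A : Finset _),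
    (if P then ∑ x ∈ A, F x else 0) = ∑ x ∈ A, if P then F x else 0 from
    fun P _ F A => by split_ifs <;> simp]
  refine Finset.sum_congr rfl fun p hp => ?_
  rw [MvPolynomial.coeff_weightedHomogeneousComponent]
  by_cases h : f.coeff p.1 = 0
  · simp [h]
  · have h1 := hf h
    have h2 : Finsupp.weight (negWt w J) s =
        Finsupp.weight (negWt w J) p.1 + Finsupp.weight (negWt w J) p.2 := by
      rw [← map_add, Finset.HasAntidiagonal.mem_antidiagonal.1 hp]
    have h3 : Finsupp.weight (negWt w J) s = d + c ↔ Finsupp.weight (negWt w J) p.2 = d := by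
      rw [h2, h1]; constructor <;> intro h <;> linarith
    simp only [h3, mul_ite, mul_zero]

theorem X_mem_polyWeight (j : J) : (MvPolynomial.X j : Coord J) ∈ polyWeight w J (-(w j : ℤ)) :=
  MvPolynomial.isWeightedHomogeneous_X ℂ (negWt w J) j

theorem weight_nonpos (s : J →₀ ℕ) : Finsupp.weight (negWt w J) s ≤ 0 := by
  rw [weight_negWt]
  have : (0 : ℤ) ≤ s.sum fun j k => (w j * k : ℤ) := Finset.sum_nonneg fun j _ => by positivity
  linarith

theorem polyWeight_eq_zero {c : ℤ} (hc : 0 < c) {f : Coord J} (hf : f ∈ polyWeight w J c) :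
    f = 0 := by
  ext s
  by_contra h
  have h1 := hf h
  have := weight_nonpos (w := w) s
  omega

theorem weight_eq_zero (hw : ∀ j : J, 0 < w j) {s : J →₀ ℕ}
    (h : Finsupp.weight (negWt w J) s = 0) : s = 0 := by
  rw [weight_negWt, neg_eq_zero, Finsupp.sum, Finset.sum_eq_zero_iff_of_nonneg
    (fun j _ => by positivity)] at h
  ext j
  by_contra hj
  have h1 := h j (Finsupp.mem_support_iff.2 hj)
  have h2 := hw j
  have : (w j * s j : ℕ) = 0 := by exact_mod_cast h1
  simp at this hj
  omega

theorem eq_C_of_polyWeight_zero (hw : ∀ j : J, 0 < w j) {f : Coord J}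
    (hf : f ∈ polyWeight w J 0) : f = MvPolynomial.C (f.coeff 0) := by
  classical
  ext s
  rw [MvPolynomial.coeff_C]
  split_ifs with h
  · rw [h]
  · by_contra hs
    exact h (weight_eq_zero hw (hf hs)).symm

theorem divMonomial_mem {c : ℤ} {f : Coord J} (hf : f ∈ polyWeight w J c) (j : J) :
    f.divMonomial (Finsupp.single j 1) ∈ polyWeight w J (c + w j) := by
  intro s hs
  rw [MvPolynomial.coeff_divMonomial] at hs
  have h := hf hs
  rw [map_add, Finsupp.weight_single] at h
  simp [negWt] at h
  linarith

theorem modMonomial_mem {c : ℤ} {f : Coord J} (hf : f ∈ polyWeight w J c) (j : J) :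
    f.modMonomial (Finsupp.single j 1) ∈ polyWeight w J c := by
  intro s hs
  by_cases h : Finsupp.single j 1 ≤ s
  · rw [MvPolynomial.coeff_modMonomial_of_le _ h] at hs
    exact absurd rfl hs
  · rw [MvPolynomial.coeff_modMonomial_of_not_le _ h] at hs
    exact hf hs

theorem single_le_iff {j : J} {s : J →₀ ℕ} : Finsupp.single j 1 ≤ s ↔ s j ≠ 0 := by
  rw [Finsupp.single_le_iff]; omega

open Classical in
/-- A homogeneous function vanishing at the origin is a combination of the coordinates. -/
theorem exists_eq_X_mul_add (h1 : (1 : Fin 2) ∈ J) {c : ℤ} {f : Coord J}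
    (hf : f ∈ polyWeight w J c) (h0 : f.coeff 0 = 0) :
    ∃ g : Fin 2 → Coord J, (∀ j, g j ∈ polyWeight w J (c + w j)) ∧ ((0 : Fin 2) ∉ J → g 0 = 0) ∧
      f = MvPolynomial.X ⟨1, h1⟩ * g 1 + (if h : (0 : Fin 2) ∈ J then MvPolynomial.X ⟨0, h⟩ * g 0
        else 0) := by
  classical
  let r := f.modMonomial (Finsupp.single ⟨1, h1⟩ 1)
  have hr : r ∈ polyWeight w J c := modMonomial_mem hf _
  have e1 : MvPolynomial.X ⟨1, h1⟩ * f.divMonomial (Finsupp.single ⟨1, h1⟩ 1) + r = f :=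
    MvPolynomial.divMonomial_add_modMonomial_single _ _
  have hr' : ∀ s : J →₀ ℕ, s ⟨1, h1⟩ ≠ 0 → r.coeff s = 0 := fun s hs =>
    MvPolynomial.coeff_modMonomial_of_le _ (single_le_iff.2 hs)
  have hr0 : r.coeff 0 = 0 := by
    rw [MvPolynomial.coeff_modMonomial_of_not_le _ (by rw [single_le_iff]; simp), h0]
  by_cases h : (0 : Fin 2) ∈ J
  · refine ⟨![r.divMonomial (Finsupp.single ⟨0, h⟩ 1), f.divMonomial (Finsupp.single ⟨1, h1⟩ 1)],
      ?_, fun h' => absurd h h', ?_⟩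
    · intro j
      fin_cases j
      · exact divMonomial_mem hr ⟨0, h⟩
      · exact divMonomial_mem hf ⟨1, h1⟩
    · have e2 : MvPolynomial.X ⟨0, h⟩ * r.divMonomial (Finsupp.single ⟨0, h⟩ 1) +
          r.modMonomial (Finsupp.single ⟨0, h⟩ 1) = r :=
        MvPolynomial.divMonomial_add_modMonomial_single _ _
      have e3 : r.modMonomial (Finsupp.single ⟨0, h⟩ 1) = 0 := by
        ext s
        by_cases hs : s ⟨0, h⟩ = 0
        · rw [MvPolynomial.coeff_modMonomial_of_not_le _ (by rw [single_le_iff]; simpa using hs)]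
          by_cases hs1 : s ⟨1, h1⟩ = 0
          · have : s = 0 := by
              ext ⟨j, hj⟩
              fin_cases j
              · exact hs
              · exact hs1
            rw [this, hr0]; rfl
          · rw [hr' s hs1]; rfl
        · rw [MvPolynomial.coeff_modMonomial_of_le _ (single_le_iff.2 hs)]; rfl
      rw [e3, add_zero] at e2
      simp only [h, dif_pos, Matrix.cons_val_zero, Matrix.cons_val_one]
      rw [e2, e1]
  · refine ⟨![0, f.divMonomial (Finsupp.single ⟨1, h1⟩ 1)], ?_, fun _ => rfl, ?_⟩
    · intro j
      fin_cases j
      · exact zero_mem _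
      · exact divMonomial_mem hf ⟨1, h1⟩
    · have e3 : r = 0 := by
        ext s
        by_cases hs1 : s ⟨1, h1⟩ = 0
        · have : s = 0 := by
            ext ⟨j, hj⟩
            fin_cases j
            · exact absurd hj h
            · exact hs1
          rw [this, hr0]; rfl
        · rw [hr' s hs1]; rfl
      simp only [h, dif_neg, not_false_eq_true, Matrix.cons_val_one, add_zero]
      rw [e3, add_zero] at e1
      exact e1.symm

namespace GrMod

/-! ### Graded modules of depth two are free -/

/-- Homogeneous relations, in a graded module on which the coordinates form a regular sequence,
between weight vectors that generate minimally, vanish: by induction on the weight. -/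
theorem relation_eq_zero {D : GrMod w J} (hw : ∀ j, 0 < w j) (h1 : (1 : Fin 2) ∈ J)
    (hreg : ∀ (j : J) (d : D.carrier), (MvPolynomial.X j : Coord J) • d = 0 → d = 0)
    (hdepth : ∀ (i j : J), i ≠ j → ∀ d d' : D.carrier,
      (MvPolynomial.X i : Coord J) • d = (MvPolynomial.X j : Coord J) • d' →
        ∃ d'' : D.carrier, d = (MvPolynomial.X j : Coord J) • d'')
    {r : ℕ} {e : Fin r → D.carrier} {a : Fin r → ℤ} (he : ∀ i, e i ∈ D.weight (a i))
    (hspan : Submodule.span (Coord J) (Set.range e) = ⊤)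
    (hmin : ∀ i, e i ∉ Submodule.span (Coord J) (e '' {k | k ≠ i})) (N : ℕ) :
    ∀ (c : ℤ), (∀ i, a i < c + N) → ∀ (f : Fin r → Coord J), (∀ i, f i ∈ polyWeight w J (c - a i)) →
      ∑ i, f i • e i = 0 → f = 0 := by
  induction N using Nat.strong_induction_on with
  | _ N ih =>
  intro c hc f hf hrel
  by_cases hcN : ∀ i, a i < c
  · funext i
    exact polyWeight_eq_zero (by have := hcN i; omega) (hf i)
  have hN : 0 < N := by
    push Not at hcN
    obtain ⟨i, hi⟩ := hcN
    have := hc i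
    omega
  -- relations of greater weight vanish
  have ih' : ∀ (v : ℕ), 0 < v → ∀ f : Fin r → Coord J,
      (∀ i, f i ∈ polyWeight w J (c + v - a i)) → ∑ i, f i • e i = 0 → f = 0 := by
    intro v hv
    exact ih (N - 1) (by omega) (c + v) fun i => by have := hc i; omega
  -- the coefficients vanish at the origin, as the generators are minimal
  have h0 : ∀ i, (f i).coeff 0 = 0 := by
    intro i
    by_contra hi
    have hci : c - a i = 0 := by
      have := hf i hi
      simpa using this.symm
    have hfi := hf i
    rw [hci] at hfi
    have hC := eq_C_of_polyWeight_zero (fun j => hw j) hfi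
    apply hmin i
    have hsum : f i • e i = -∑ k ∈ Finset.univ.erase i, f k • e k := by
      rw [← Finset.add_sum_erase _ _ (Finset.mem_univ i)] at hrel
      exact eq_neg_of_add_eq_zero_left hrel
    have hmem : f i • e i ∈ Submodule.span (Coord J) (e '' {k | k ≠ i}) := by
      rw [hsum]
      refine neg_mem (Submodule.sum_mem _ fun k hk => Submodule.smul_mem _ _
        (Submodule.subset_span ⟨k, Finset.ne_of_mem_erase hk, rfl⟩))
    have := Submodule.smul_mem _ (MvPolynomial.C ((f i).coeff 0)⁻¹ : Coord J) hmem
    rw [hC, smul_smul, ← map_mul, MvPolynomial.coeff_zero_C, inv_mul_cancel₀ hi, map_one,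
      one_smul] at this
    exact this
  choose g hg hg0 hfg using fun i => exists_eq_X_mul_add h1 (hf i) (h0 i)
  by_cases hJ : (0 : Fin 2) ∈ J
  · simp only [hJ, dif_pos] at hfg
    have hne : (⟨1, h1⟩ : J) ≠ ⟨0, hJ⟩ := by simp
    -- the part of the relation divisible by `z 1` is also divisible by `z 0`
    obtain ⟨d, hd⟩ := hdepth ⟨1, h1⟩ ⟨0, hJ⟩ hne (∑ i, g i 1 • e i) (-∑ i, g i 0 • e i) (by
      rw [smul_neg, eq_neg_iff_add_eq_zero, Finset.smul_sum, Finset.smul_sum,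
        ← Finset.sum_add_distrib, ← hrel]
      refine Finset.sum_congr rfl fun i _ => ?_
      conv_rhs => rw [hfg i]
      rw [add_smul, mul_smul, mul_smul])
    have hdmem : d ∈ Submodule.span (Coord J) (Set.range e) := hspan ▸ trivial
    obtain ⟨k, hk⟩ := (Submodule.mem_span_range_iff_exists_fun _).1 hdmem
    let k' : Fin r → Coord J := fun i =>
      MvPolynomial.weightedHomogeneousComponent (negWt w J) (c + w 1 + w 0 - a i) (k i)
    have hk'mem : ∀ i, k' i ∈ polyWeight w J (c + w 1 + w 0 - a i) := fun i =>
      MvPolynomial.weightedHomogeneousComponent_mem _ _ _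
    have hk' : ∑ i, k' i • e i = D.proj (c + w 1 + w 0) d := by
      rw [← hk, map_sum]
      refine Finset.sum_congr rfl fun i _ => ?_
      rw [proj_smul_of_mem (he i)]
    have hgd : ∑ i, g i 1 • e i = (MvPolynomial.X ⟨0, hJ⟩ : Coord J) • D.proj (c + w 1 + w 0) d := by
      rw [← proj_smul (X_mem_polyWeight ⟨0, hJ⟩), ← hd]
      symm
      apply proj_of_mem
      refine Submodule.sum_mem _ fun i _ => ?_
      have := smul_mem_weight (hg i 1) (he i)
      convert this using 2
      ring
    have h2 : (fun i => g i 1 - MvPolynomial.X ⟨0, hJ⟩ * k' i) = 0 := by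
      apply ih' (w 1) (hw 1)
      · intro i
        refine sub_mem ?_ ?_
        · have := hg i 1
          convert this using 2
          ring
        · have := MvPolynomial.IsWeightedHomogeneous.mul (X_mem_polyWeight (w := w) ⟨0, hJ⟩)
            (hk'mem i)
          change MvPolynomial.IsWeightedHomogeneous _ _ _
          convert this using 1
          ring
      · simp only [sub_smul, mul_smul]
        rw [Finset.sum_sub_distrib, ← Finset.smul_sum, hk', hgd, sub_self]
    have h3 : ∀ i, g i 1 = MvPolynomial.X ⟨0, hJ⟩ * k' i := fun i => sub_eq_zero.1 (congrFun h2 i)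
    have hf2 : ∀ i, f i = MvPolynomial.X ⟨0, hJ⟩ * (g i 0 + MvPolynomial.X ⟨1, h1⟩ * k' i) := by
      intro i
      rw [hfg i, h3 i]; ring
    have h4 : (fun i => g i 0 + MvPolynomial.X ⟨1, h1⟩ * k' i) = 0 := by
      apply ih' (w 0) (hw 0)
      · intro i
        refine add_mem ?_ ?_
        · have := hg i 0
          convert this using 2
          ring
        · have := MvPolynomial.IsWeightedHomogeneous.mul (X_mem_polyWeight (w := w) ⟨1, h1⟩)
            (hk'mem i)
          change MvPolynomial.IsWeightedHomogeneous _ _ _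
          convert this using 1
          ring
      · apply hreg ⟨0, hJ⟩
        rw [Finset.smul_sum, ← hrel]
        refine Finset.sum_congr rfl fun i _ => ?_
        rw [smul_smul, ← hf2]
    funext i
    rw [hf2 i, congrFun h4 i]
    simp
  · simp only [hJ, dif_neg, not_false_eq_true, add_zero] at hfg
    have h4 : (fun i => g i 1) = 0 := by
      apply ih' (w 1) (hw 1)
      · intro i
        have := hg i 1
        convert this using 2
        ring
      · apply hreg ⟨1, h1⟩
        rw [Finset.smul_sum, ← hrel]
        refine Finset.sum_congr rfl fun i _ => ?_
        rw [smul_smul, ← hfg]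
    funext i
    rw [hfg i, congrFun h4 i]
    simp

/-- A graded module on which the coordinates form a regular sequence has a basis of weight
vectors. -/
theorem exists_weight_basis (D : GrMod w J) (hw : ∀ j, 0 < w j) (h1 : (1 : Fin 2) ∈ J)
    (hreg : ∀ (j : J) (d : D.carrier), (MvPolynomial.X j : Coord J) • d = 0 → d = 0)
    (hdepth : ∀ (i j : J), i ≠ j → ∀ d d' : D.carrier,
      (MvPolynomial.X i : Coord J) • d = (MvPolynomial.X j : Coord J) • d' →
        ∃ d'' : D.carrier, d = (MvPolynomial.X j : Coord J) • d'') :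
    ∃ (r : ℕ) (e : Fin r → D.carrier) (a : Fin r → ℤ), (∀ i, e i ∈ D.weight (a i)) ∧
      LinearIndependent (Coord J) e ∧ Submodule.span (Coord J) (Set.range e) = ⊤ := by
  classical
  have hex : ∃ (r : ℕ) (e : Fin r → D.carrier) (a : Fin r → ℤ), (∀ i, e i ∈ D.weight (a i)) ∧
      Submodule.span (Coord J) (Set.range e) = ⊤ :=
    exists_weight_generators D ⊤ fun _ _ _ => trivial
  obtain ⟨r, ⟨e, a, he, hspan⟩, hr⟩ : ∃ r, (∃ (e : Fin r → D.carrier) (a : Fin r → ℤ),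
      (∀ i, e i ∈ D.weight (a i)) ∧ Submodule.span (Coord J) (Set.range e) = ⊤) ∧
      ∀ m < r, ¬ ∃ (e : Fin m → D.carrier) (a : Fin m → ℤ),
        (∀ i, e i ∈ D.weight (a i)) ∧ Submodule.span (Coord J) (Set.range e) = ⊤ :=
    ⟨Nat.find hex, Nat.find_spec hex, fun m hm => Nat.find_min hex hm⟩
  refine ⟨r, e, a, he, ?_, hspan⟩
  have hmin : ∀ i, e i ∉ Submodule.span (Coord J) (e '' {k | k ≠ i}) := by
    intro i hi
    obtain ⟨r', hr'⟩ : ∃ r', r = r' + 1 := ⟨r - 1, by have := i.2; omega⟩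
    subst hr'
    refine hr r' (by omega) ⟨e ∘ i.succAbove, a ∘ i.succAbove,
      fun k => he _, ?_⟩
    have himg : e '' {k | k ≠ i} = Set.range (e ∘ i.succAbove) := by
      rw [Set.range_comp, Fin.range_succAbove]; rfl
    rw [himg] at hi
    rw [eq_top_iff, ← hspan, Submodule.span_le]
    rintro _ ⟨k, rfl⟩
    by_cases hk : k = i
    · rw [hk]; exact hi
    · obtain ⟨l, rfl⟩ := Fin.exists_succAbove_eq hk
      exact Submodule.subset_span ⟨l, rfl⟩
  rw [Fintype.linearIndependent_iff]
  intro f hrel i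
  have hcomp : ∀ c, (fun i => MvPolynomial.weightedHomogeneousComponent (negWt w J) (c - a i) (f i))
      = 0 := by
    intro c
    obtain ⟨N, hN⟩ : ∃ N : ℕ, ∀ i, a i < c + N := by
      obtain ⟨b, hb⟩ := Finite.bddAbove_range a
      refine ⟨(b - c).toNat + 1, fun i => ?_⟩
      have := hb ⟨i, rfl⟩
      push_cast
      have := Int.self_le_toNat (b - c)
      omega
    refine relation_eq_zero hw h1 hreg hdepth he hspan hmin N c hN _ (fun i =>
      MvPolynomial.weightedHomogeneousComponent_mem _ _ _) ?_
    have := congrArg (D.proj c) hrel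
    rw [map_sum, map_zero] at this
    rw [← this]
    refine Finset.sum_congr rfl fun i _ => ?_
    rw [proj_smul_of_mem (he i)]
  obtain ⟨A, hA⟩ := sum_polyComponent w J (f i)
  rw [← hA]
  refine Finset.sum_eq_zero fun c _ => ?_
  have := congrFun (hcomp (c + a i)) i
  simpa using this

end GrMod

/-! ### Equivariant vector bundles split -/

/-- A linear map between modules of sections that is an isomorphism on each of the open sets
`{z j ≠ 0}` of `X_J`: it has a two-sided inverse up to a power of `z j`. -/
def IsIsoOnX {M N : Type*} [AddCommGroup M] [AddCommGroup N] [Module (Coord J) M]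
    [Module (Coord J) N] (e : M →ₗ[Coord J] N) : Prop :=
  ∀ j : J, ∃ (k : ℕ) (e' : N →ₗ[Coord J] M),
    (∀ y, e (e' y) = (MvPolynomial.X j ^ k : Coord J) • y) ∧
    (∀ x, e' (e x) = (MvPolynomial.X j ^ k : Coord J) • x)

/-- The restriction of `M` to `X_J` is isomorphic to the direct sum of the line bundles attached
to the characters `t ↦ t ^ a i`. -/
def Splits (M : EquivBundle w J) {ι : Type} (a : ι → ℤ) : Prop :=
  ∃ e : M.carrier →ₗ[Coord J] (ι → Coord J),
    (∀ t s i, e (M.act t s) i = MvPolynomial.C ((t ^ a i : ℂˣ) : ℂ) * translate w J t (e s i)) ∧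
    IsIsoOnX e

theorem translate_inv_translate (t : ℂˣ) (f : Coord J) :
    translate w J t (translate w J t⁻¹ f) = f := by
  rw [← translate_mul, mul_inv_cancel, translate_one]; rfl

/-- Forgetting that the restriction to `X_J` is locally free. -/
@[reducible] def EquivBundle.toGr (M : EquivBundle w J) : GrMod w J :=
  letI : Module ℂ M.carrier := Module.compHom _ (MvPolynomial.C : ℂ →+* Coord J)
  haveI : IsScalarTower ℂ (Coord J) M.carrier := ⟨fun c f m => by
    change (c • f) • m = (MvPolynomial.C c : Coord J) • f • m
    rw [MvPolynomial.smul_eq_C_mul, mul_smul]⟩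
  { carrier := M.carrier
    act := M.act
    act_smul := M.act_smul
    rational := M.rational }

theorem finite_dual (M : Type*) [AddCommGroup M] [Module (Coord J) M] [Module.Finite (Coord J) M] :
    Module.Finite (Coord J) (Module.Dual (Coord J) M) := by
  obtain ⟨n, π, hπ⟩ := Module.Finite.exists_fin' (Coord J) M
  refine Module.Finite.of_injective
    (LinearMap.lcomp (Coord J) (Coord J) π : Module.Dual (Coord J) M →ₗ[Coord J] _) ?_
  intro φ ψ h
  refine LinearMap.ext fun m => ?_
  obtain ⟨y, rfl⟩ := hπ m
  exact LinearMap.congr_fun h y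

namespace GrMod

/-- The action of `G` on linear functionals. -/
def dualAct (M : GrMod w J) : ℂˣ →* AddMonoid.End (Module.Dual (Coord J) M.carrier) where
  toFun t :=
    { toFun := fun φ =>
        { toFun := fun m => translate w J t (φ (M.act t⁻¹ m))
          map_add' := fun m m' => by simp only [map_add]
          map_smul' := fun f m => by
            rw [M.act_smul, map_smul, smul_eq_mul, map_mul, translate_inv_translate]; rfl }
      map_zero' := by ext m; simp
      map_add' := fun φ ψ => by ext1 m; simp }
  map_one' := by
    ext1 φ
    ext1 m
    change translate w J 1 (φ (M.act 1⁻¹ m)) = φ m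
    rw [translate_one, inv_one, map_one]; rfl
  map_mul' s t := by
    ext1 φ
    ext1 m
    change translate w J (s * t) (φ (M.act (s * t)⁻¹ m)) =
      translate w J s (translate w J t (φ (M.act t⁻¹ (M.act s⁻¹ m))))
    rw [translate_mul, mul_inv_rev, map_mul]; rfl

theorem dualAct_apply (M : GrMod w J) (t : ℂˣ) (φ : Module.Dual (Coord J) M.carrier)
    (m : M.carrier) : M.dualAct t φ m = translate w J t (φ (M.act t⁻¹ m)) := rfl

/-- The component of weight `a` of a linear functional, as a map linear over the scalars: on the
sections of weight `b` it is the component of weight `a + b` of the functional. -/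
def dualCompAux (M : GrMod w J) (φ : Module.Dual (Coord J) M.carrier) (a : ℤ) :
    M.carrier →ₗ[ℂ] Coord J :=
  DirectSum.toModule ℂ ℤ (Coord J) (fun b =>
    MvPolynomial.weightedHomogeneousComponent (negWt w J) (a + b) ∘ₗ φ.restrictScalars ℂ ∘ₗ
      (M.weight b).subtype) ∘ₗ (DirectSum.decomposeLinearEquiv M.weight).toLinearMap

theorem dualCompAux_of_mem {M : GrMod w J} (φ : Module.Dual (Coord J) M.carrier) (a : ℤ) {b : ℤ}
    {m : M.carrier} (hm : m ∈ M.weight b) : M.dualCompAux φ a m =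
      MvPolynomial.weightedHomogeneousComponent (negWt w J) (a + b) (φ m) := by
  rw [dualCompAux, LinearMap.comp_apply, LinearEquiv.coe_coe,
    DirectSum.decomposeLinearEquiv_apply, DirectSum.decompose_of_mem _ hm,
    ← DirectSum.lof_eq_of ℂ, DirectSum.toModule_lof]
  rfl

/-- The component of weight `a` of a linear functional. -/
def dualComp (M : GrMod w J) (φ : Module.Dual (Coord J) M.carrier) (a : ℤ) :
    Module.Dual (Coord J) M.carrier where
  toFun := M.dualCompAux φ a
  map_add' := map_add _
  map_smul' f m := by
    obtain ⟨A, hA⟩ := sum_polyComponent w J f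
    rw [← hA, RingHom.id_apply, Finset.sum_smul, Finset.sum_smul, map_sum]
    refine Finset.sum_congr rfl fun c _ => ?_
    have hc := MvPolynomial.weightedHomogeneousComponent_mem (negWt w J) f c
    induction m using weight_induction with
    | hw b m hm =>
      rw [dualCompAux_of_mem φ a hm, dualCompAux_of_mem φ a (smul_mem_weight hc hm), map_smul,
        smul_eq_mul, smul_eq_mul, ← polyComponent_mul hc]
      congr 2
      ring
    | hadd m m' h h' => rw [smul_add, map_add, map_add, smul_add, h, h']

theorem dualComp_of_mem {M : GrMod w J} (φ : Module.Dual (Coord J) M.carrier) (a : ℤ) {b : ℤ}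
    {m : M.carrier} (hm : m ∈ M.weight b) : M.dualComp φ a m =
      MvPolynomial.weightedHomogeneousComponent (negWt w J) (a + b) (φ m) :=
  dualCompAux_of_mem φ a hm

/-- The dual of an equivariant coherent sheaf. -/
@[reducible] def dual (M : GrMod w J) : GrMod w J :=
  haveI := finite_dual (J := J) M.carrier
  { carrier := Module.Dual (Coord J) M.carrier
    act := M.dualAct
    act_smul := fun t f φ => by
      ext1 m
      change translate w J t (f * φ (M.act t⁻¹ m)) = _
      rw [map_mul]; rfl
    rational := by
      rw [eq_top_iff]
      intro φ _
      obtain ⟨r, e, b, he, hspan⟩ := exists_weight_generators M ⊤ fun _ _ _ => trivial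
      choose A hA using fun i => sum_polyComponent w J (φ (e i))
      let B : Finset ℤ := Finset.univ.biUnion fun i => (A i).image fun a => a - b i
      have hφ : φ = ∑ a ∈ B, M.dualComp φ a := by
        refine LinearMap.ext_on_range hspan fun i => ?_
        rw [LinearMap.sum_apply]
        have h1 : ∀ a ∈ B, M.dualComp φ a (e i) =
          MvPolynomial.weightedHomogeneousComponent (negWt w J) (a + b i) (φ (e i)) := fun a _ =>
            dualComp_of_mem φ a (he i)
        rw [Finset.sum_congr rfl h1]
        have h2 : ∑ a ∈ (A i).image fun a => a - b i,
            MvPolynomial.weightedHomogeneousComponent (negWt w J) (a + b i) (φ (e i)) = φ (e i) := by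
          rw [Finset.sum_image (by intro x _ y _ h; simpa using h)]
          simp only [sub_add_cancel]
          exact hA i
        conv_lhs => rw [← h2]
        refine Finset.sum_subset (Finset.subset_biUnion_of_mem
          (fun i => (A i).image fun a => a - b i) (Finset.mem_univ i)) fun a _ ha => ?_
        -- a weight outside the list does not occur in the functional value
        conv_lhs => rw [← hA i]
        rw [map_sum]
        refine Finset.sum_eq_zero fun c hc => ?_
        rw [MvPolynomial.IsWeightedHomogeneous.weightedHomogeneousComponent_ne (a + b i) (m := c)
          (MvPolynomial.weightedHomogeneousComponent_mem (negWt w J) _ c)]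
        rintro rfl
        exact ha (Finset.mem_image.2 ⟨_, hc, by ring⟩)
      rw [hφ]
      refine AddSubgroup.sum_mem _ fun a _ => AddSubgroup.subset_closure ⟨a, fun t => ?_⟩
      ext1 m
      rw [dualAct_apply, LinearMap.smul_apply]
      induction m using weight_induction with
      | hw b m hm =>
        have h1 : M.act t⁻¹ m = ((t⁻¹ ^ b : ℂˣ) : ℂ) • m := hm _
        rw [h1, ← C_smul (J := J), map_smul, dualComp_of_mem φ a hm, smul_eq_mul, map_mul,
          mem_polyWeight_iff.1 (MvPolynomial.weightedHomogeneousComponent_mem (negWt w J) _ _)]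
        have h2 : translate w J t (MvPolynomial.C ((t⁻¹ ^ b : ℂˣ) : ℂ)) =
          MvPolynomial.C ((t⁻¹ ^ b : ℂˣ) : ℂ) := (translate w J t).commutes _
        rw [h2, ← mul_assoc, ← map_mul, ← Units.val_mul, MvPolynomial.smul_eq_C_mul]
        congr 3
        rw [zpow_add, inv_zpow]
        rw [mul_comm, mul_assoc, mul_inv_cancel, mul_one]
      | hadd m m' h h' => rw [map_add, map_add, map_add, map_add, h, h', smul_add] }

/-- The coordinates form a regular sequence on the dual module, of length at most two: linear
functionals may be divided by a coordinate that divides all of their values. -/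
theorem dual_depth (M : GrMod w J) :
    (∀ (j : J) (d : M.dual.carrier), (MvPolynomial.X j : Coord J) • d = 0 → d = 0) ∧
    (∀ (i j : J), i ≠ j → ∀ d d' : M.dual.carrier,
      (MvPolynomial.X i : Coord J) • d = (MvPolynomial.X j : Coord J) • d' →
        ∃ d'' : M.dual.carrier, d = (MvPolynomial.X j : Coord J) • d'') := by
  constructor
  · intro j d hd
    ext1 m
    have : MvPolynomial.X j * d m = 0 := LinearMap.congr_fun hd m
    exact (mul_eq_zero.1 this).resolve_left (MvPolynomial.X_ne_zero j)
  · intro i j hij d d' h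
    have hdvd : ∀ m, (MvPolynomial.X j : Coord J) ∣ d m := by
      intro m
      have h1 : MvPolynomial.X i * d m = MvPolynomial.X j * d' m := LinearMap.congr_fun h m
      have h2 : (MvPolynomial.X j : Coord J) ∣ MvPolynomial.X i * d m := ⟨_, h1⟩
      refine (MvPolynomial.X_prime.dvd_or_dvd h2).resolve_left fun h3 => hij ?_
      exact (MvPolynomial.X_dvd_X.1 h3).symm
    choose q hq using hdvd
    have hX := MvPolynomial.X_ne_zero (R := ℂ) j
    refine ⟨⟨⟨q, fun m m' => ?_⟩, fun f m => ?_⟩, ?_⟩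
    · apply mul_left_cancel₀ hX
      rw [← hq, mul_add, ← hq, ← hq, map_add]
    · apply mul_left_cancel₀ hX
      rw [← hq, map_smul, hq, RingHom.id_apply, smul_eq_mul, smul_eq_mul]; ring
    · exact LinearMap.ext hq

end GrMod

/-- If a finitely generated module is projective where `z j ≠ 0`, multiplication by a power of
`z j` factors through a free module. -/
theorem exists_dual_family {M : Type*} [AddCommGroup M] [Module (Coord J) M]
    [Module.Finite (Coord J) M] (j : J)
    (hproj : Module.Projective
      (Localization (Submonoid.powers (MvPolynomial.X j : Coord J)))
      (LocalizedModule (Submonoid.powers (MvPolynomial.X j : Coord J)) M)) :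
    ∃ (q : ℕ) (m : Fin q → M) (σ : Fin q → Module.Dual (Coord J) M) (k : ℕ),
      ∀ y, ∑ i, σ i y • m i = (MvPolynomial.X j ^ k : Coord J) • y := by
  let S := Submonoid.powers (MvPolynomial.X j : Coord J)
  obtain ⟨q, π, hπ⟩ := Module.Finite.exists_fin' (Coord J) M
  let F := Fin q → Coord J
  let πS : LocalizedModule S F →ₗ[Localization S] LocalizedModule S M := LocalizedModule.map S π
  have hπS : Function.Surjective πS := LocalizedModule.map_surjective S π hπ
  obtain ⟨s, hs⟩ := Module.projective_lifting_property πS LinearMap.id hπS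
  let ιM := LocalizedModule.mkLinearMap S M
  let ιF := LocalizedModule.mkLinearMap S F
  have : Module.FinitePresentation (Coord J) M := Module.finitePresentation_of_finite _ _
  obtain ⟨h, ⟨s₀, k₀, hk₀⟩, hh⟩ := Module.FinitePresentation.exists_lift_of_isLocalizedModule S ιF
    ((s.restrictScalars (Coord J)) ∘ₗ ιM)
  have hcomp : ιM ∘ₗ (π ∘ₗ h) = ιM ∘ₗ (s₀ • LinearMap.id) := by
    ext y
    have h1 : ιF (h y) = s₀ • s (ιM y) := LinearMap.congr_fun hh y
    have h2 : ιM (π (h y)) = πS (ιF (h y)) := by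
      simp [ιM, ιF, πS, LocalizedModule.mkLinearMap_apply]
    have h3 : πS (s (ιM y)) = ιM y := LinearMap.congr_fun hs (ιM y)
    change ιM (π (h y)) = ιM (s₀ • y)
    rw [h2, h1]
    have h4 : πS (s₀ • s (ιM y)) = s₀ • πS (s (ιM y)) := LinearMap.map_smul_of_tower πS s₀ _
    exact h4.trans ((congrArg _ h3).trans (map_smul ιM s₀ y).symm)
  obtain ⟨⟨_, k₁, rfl⟩, hs₁⟩ := Module.Finite.exists_smul_of_comp_eq_of_isLocalizedModule S ιM _ _ hcomp
  refine ⟨q, fun i => π (Pi.single i 1),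
    fun i => (MvPolynomial.X j ^ k₁ : Coord J) • (LinearMap.proj i ∘ₗ h), k₁ + k₀, fun y => ?_⟩
  have h1 : (MvPolynomial.X j ^ k₁ : Coord J) • π (h y) = (MvPolynomial.X j ^ k₁ : Coord J) • s₀ • y :=
    LinearMap.congr_fun hs₁ y
  have hk₀' : (MvPolynomial.X j ^ k₀ : Coord J) = s₀ := hk₀
  rw [pow_add, mul_smul, hk₀', ← h1]
  have h2 : h y = ∑ i, h y i • (Pi.single i 1 : F) := by
    ext1 i
    simp [Finset.sum_apply, Pi.single_apply]
  conv_rhs => rw [h2, map_sum, Finset.smul_sum]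
  refine Finset.sum_congr rfl fun i _ => ?_
  rw [map_smul, smul_smul]; rfl

/-- Every equivariant vector bundle on `X_J` is a direct sum of line bundles attached to
characters: a basis of weight vectors of the dual module provides the isomorphism. -/
theorem exists_splits (hw : ∀ j, 0 < w j) (h1 : (1 : Fin 2) ∈ J) (M : EquivBundle w J) :
    ∃ (r : ℕ) (a : Fin r → ℤ), Splits M a := by
  obtain ⟨hreg, hdepth⟩ := GrMod.dual_depth M.toGr
  obtain ⟨r, φ, b, hφ, hli, hspan⟩ :=
    GrMod.exists_weight_basis M.toGr.dual hw h1 hreg hdepth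
  let e : M.carrier →ₗ[Coord J] (Fin r → Coord J) := LinearMap.pi φ
  refine ⟨r, fun i => -b i, e, ?_, ?_⟩
  · intro t s i
    have h := LinearMap.congr_fun (hφ i t⁻¹) s
    change translate w J t⁻¹ (φ i (M.act t⁻¹⁻¹ s)) = ((t⁻¹ ^ b i : ℂˣ) : ℂ) • φ i s at h
    rw [inv_inv] at h
    have h' := congrArg (translate w J t) h
    rw [translate_inv_translate, map_smul] at h'
    change φ i (M.act t s) = _ * translate w J t (φ i s)
    rw [h', MvPolynomial.smul_eq_C_mul, zpow_neg, inv_zpow]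
  · intro j
    obtain ⟨q, m, σ, k, hσ⟩ := exists_dual_family j (M.locallyFree j)
    have hs : ∀ i, ∃ s : Fin r → Coord J, ∑ l, s l • φ l = σ i := fun i =>
      (Submodule.mem_span_range_iff_exists_fun _).1 (hspan ▸ trivial)
    choose s hs using hs
    let e' : (Fin r → Coord J) →ₗ[Coord J] M.carrier :=
      ∑ l, LinearMap.toSpanSingleton (Coord J) M.carrier (∑ i, s i l • m i) ∘ₗ LinearMap.proj l
    have he' : ∀ y, e' y = ∑ l, y l • ∑ i, s i l • m i := fun y => by
      simp [e', LinearMap.sum_apply]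
    have hee : ∀ x, e' (e x) = (MvPolynomial.X j ^ k : Coord J) • x := by
      intro x
      rw [he', ← hσ]
      simp only [Finset.smul_sum]
      rw [Finset.sum_comm]
      refine Finset.sum_congr rfl fun i _ => ?_
      rw [← hs i, LinearMap.sum_apply, Finset.sum_smul]
      refine Finset.sum_congr rfl fun l _ => ?_
      rw [smul_smul, mul_comm]; rfl
    refine ⟨k, e', fun y => ?_, hee⟩
    -- `e ∘ e' - z j ^ k` vanishes after composition with `e`; its rows are relations of the basis
    let B : (Fin r → Coord J) →ₗ[Coord J] (Fin r → Coord J) :=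
      e ∘ₗ e' - (MvPolynomial.X j ^ k : Coord J) • LinearMap.id
    have hB : ∀ x, B (e x) = 0 := by
      intro x
      change e (e' (e x)) - (MvPolynomial.X j ^ k : Coord J) • e x = 0
      rw [hee, map_smul, sub_self]
    have hB1 : ∀ l l', B (Pi.single l 1) l' = 0 := by
      intro l l'
      refine Fintype.linearIndependent_iff.1 hli (fun l => B (Pi.single l 1) l') ?_ l
      ext1 x
      have h2 : e x = ∑ l, φ l x • (Pi.single l 1 : Fin r → Coord J) := by
        ext1 i
        simp [Finset.sum_apply, Pi.single_apply, e]
      have h3 := congrFun (hB x) l'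
      rw [h2, map_sum, Finset.sum_apply] at h3
      rw [LinearMap.sum_apply, LinearMap.zero_apply]
      rw [Pi.zero_apply] at h3
      rw [← h3]
      refine Finset.sum_congr rfl fun l _ => ?_
      rw [map_smul, Pi.smul_apply, LinearMap.smul_apply, smul_eq_mul, smul_eq_mul, mul_comm]
    have hB2 : B = 0 := by
      refine LinearMap.pi_ext' fun l => LinearMap.ext_ring ?_
      ext1 l'
      exact hB1 l l'
    have h4 : B y = 0 := by rw [hB2]; rfl
    exact sub_eq_zero.1 h4

/-! ### Direct sums of line bundles -/

/-- The direct sum of the line bundles attached to the characters `t ↦ t ^ a i`. -/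
def freeBundle (w : Fin 2 → ℕ) (J : Set (Fin 2)) {ι : Type} [Finite ι] (a : ι → ℤ) :
    EquivBundle w J where
  carrier := ι → Coord J
  act :=
    { toFun := fun t =>
        { toFun := fun s i => (lineBundle w J (a i)).act t (s i)
          map_zero' := by
            funext i
            exact map_zero ((lineBundle w J (a i)).act t)
          map_add' := fun s s' => by
            funext i
            exact map_add ((lineBundle w J (a i)).act t) _ _ }
      map_one' := by
        ext1 s
        funext i
        change (lineBundle w J (a i)).act 1 (s i) = s i
        rw [map_one]; rfl
      map_mul' := fun t t' => by
        ext1 s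
        funext i
        change (lineBundle w J (a i)).act (t * t') (s i) = _
        rw [map_mul]; rfl }
  act_smul := fun t f s => by
    funext i
    exact (lineBundle w J (a i)).act_smul t f (s i)
  rational := by
    classical
    cases nonempty_fintype ι
    rw [eq_top_iff]
    intro s _
    rw [← Finset.univ_sum_single s]
    refine AddSubgroup.sum_mem _ fun i _ => ?_
    have hi : (s i : (lineBundle w J (a i)).carrier) ∈ AddSubgroup.closure
        {s : (lineBundle w J (a i)).carrier | ∃ b : ℤ, ∀ t : ℂˣ,
          (lineBundle w J (a i)).act t s = (MvPolynomial.C ((t ^ b : ℂˣ) : ℂ) : Coord J) • s} := by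
      rw [(lineBundle w J (a i)).rational]; trivial
    change (AddMonoidHom.single (fun _ : ι => Coord J) i) (s i) ∈ _
    rw [← AddSubgroup.mem_comap]
    refine (AddSubgroup.closure_le _).2 ?_ hi
    rintro f ⟨b, hb⟩
    refine AddSubgroup.subset_closure ⟨b, fun t => ?_⟩
    funext k
    change (lineBundle w J (a k)).act t ((Pi.single i f : ι → Coord J) k) =
      MvPolynomial.C _ * (Pi.single i f : ι → Coord J) k
    by_cases h : k = i
    · subst h
      rw [Pi.single_eq_same]
      exact hb t
    · rw [Pi.single_eq_of_ne h]
      exact (map_zero ((lineBundle w J (a k)).act t)).trans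
        (mul_zero (MvPolynomial.C ((t ^ b : ℂˣ) : ℂ) : Coord J)).symm
  locallyFree := fun j => Module.projective_of_isLocalizedModule
    (Submonoid.powers (MvPolynomial.X j : Coord J))
    (LocalizedModule.mkLinearMap (Submonoid.powers (MvPolynomial.X j : Coord J)) (ι → Coord J))

theorem freeBundle_act {ι : Type} [Finite ι] (a : ι → ℤ) (t : ℂˣ)
    (s : (freeBundle w J a).carrier) (i : ι) : (freeBundle w J a).act t s i =
      MvPolynomial.C ((t ^ a i : ℂˣ) : ℂ) * translate w J t ((s : ι → Coord J) i) := rfl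

/-! ### Exactness on `X_J` in terms of elements -/

theorem localized_map_mk {M N : Type*} [AddCommGroup M] [AddCommGroup N] [Module (Coord J) M]
    [Module (Coord J) N] (S : Submonoid (Coord J)) (f : M →ₗ[Coord J] N) (m : M) (s : S) :
    LocalizedModule.map S f (LocalizedModule.mk m s) = LocalizedModule.mk (f m) s := by
  simp

theorem localized_mk_eq_zero {M : Type*} [AddCommGroup M] [Module (Coord J) M] (x : Coord J) (m : M)
    (s : Submonoid.powers x) :
    (LocalizedModule.mk m s : LocalizedModule (Submonoid.powers x) M) = 0 ↔
      ∃ k : ℕ, x ^ k • m = 0 := by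
  rw [← LocalizedModule.zero_mk s, LocalizedModule.mk_eq]
  constructor
  · rintro ⟨⟨_, k, rfl⟩, h⟩
    obtain ⟨_, k', rfl⟩ := s
    refine ⟨k + k', ?_⟩
    rw [smul_zero, smul_zero] at h
    rw [pow_add, mul_smul]
    exact h
  · rintro ⟨k, hk⟩
    refine ⟨⟨_, k, rfl⟩, ?_⟩
    rw [smul_zero, smul_zero]
    change x ^ k • s • m = 0
    rw [smul_comm, hk, smul_zero]

/-- Exactness on `X_J`, in terms of sections on `V_J`. -/
structure ElemExact {M' M M'' : Type*} [AddCommGroup M'] [AddCommGroup M] [AddCommGroup M'']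
    [Module (Coord J) M'] [Module (Coord J) M] [Module (Coord J) M'']
    (f : M' →ₗ[Coord J] M) (g : M →ₗ[Coord J] M'') : Prop where
  inj : ∀ (j : J) m, f m = 0 → ∃ k : ℕ, (MvPolynomial.X j ^ k : Coord J) • m = 0
  comp : ∀ (j : J) m, ∃ k : ℕ, (MvPolynomial.X j ^ k : Coord J) • g (f m) = 0
  exact : ∀ (j : J) m, g m = 0 → ∃ (k : ℕ) (m' : M'), (MvPolynomial.X j ^ k : Coord J) • m = f m'
  surj : ∀ (j : J) y, ∃ (k : ℕ) (m : M), (MvPolynomial.X j ^ k : Coord J) • y = g m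

/-- As `X_J` is covered by the open sets `{z j ≠ 0}`, exactness on `X_J` means exactness up to
powers of each of the coordinates. -/
theorem shortExactOnX_iff {M' M M'' : Type} [AddCommGroup M'] [AddCommGroup M] [AddCommGroup M'']
    [Module (Coord J) M'] [Module (Coord J) M] [Module (Coord J) M'']
    (f : M' →ₗ[Coord J] M) (g : M →ₗ[Coord J] M'') : ShortExactOnX f g ↔ ElemExact f g := by
  constructor
  · intro h
    constructor
    · intro j m hm
      have h1 := (h j).1
      have : (LocalizedModule.mk m 1 :
          LocalizedModule (Submonoid.powers (MvPolynomial.X j : Coord J)) M') = 0 := by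
        apply h1
        rw [localized_map_mk, hm, map_zero, LocalizedModule.zero_mk]
      exact (localized_mk_eq_zero _ _ _).1 this
    · intro j m
      have h1 := (h j).2.1.apply_apply_eq_zero (LocalizedModule.mk m 1)
      rw [localized_map_mk, localized_map_mk] at h1
      exact (localized_mk_eq_zero _ _ _).1 h1
    · intro j m hm
      have h1 := ((h j).2.1 (LocalizedModule.mk m 1)).1 (by
        rw [localized_map_mk, hm, LocalizedModule.zero_mk])
      obtain ⟨y, hy⟩ := h1
      induction y using LocalizedModule.induction_on with
      | h m' s =>
        rw [localized_map_mk, LocalizedModule.mk_eq] at hy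
        obtain ⟨⟨_, k, rfl⟩, hy⟩ := hy
        obtain ⟨_, k', rfl⟩ := s
        refine ⟨k + k', (MvPolynomial.X j ^ k : Coord J) • m', ?_⟩
        rw [one_smul] at hy
        rw [map_smul, pow_add, mul_smul]
        exact hy.symm
    · intro j y
      obtain ⟨z, hz⟩ := (h j).2.2 (LocalizedModule.mk y 1)
      induction z using LocalizedModule.induction_on with
      | h m s =>
        rw [localized_map_mk, LocalizedModule.mk_eq] at hz
        obtain ⟨⟨_, k, rfl⟩, hz⟩ := hz
        obtain ⟨_, k', rfl⟩ := s
        refine ⟨k + k', (MvPolynomial.X j ^ k : Coord J) • m, ?_⟩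
        rw [one_smul] at hz
        rw [map_smul, pow_add, mul_smul]
        exact hz.symm
  · intro h j
    refine ⟨?_, ?_, ?_⟩
    · rw [injective_iff_map_eq_zero]
      intro z hz
      induction z using LocalizedModule.induction_on with
      | h m s =>
        rw [localized_map_mk, localized_mk_eq_zero] at hz
        obtain ⟨k, hk⟩ := hz
        rw [← map_smul] at hk
        obtain ⟨k', hk'⟩ := h.inj j _ hk
        rw [localized_mk_eq_zero]
        exact ⟨k' + k, by rw [pow_add, mul_smul, hk']⟩
    · intro z
      constructor
      · intro hz
        induction z using LocalizedModule.induction_on with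
        | h m s =>
          rw [localized_map_mk, localized_mk_eq_zero] at hz
          obtain ⟨k, hk⟩ := hz
          rw [← map_smul] at hk
          obtain ⟨k', m', hk'⟩ := h.exact j _ hk
          refine ⟨LocalizedModule.mk m' (⟨_, k' + k, rfl⟩ * s), ?_⟩
          rw [localized_map_mk, LocalizedModule.mk_eq]
          refine ⟨1, ?_⟩
          rw [one_smul, one_smul, mul_comm, mul_smul, ← hk', smul_smul, ← pow_add]
          rfl
      · rintro ⟨y, rfl⟩
        induction y using LocalizedModule.induction_on with
        | h m s =>
          rw [localized_map_mk, localized_map_mk, localized_mk_eq_zero]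
          exact h.comp j m
    · intro z
      induction z using LocalizedModule.induction_on with
      | h y s =>
        obtain ⟨k, m, hk⟩ := h.surj j y
        refine ⟨LocalizedModule.mk m (⟨_, k, rfl⟩ * s), ?_⟩
        rw [localized_map_mk, LocalizedModule.mk_eq]
        refine ⟨1, ?_⟩
        rw [one_smul, one_smul, mul_comm, mul_smul, ← hk]
        rfl

/-! ### Hilbert functions -/

theorem finite_weight (hw : ∀ j, 0 < w j) (c : ℤ) :
    {s : J →₀ ℕ | Finsupp.weight (negWt w J) s = c}.Finite := by
  refine Set.Finite.subset (Set.finite_Icc 0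
    (Finsupp.equivFunOnFinite.symm fun _ => (-c).toNat)) fun s hs => ⟨zero_le, fun j => ?_⟩
  simp only [Set.mem_ofPred_eq] at hs
  rw [weight_negWt] at hs
  change s j ≤ (-c).toNat
  by_cases hj : s j = 0
  · omega
  have h1 : (w j * s j : ℤ) ≤ s.sum fun j k => (w j * k : ℤ) :=
    Finset.single_le_sum (f := fun j : J => (w j * s j : ℤ)) (fun i _ => by positivity)
      (Finsupp.mem_support_iff.2 hj)
  have h2 : (s j : ℤ) ≤ w j * s j := by
    have := hw j
    exact_mod_cast Nat.le_mul_of_pos_left _ this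
  omega

theorem finiteDimensional_polyWeight (hw : ∀ j, 0 < w j) (c : ℤ) :
    FiniteDimensional ℂ (polyWeight w J c) := by
  have := (finite_weight (J := J) hw c).to_subtype
  have h := MvPolynomial.weightedHomogeneousSubmodule_eq_finsupp_supported ℂ (negWt w J) c
  unfold polyWeight
  rw [h]
  exact Module.Finite.equiv (AddMonoidAlgebra.supportedEquivFinsupp _).symm

theorem finrank_polyWeight (c : ℤ) : Module.finrank ℂ (polyWeight w J c) =
    Nat.card {s : J →₀ ℕ // Finsupp.weight (negWt w J) s = c} := by
  have h := MvPolynomial.weightedHomogeneousSubmodule_eq_finsupp_supported ℂ (negWt w J) c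
  unfold polyWeight
  rw [h]
  exact Module.finrank_eq_nat_card_basis ⟨AddMonoidAlgebra.supportedEquivFinsupp _⟩

namespace GrMod

theorem finiteDimensional_weight (M : GrMod w J) (hw : ∀ j, 0 < w j) (c : ℤ) :
    FiniteDimensional ℂ (M.weight c) := by
  obtain ⟨r, e, b, he, hspan⟩ := exists_weight_generators M ⊤ fun _ _ _ => trivial
  have := fun i => finiteDimensional_polyWeight (J := J) hw (c - b i)
  let L : (∀ i, polyWeight w J (c - b i)) →ₗ[ℂ] M.carrier :=
    { toFun := fun f => ∑ i, (f i : Coord J) • e i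
      map_add' := fun f g => by
        rw [← Finset.sum_add_distrib]
        exact Finset.sum_congr rfl fun i _ => add_smul _ _ _
      map_smul' := fun z f => by
        rw [RingHom.id_apply, Finset.smul_sum]
        exact Finset.sum_congr rfl fun i _ => smul_assoc z (f i : Coord J) (e i) }
  refine Submodule.finiteDimensional_of_le (S₂ := LinearMap.range L) fun m hm => ?_
  obtain ⟨f, hf⟩ := (Submodule.mem_span_range_iff_exists_fun (Coord J)).1
    (hspan.ge (Submodule.mem_top (x := m)))
  refine ⟨fun i => ⟨MvPolynomial.weightedHomogeneousComponent (negWt w J) (c - b i) (f i),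
    MvPolynomial.weightedHomogeneousComponent_mem _ _ _⟩, ?_⟩
  rw [← proj_of_mem hm, ← hf, map_sum]
  change ∑ i, MvPolynomial.weightedHomogeneousComponent (negWt w J) (c - b i) (f i) • e i = _
  exact Finset.sum_congr rfl fun i _ => (proj_smul_of_mem (he i) c (f i)).symm

/-- A homogeneous function of sufficiently negative weight is a combination of multiples of
high powers of the coordinates. -/
theorem smul_mem_of_weight_lt [Fintype J] {M : Type*} [AddCommGroup M] [Module (Coord J) M]
    {N : Submodule (Coord J) M} {p : M} {k : ℕ}
    (hp : ∀ j : J, (MvPolynomial.X j ^ k : Coord J) • p ∈ N) {d : ℤ}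
    (hd : d < -∑ j : J, (w j * k : ℤ)) {f : Coord J} (hf : f ∈ polyWeight w J d) : f • p ∈ N := by
  classical
  rw [f.as_sum, Finset.sum_smul]
  refine Submodule.sum_mem _ fun s hs => ?_
  obtain ⟨j, hj⟩ : ∃ j, k ≤ s j := by
    by_contra! h
    have h1 := hf (MvPolynomial.mem_support_iff.1 hs)
    rw [weight_negWt, Finsupp.sum_fintype _ _ (by simp)] at h1
    have h2 : ∑ j : J, (w j * s j : ℤ) ≤ ∑ j : J, (w j * k : ℤ) := by
      refine Finset.sum_le_sum fun j _ => ?_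
      have := (h j).le
      gcongr
    linarith
  have h1 : MvPolynomial.monomial s (f.coeff s) =
      MvPolynomial.monomial (s - Finsupp.single j k) (f.coeff s) * MvPolynomial.X j ^ k := by
    rw [MvPolynomial.X_pow_eq_monomial, MvPolynomial.monomial_mul, mul_one, tsub_add_cancel_of_le]
    exact Finsupp.single_le_iff.2 hj
  rw [h1, mul_smul]
  exact Submodule.smul_mem _ _ (hp j)

/-- If the quotient of graded submodules is supported at the origin, it vanishes in sufficiently
negative weights. -/
theorem eventually_mem (M : GrMod w J) (P N : Submodule (Coord J) M.carrier)
    (hP : ∀ a, ∀ m ∈ P, M.proj a m ∈ P)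
    (hPN : ∀ p ∈ P, ∀ j : J, ∃ k : ℕ, (MvPolynomial.X j ^ k : Coord J) • p ∈ N) :
    ∃ c₁ : ℤ, ∀ c ≤ c₁, ∀ p ∈ P, p ∈ M.weight c → p ∈ N := by
  classical
  cases nonempty_fintype J
  obtain ⟨r, e, b, he, hspan⟩ := exists_weight_generators M P hP
  have heP : ∀ i, e i ∈ P := fun i => hspan ▸ Submodule.subset_span ⟨i, rfl⟩
  choose k hk using fun (i : Fin r) (j : J) => hPN (e i) (heP i) j
  let K : ℕ := ∑ i, ∑ j, k i j
  have hkK : ∀ i j, k i j ≤ K := fun i j =>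
    (Finset.single_le_sum (f := fun j => k i j) (fun _ _ => Nat.zero_le _)
      (Finset.mem_univ j)).trans (Finset.single_le_sum (f := fun i => ∑ j, k i j)
        (fun _ _ => Nat.zero_le _) (Finset.mem_univ i))
  have hK : ∀ i (j : J), (MvPolynomial.X j ^ K : Coord J) • e i ∈ N := fun i j => by
    rw [← Nat.sub_add_cancel (hkK i j), pow_add, mul_smul]
    exact Submodule.smul_mem _ _ (hk i j)
  obtain ⟨b₀, hb₀⟩ := Finite.bddBelow_range b
  refine ⟨b₀ - ∑ j : J, (w j * K : ℤ) - 1, fun c hc p hpP hp => ?_⟩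
  obtain ⟨f, hf⟩ := (Submodule.mem_span_range_iff_exists_fun (Coord J)).1 (hspan ▸ hpP)
  rw [← proj_of_mem hp, ← hf, map_sum]
  refine Submodule.sum_mem _ fun i _ => ?_
  rw [proj_smul_of_mem (he i)]
  refine smul_mem_of_weight_lt (hK i) (d := c - b i) ?_
    (MvPolynomial.weightedHomogeneousComponent_mem (negWt w J) _ _)
  have := hb₀ ⟨i, rfl⟩
  linarith

/-- Hilbert functions are additive on sequences that are exact on `X_J`, in sufficiently negative
weights. -/
theorem finrank_weight_add (hw : ∀ j, 0 < w j) {A B C : GrMod w J}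
    (f : A.carrier →ₗ[Coord J] B.carrier) (g : B.carrier →ₗ[Coord J] C.carrier)
    (hf : ∀ t s, f (A.act t s) = B.act t (f s)) (hg : ∀ t s, g (B.act t s) = C.act t (g s))
    (h : ElemExact f g) : ∃ c₁ : ℤ, ∀ c ≤ c₁, Module.finrank ℂ (B.weight c) =
      Module.finrank ℂ (A.weight c) + Module.finrank ℂ (C.weight c) := by
  have hfC : ∀ (z : ℂ) m, f (z • m) = z • f m := fun z m => by
    rw [← C_smul (J := J), map_smul, C_smul]
  have hgC : ∀ (z : ℂ) m, g (z • m) = z • g m := fun z m => by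
    rw [← C_smul (J := J), map_smul, C_smul]
  have hfp := fun a m => map_proj (f := f.toAddMonoidHom) hfC hf a m
  have hgp := fun a m => map_proj (f := g.toAddMonoidHom) hgC hg a m
  have hfw : ∀ c, ∀ m ∈ A.weight c, f m ∈ B.weight c := fun c m hm t => by rw [← hf, hm t, hfC]
  have hgw : ∀ c, ∀ m ∈ B.weight c, g m ∈ C.weight c := fun c m hm t => by rw [← hg, hm t, hgC]
  obtain ⟨c₁, h₁⟩ := eventually_mem A (LinearMap.ker f) ⊥ (fun a m hm => by
    rw [LinearMap.mem_ker] at hm ⊢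
    exact (hfp a m).trans (by change B.proj a (f m) = 0; rw [hm, map_zero])) (fun m hm j => h.inj j m hm)
  obtain ⟨c₂, h₂⟩ := eventually_mem A ⊤ (LinearMap.ker (g ∘ₗ f)) (fun _ _ _ => trivial)
    (fun m _ j => by
      obtain ⟨k, hk⟩ := h.comp j m
      exact ⟨k, by rw [LinearMap.mem_ker, map_smul]; exact hk⟩)
  obtain ⟨c₃, h₃⟩ := eventually_mem B (LinearMap.ker g) (LinearMap.range f) (fun a m hm => by
    rw [LinearMap.mem_ker] at hm ⊢
    exact (hgp a m).trans (by change C.proj a (g m) = 0; rw [hm, map_zero])) (fun m hm j => by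
      obtain ⟨k, m', hk⟩ := h.exact j m hm
      exact ⟨k, m', hk.symm⟩)
  obtain ⟨c₄, h₄⟩ := eventually_mem C ⊤ (LinearMap.range g) (fun _ _ _ => trivial)
    (fun m _ j => by
      obtain ⟨k, m', hk⟩ := h.surj j m
      exact ⟨k, m', hk.symm⟩)
  refine ⟨min (min c₁ c₂) (min c₃ c₄), fun c hc => ?_⟩
  have hc1 : c ≤ c₁ := hc.trans ((min_le_left _ _).trans (min_le_left _ _))
  have hc2 : c ≤ c₂ := hc.trans ((min_le_left _ _).trans (min_le_right _ _))
  have hc3 : c ≤ c₃ := hc.trans ((min_le_right _ _).trans (min_le_left _ _))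
  have hc4 : c ≤ c₄ := hc.trans ((min_le_right _ _).trans (min_le_right _ _))
  let fc : A.weight c →ₗ[ℂ] B.weight c :=
    { toFun := fun m => ⟨f m, hfw c m m.2⟩
      map_add' := fun m m' => Subtype.ext (map_add f _ _)
      map_smul' := fun z m => Subtype.ext (hfC z m) }
  let gc : B.weight c →ₗ[ℂ] C.weight c :=
    { toFun := fun m => ⟨g m, hgw c m m.2⟩
      map_add' := fun m m' => Subtype.ext (map_add g _ _)
      map_smul' := fun z m => Subtype.ext (hgC z m) }
  have hinj : Function.Injective fc := by
    rw [injective_iff_map_eq_zero]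
    rintro ⟨m, hm⟩ h0
    exact Subtype.ext (h₁ c hc1 m (congrArg Subtype.val h0) hm)
  have hsurj : LinearMap.range gc = ⊤ := by
    rw [LinearMap.range_eq_top]
    rintro ⟨y, hy⟩
    obtain ⟨m, hm⟩ := h₄ c hc4 y trivial hy
    refine ⟨⟨B.proj c m, proj_mem c m⟩, Subtype.ext ?_⟩
    exact (hgp c m).trans (by change C.proj c (g m) = y; rw [hm, proj_of_mem hy])
  have hex : LinearMap.ker gc = LinearMap.range fc := by
    ext ⟨m, hm⟩
    constructor
    · intro h0
      obtain ⟨m', hm'⟩ := h₃ c hc3 m (congrArg Subtype.val h0) hm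
      refine ⟨⟨A.proj c m', proj_mem c m'⟩, Subtype.ext ?_⟩
      exact (hfp c m').trans (by change B.proj c (f m') = m; rw [hm', proj_of_mem hm])
    · rintro ⟨⟨m', hm'⟩, h0⟩
      rw [← h0]
      exact Subtype.ext (h₂ c hc2 m' trivial hm')
  have := finiteDimensional_weight B hw c
  have h5 := LinearMap.finrank_range_add_finrank_ker gc
  rw [hsurj, hex, LinearMap.finrank_range_of_inj hinj, finrank_top] at h5
  omega

end GrMod

theorem mem_weight_freeBundle {ι : Type} [Finite ι] (a : ι → ℤ) (c : ℤ)
    (s : ι → Coord J) : (s : (freeBundle w J a).toGr.carrier) ∈ (freeBundle w J a).toGr.weight c ↔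
      ∀ i, s i ∈ polyWeight w J (c - a i) := by
  have key : ∀ (t : ℂˣ) (i : ι), MvPolynomial.C ((t ^ a i : ℂˣ) : ℂ) * translate w J t (s i) =
      MvPolynomial.C ((t ^ c : ℂˣ) : ℂ) * s i ↔
      translate w J t (s i) = MvPolynomial.C ((t ^ (c - a i) : ℂˣ) : ℂ) * s i := by
    intro t i
    have h1 : (MvPolynomial.C ((t ^ c : ℂˣ) : ℂ) : Coord J) = MvPolynomial.C ((t ^ a i : ℂˣ) : ℂ) *
        MvPolynomial.C ((t ^ (c - a i) : ℂˣ) : ℂ) := by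
      rw [← map_mul, ← Units.val_mul, ← zpow_add]
      congr 4
      ring
    rw [h1, mul_assoc]
    refine ⟨fun h => mul_left_cancel₀ ?_ h, fun h => by rw [h]⟩
    rw [Ne, MvPolynomial.C_eq_zero]
    exact Units.ne_zero _
  constructor
  · intro h i
    rw [mem_polyWeight_iff]
    intro t
    exact (key t i).1 (congrFun (h t) i)
  · intro h t
    funext i
    exact (key t i).2 (mem_polyWeight_iff.1 (h i) t)

theorem finrank_weight_freeBundle (hw : ∀ j, 0 < w j) {ι : Type} [Fintype ι] (a : ι → ℤ) (c : ℤ) :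
    Module.finrank ℂ ((freeBundle w J a).toGr.weight c) =
      ∑ i, Module.finrank ℂ (polyWeight w J (c - a i)) := by
  have := fun i => finiteDimensional_polyWeight (J := J) hw (c - a i)
  rw [← Module.finrank_pi_fintype]
  refine LinearEquiv.finrank_eq
    { toFun := fun s i => ⟨(s.1 : ι → Coord J) i, (mem_weight_freeBundle a c s.1).1 s.2 i⟩
      invFun := fun s => ⟨fun i => s i, (mem_weight_freeBundle a c _).2 fun i => (s i).2⟩
      left_inv := fun s => rfl
      right_inv := fun s => rfl
      map_add' := fun s s' => rfl
      map_smul' := fun z s => ?_ }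
  funext i
  refine Subtype.ext ?_
  change MvPolynomial.C z * (s.1 : ι → Coord J) i = z • (s.1 : ι → Coord J) i
  rw [MvPolynomial.smul_eq_C_mul]

/-! ### The Hilbert functions for the weights `(1, n)` -/

theorem wt_pos (n : ℕ) [NeZero n] (j : Fin 2) : 0 < wt n j := by
  fin_cases j
  · exact one_pos
  · exact Nat.pos_of_ne_zero (NeZero.ne n)

/-- The Hilbert function of the coordinate ring of `V_J`, for the weights `(1, n)`. -/
def hilb (n : ℕ) (J : Set (Fin 2)) (c : ℤ) : ℕ := Module.finrank ℂ (polyWeight (wt n) J c)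

theorem weight_of_mem_of_mem (n : ℕ) (h0 : (0 : Fin 2) ∈ J) (h1 : (1 : Fin 2) ∈ J) (s : J →₀ ℕ) :
    Finsupp.weight (negWt (wt n) J) s = -(s ⟨0, h0⟩ + n * s ⟨1, h1⟩ : ℤ) := by
  have hs : s = Finsupp.single ⟨0, h0⟩ (s ⟨0, h0⟩) + Finsupp.single ⟨1, h1⟩ (s ⟨1, h1⟩) := by
    ext ⟨j, hj⟩
    fin_cases j <;> simp
  conv_lhs => rw [hs]
  rw [map_add, Finsupp.weight_single, Finsupp.weight_single]
  simp [negWt, wt]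
  ring

theorem weight_of_notMem (n : ℕ) (h0 : (0 : Fin 2) ∉ J) (h1 : (1 : Fin 2) ∈ J) (s : J →₀ ℕ) :
    Finsupp.weight (negWt (wt n) J) s = -(n * s ⟨1, h1⟩ : ℤ) := by
  have hs : s = Finsupp.single ⟨1, h1⟩ (s ⟨1, h1⟩) := by
    ext ⟨j, hj⟩
    fin_cases j
    · exact absurd hj h0
    · simp
  conv_lhs => rw [hs]
  rw [Finsupp.weight_single]
  simp [negWt, wt]
  ring

theorem hilb_of_mem (n : ℕ) [NeZero n] (h0 : (0 : Fin 2) ∈ J) (h1 : (1 : Fin 2) ∈ J) (d : ℕ) :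
    hilb n J (-d) = d / n + 1 := by
  have hn : 0 < n := Nat.pos_of_ne_zero (NeZero.ne n)
  rw [hilb, finrank_polyWeight, ← Nat.card_fin (d / n + 1)]
  refine Nat.card_congr
    { toFun := fun s => ⟨s.1 ⟨1, h1⟩, ?_⟩
      invFun := fun k => ⟨Finsupp.single (⟨0, h0⟩ : J) (d - n * k.1) +
        Finsupp.single (⟨1, h1⟩ : J) k.1, ?_⟩
      left_inv := fun s => ?_
      right_inv := fun k => ?_ }
  · have := s.2
    rw [weight_of_mem_of_mem n h0 h1, neg_inj] at this
    have h2 : s.1 ⟨0, h0⟩ + n * s.1 ⟨1, h1⟩ = d := by exact_mod_cast this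
    rw [Nat.lt_succ_iff, Nat.le_div_iff_mul_le hn, mul_comm]
    omega
  · rw [weight_of_mem_of_mem n h0 h1]
    have h2 : n * (k : ℕ) ≤ d := by
      rw [mul_comm, ← Nat.le_div_iff_mul_le hn]
      exact Nat.lt_succ_iff.1 k.2
    have h3 : (d - n * k : ℕ) + n * (k : ℕ) = d := by omega
    simp
    have h4 := congrArg (Nat.cast : ℕ → ℤ) h3
    rw [Nat.cast_add, Nat.cast_mul] at h4
    linarith
  · have := s.2
    rw [weight_of_mem_of_mem n h0 h1, neg_inj] at this
    have h2 : s.1 ⟨0, h0⟩ + n * s.1 ⟨1, h1⟩ = d := by exact_mod_cast this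
    refine Subtype.ext ?_
    ext ⟨j, hj⟩
    fin_cases j
    · simp; omega
    · simp
  · simp

theorem hilb_of_notMem (n : ℕ) [NeZero n] (h0 : (0 : Fin 2) ∉ J) (h1 : (1 : Fin 2) ∈ J) (d : ℕ) :
    hilb n J (-d) = if n ∣ d then 1 else 0 := by
  have hn : 0 < n := Nat.pos_of_ne_zero (NeZero.ne n)
  rw [hilb, finrank_polyWeight]
  have key : ∀ s : J →₀ ℕ, Finsupp.weight (negWt (wt n) J) s = -(d : ℤ) ↔ n * s ⟨1, h1⟩ = d := by
    intro s
    rw [weight_of_notMem n h0 h1, neg_inj]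
    exact_mod_cast Iff.rfl
  split_ifs with h
  · obtain ⟨q, rfl⟩ := h
    rw [Nat.card_eq_one_iff_unique]
    refine ⟨⟨fun s s' => Subtype.ext ?_⟩, ⟨⟨Finsupp.single ⟨1, h1⟩ q, ?_⟩⟩⟩
    · have e1 := (key _).1 s.2
      have e2 := (key _).1 s'.2
      ext ⟨j, hj⟩
      fin_cases j
      · exact absurd hj h0
      · exact Nat.eq_of_mul_eq_mul_left hn (e1.trans e2.symm)
    · rw [key]; simp
  · rw [Nat.card_eq_zero]
    left
    exact ⟨fun s => h ⟨_, ((key _).1 s.2).symm⟩⟩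

/-! ### The Hilbert function determines the class -/

open Classical in
/-- The relations satisfied by the class `x` in `K_G(X_J)`, for the weights `(1, n)`. -/
def Admissible (n : ℕ) (J : Set (Fin 2)) {A : Type*} [CommRing A] (u : Aˣ) : Prop :=
  ((u : A) ^ n - 1) * (if (0 : Fin 2) ∈ J then (u : A) - 1 else 1) = 0

section

variable {A : Type*} [CommRing A]

/-- For `n ≤ d` exactly one `r < n` is congruent to `d` modulo `n`. -/
theorem sum_pow_ite_dvd (n : ℕ) [NeZero n] (v : A) {d : ℕ} (hd : n ≤ d) :
    ∑ r ∈ Finset.range n, v ^ r * (if n ∣ d - r then 1 else 0) = v ^ (d % n) := by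
  have hn : 0 < n := Nat.pos_of_ne_zero (NeZero.ne n)
  rw [Finset.sum_eq_single (d % n)]
  · rw [if_pos (Nat.dvd_sub_mod d), mul_one]
  · intro r hr hne
    rw [if_neg, mul_zero]
    intro h
    have hr' := Finset.mem_range.1 hr
    apply hne
    have := (Nat.modEq_iff_dvd' (by omega)).2 h
    rw [← this, Nat.mod_eq_of_lt hr']
  · intro h
    exact absurd (Finset.mem_range.2 (Nat.mod_lt _ hn)) h

/-- Reduction of powers modulo the polynomial `(X ^ n - 1) * (X - 1)`: by the relation, `v` acts as
the identity on `v ^ n - 1`. -/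
theorem pow_eq_of_relation {n : ℕ} {v : A} (hv : (v ^ n - 1) * (v - 1) = 0) (d : ℕ) :
    v ^ d = v ^ (d % n) + (d / n : ℕ) * (v ^ n - 1) := by
  have h1 : ∀ r : ℕ, (v ^ n - 1) * v ^ r = v ^ n - 1 := by
    intro r
    induction r with
    | zero => simp
    | succ r ih =>
      rw [pow_succ, ← mul_assoc, ih]
      linear_combination hv
  have h2 : ∀ q : ℕ, v ^ (n * q) = 1 + q * (v ^ n - 1) := by
    intro q
    induction q with
    | zero => simp
    | succ q ih =>
      rw [Nat.mul_succ, pow_add, ih]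
      push_cast
      linear_combination q * h1 n
  conv_lhs => rw [← Nat.div_add_mod d n, pow_add, h2, add_mul, one_mul, mul_assoc, h1]

/-- A power of `u` is a combination of values of a translate of the Hilbert function, with
coefficients that do not depend on the exponent. -/
theorem exists_zpow_eq_sum_hilb (n : ℕ) [NeZero n] (h1 : (1 : Fin 2) ∈ J) {u : Aˣ}
    (hu : Admissible n J u) (c₀ : ℤ) : ∃ α : ℕ → A, ∀ a : ℤ, c₀ + n ≤ a →
      ((u ^ a : Aˣ) : A) = ∑ r ∈ Finset.range (n + 1), α r * (hilb n J (c₀ + r - a) : A) := by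
  classical
  by_cases h0 : (0 : Fin 2) ∈ J
  · have hrel : ((u : A) ^ n - 1) * ((u : A) - 1) = 0 := by
      have := hu
      rwa [Admissible, if_pos h0] at this
    let β : ℕ → A := fun r => (u : A) ^ r
    refine ⟨fun r => ((u ^ c₀ : Aˣ) : A) * ((if r < n then β r else 0) -
      (if r = 0 then 0 else β (r - 1)) + if r = n then (u : A) ^ n - 1 else 0), fun a ha => ?_⟩
    obtain ⟨d, hd⟩ : ∃ d : ℕ, a = c₀ + d := ⟨(a - c₀).toNat, by omega⟩
    subst hd
    have hnd : n ≤ d := by omega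
    have hh : ∀ r, r ≤ n → hilb n J (c₀ + r - (c₀ + d)) = (d - r) / n + 1 := by
      intro r hr
      rw [← hilb_of_mem n h0 h1]
      congr 1
      omega
    let η : ℕ → A := fun r => (hilb n J (c₀ + r - (c₀ + d)) : A)
    have hdiff : ∀ r, r < n → η r - η (r + 1) = if n ∣ d - r then 1 else 0 := by
      intro r hr
      simp only [η]
      have e := hh (r + 1) (by omega)
      rw [hh r hr.le, e]
      have e2 : d - r = (d - (r + 1)) + 1 := by omega
      rw [e2, Nat.succ_div]
      split_ifs <;> push_cast <;> ring
    have hsum : ∑ r ∈ Finset.range (n + 1), ((if r < n then β r else 0) -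
        (if r = 0 then 0 else β (r - 1)) + if r = n then (u : A) ^ n - 1 else 0) * η r =
        ∑ r ∈ Finset.range n, β r * (η r - η (r + 1)) + ((u : A) ^ n - 1) * η n := by
      simp only [add_mul, sub_mul, Finset.sum_add_distrib, Finset.sum_sub_distrib, mul_sub (β _)]
      congr 1
      · congr 1
        · rw [Finset.sum_range_succ, if_neg (lt_irrefl n), zero_mul, add_zero]
          exact Finset.sum_congr rfl fun r hr => by rw [if_pos (Finset.mem_range.1 hr)]
        · rw [Finset.sum_range_succ', if_pos rfl, zero_mul, add_zero]
          exact Finset.sum_congr rfl fun r _ => by rw [if_neg (Nat.succ_ne_zero r)]; rfl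
      · simp [ite_mul, Finset.sum_ite_eq']
        ring
    have hηn : η n = (d / n : ℕ) := by
      simp only [η]
      rw [hh n le_rfl]
      have : d / n = (d - n) / n + 1 := Nat.div_eq_sub_div (Nat.pos_of_ne_zero (NeZero.ne n)) hnd
      rw [this]
    simp only [mul_assoc]
    rw [← Finset.mul_sum]
    change _ = _ * ∑ r ∈ Finset.range (n + 1), _ * η r
    rw [hsum, Finset.sum_congr rfl fun r hr => by rw [hdiff r (Finset.mem_range.1 hr)],
      sum_pow_ite_dvd n _ hnd, hηn, zpow_add, Units.val_mul]
    congr 1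
    rw [zpow_natCast, Units.val_pow_eq_pow_val, pow_eq_of_relation hrel d, mul_comm ((u : A) ^ n - 1)]
  · have hrel : (u : A) ^ n = 1 := by
      have := hu
      rw [Admissible, if_neg h0, mul_one] at this
      exact sub_eq_zero.1 this
    refine ⟨fun r => ((u ^ c₀ : Aˣ) : A) * if r < n then (u : A) ^ r else 0, fun a ha => ?_⟩
    obtain ⟨d, hd⟩ : ∃ d : ℕ, a = c₀ + d := ⟨(a - c₀).toNat, by omega⟩
    subst hd
    have hnd : n ≤ d := by omega
    simp only [mul_assoc]
    rw [← Finset.mul_sum, Finset.sum_range_succ, if_neg (lt_irrefl n), zero_mul, add_zero,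
      zpow_add, Units.val_mul]
    congr 1
    have hh : ∀ r ∈ Finset.range n, (if r < n then (u : A) ^ r else 0) *
        (hilb n J (c₀ + r - (c₀ + d)) : A) = (u : A) ^ r * (if n ∣ d - r then 1 else 0) := by
      intro r hr
      have hr' := Finset.mem_range.1 hr
      have e : (c₀ + r - (c₀ + d) : ℤ) = -((d - r : ℕ) : ℤ) := by omega
      rw [if_pos hr', e, hilb_of_notMem n h0 h1]
      split_ifs <;> simp
    rw [Finset.sum_congr rfl hh, sum_pow_ite_dvd n _ hnd, zpow_natCast, Units.val_pow_eq_pow_val]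
    conv_lhs => rw [← Nat.div_add_mod d n, pow_add, pow_mul, hrel, one_pow, one_mul]

/-- Families of exponents with the same Hilbert function have the same class. -/
theorem sum_zpow_eq_of_hilb (n : ℕ) [NeZero n] (h1 : (1 : Fin 2) ∈ J) {u : Aˣ}
    (hu : Admissible n J u) {ι κ : Type*} [Fintype ι] [Fintype κ] (a : ι → ℤ) (b : κ → ℤ)
    (c₁ : ℤ) (h : ∀ c ≤ c₁, ∑ i, hilb n J (c - a i) = ∑ j, hilb n J (c - b j)) :
    ∑ i, ((u ^ a i : Aˣ) : A) = ∑ j, ((u ^ b j : Aˣ) : A) := by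
  obtain ⟨a₀, ha₀⟩ := Finite.bddBelow_range a
  obtain ⟨b₀, hb₀⟩ := Finite.bddBelow_range b
  have ha : ∀ i, a₀ ≤ a i := fun i => ha₀ ⟨i, rfl⟩
  have hb : ∀ i, b₀ ≤ b i := fun i => hb₀ ⟨i, rfl⟩
  obtain ⟨α, hα⟩ := exists_zpow_eq_sum_hilb n h1 hu (min c₁ (min a₀ b₀) - n)
  rw [Finset.sum_congr rfl fun i _ => hα (a i) (by have := ha i; omega),
    Finset.sum_congr rfl fun j _ => hα (b j) (by have := hb j; omega),
    Finset.sum_comm, Finset.sum_comm (s := (Finset.univ : Finset κ))]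
  refine Finset.sum_congr rfl fun r hr => ?_
  have hr' := Finset.mem_range.1 hr
  rw [← Finset.mul_sum, ← Finset.mul_sum, ← Nat.cast_sum, ← Nat.cast_sum, h _ (by omega)]

end

/-! ### Characters of split bundles -/

/-- An isomorphism on `X_J` gives an exact sequence with zero as the third term. -/
theorem IsIsoOnX.elemExact {M N P : Type*} [AddCommGroup M] [AddCommGroup N] [AddCommGroup P]
    [Module (Coord J) M] [Module (Coord J) N] [Module (Coord J) P] [Subsingleton P]
    {e : M →ₗ[Coord J] N} (he : IsIsoOnX e) : ElemExact e (0 : N →ₗ[Coord J] P) where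
  inj j m hm := by
    obtain ⟨k, e', -, h⟩ := he j
    exact ⟨k, by rw [← h, hm, map_zero]⟩
  comp j m := ⟨0, Subsingleton.elim _ _⟩
  exact j m _ := by
    obtain ⟨k, e', h, -⟩ := he j
    exact ⟨k, e' m, (h m).symm⟩
  surj j y := ⟨0, 0, Subsingleton.elim _ _⟩

theorem Splits.finrank_weight {n : ℕ} [NeZero n] {M : EquivBundle (wt n) J} {ι : Type} [Fintype ι]
    {a : ι → ℤ} (h : Splits M a) : ∃ c₁ : ℤ, ∀ c ≤ c₁,
      Module.finrank ℂ (M.toGr.weight c) = ∑ i, hilb n J (c - a i) := by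
  obtain ⟨e, he, hiso⟩ := h
  let Z : EquivBundle (wt n) J := freeBundle (wt n) J (fun i : Fin 0 => (0 : ℤ))
  have : Subsingleton Z.carrier := inferInstanceAs (Subsingleton (Fin 0 → Coord J))
  obtain ⟨c₁, hc₁⟩ := GrMod.finrank_weight_add (wt_pos n) (A := M.toGr)
    (B := (freeBundle (wt n) J a).toGr) (C := Z.toGr) e 0 (fun t s => funext fun i => he t s i)
    (fun t s => Subsingleton.elim (α := Z.carrier) _ _) hiso.elemExact
  refine ⟨c₁, fun c hc => ?_⟩
  have h2 := hc₁ c hc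
  have h3 : Module.finrank ℂ (Z.toGr.weight c) = 0 := by
    rw [finrank_weight_freeBundle (wt_pos n)]; simp
  rw [finrank_weight_freeBundle (wt_pos n), h3, add_zero] at h2
  exact h2.symm

section

variable {A : Type*} [CommRing A] {n : ℕ} [NeZero n] {ι ι' ι'' : Type} [Fintype ι] [Fintype ι']
  [Fintype ι''] {a : ι → ℤ} {a' : ι' → ℤ} {a'' : ι'' → ℤ}

/-- The sum of the powers of `u` does not depend on the splitting of the bundle. -/
theorem Splits.sum_zpow_eq (h1 : (1 : Fin 2) ∈ J) {u : Aˣ} (hu : Admissible n J u)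
    {M : EquivBundle (wt n) J} (h : Splits M a) (h' : Splits M a') :
    ∑ i, ((u ^ a i : Aˣ) : A) = ∑ i, ((u ^ a' i : Aˣ) : A) := by
  obtain ⟨c₁, hc₁⟩ := h.finrank_weight
  obtain ⟨c₂, hc₂⟩ := h'.finrank_weight
  exact sum_zpow_eq_of_hilb n h1 hu a a' (min c₁ c₂) fun c hc => by
    rw [← hc₁ c (hc.trans (min_le_left _ _)), hc₂ c (hc.trans (min_le_right _ _))]

/-- The sum of the powers of `u` is additive on extensions. -/
theorem IsExtension.sum_zpow_eq (h1 : (1 : Fin 2) ∈ J) {u : Aˣ} (hu : Admissible n J u)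
    {M M' M'' : EquivBundle (wt n) J} (h : IsExtension M' M M'') (hM' : Splits M' a')
    (hM : Splits M a) (hM'' : Splits M'' a'') :
    ∑ i, ((u ^ a i : Aˣ) : A) = ∑ i, ((u ^ a' i : Aˣ) : A) + ∑ i, ((u ^ a'' i : Aˣ) : A) := by
  obtain ⟨f, g, hf, hg, hex⟩ := h
  obtain ⟨c₀, hc₀⟩ := GrMod.finrank_weight_add (wt_pos n) (A := M'.toGr) (B := M.toGr)
    (C := M''.toGr) f g hf hg ((shortExactOnX_iff f g).1 hex)
  obtain ⟨c₁, hc₁⟩ := hM'.finrank_weight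
  obtain ⟨c₂, hc₂⟩ := hM.finrank_weight
  obtain ⟨c₃, hc₃⟩ := hM''.finrank_weight
  have := sum_zpow_eq_of_hilb n h1 hu a (Sum.elim a' a'') (min (min c₀ c₁) (min c₂ c₃)) fun c hc => by
    rw [Fintype.sum_sum_type]
    simp only [Sum.elim_inl, Sum.elim_inr]
    rw [← hc₁ c (by omega), ← hc₂ c (by omega), ← hc₃ c (by omega)]
    exact hc₀ c (by omega)
  rw [this, Fintype.sum_sum_type]
  simp only [Sum.elim_inl, Sum.elim_inr]

end

theorem splits_lineBundle (a : ℤ) : Splits (lineBundle w J a) (fun _ : Unit => a) := by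
  refine ⟨LinearMap.pi fun _ => LinearMap.id, fun _ _ _ => rfl, fun j =>
    ⟨0, LinearMap.proj (), fun y => ?_, fun y => ?_⟩⟩
  · rw [pow_zero, one_smul]; rfl
  · rw [pow_zero, one_smul]; rfl

/-- The tensor product of two sums of line bundles is the sum of the tensor products of the
summands. -/
theorem Splits.tensor {M N T : EquivBundle w J} {ι κ : Type} [Fintype ι] [Fintype κ]
    {a : ι → ℤ} {b : κ → ℤ} (hM : Splits M a) (hN : Splits N b) (h : IsTensor M N T) :
    Splits T (fun p : ι × κ => a p.1 + b p.2) := by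
  classical
  obtain ⟨e, he, hei⟩ := hM
  obtain ⟨f, hf, hfi⟩ := hN
  obtain ⟨β, hβ, hact⟩ := h
  let B : M.carrier →ₗ[Coord J] N.carrier →ₗ[Coord J] (ι × κ → Coord J) :=
    LinearMap.mk₂ (Coord J) (fun m n p => e m p.1 * f n p.2)
      (fun m m' n => by funext p; simp [add_mul]) (fun c m n => by funext p; simp [mul_assoc])
      (fun m n n' => by funext p; simp [mul_add]) (fun c m n => by funext p; simp; ring)
  let E : T.carrier →ₗ[Coord J] (ι × κ → Coord J) := hβ.lift B
  have hE : ∀ m n p, E (β m n) p = e m p.1 * f n p.2 := fun m n p => by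
    have := hβ.lift_eq B m n
    exact congrFun this p
  refine ⟨E, fun t z p => ?_, fun j => ?_⟩
  · induction z using hβ.inductionOn with
    | zero => rw [map_zero, map_zero, Pi.zero_apply, map_zero, mul_zero]
    | tmul m n =>
      rw [← hact, hE, hE, he, hf, map_mul, zpow_add, Units.val_mul, map_mul]; ring
    | add z z' hz hz' =>
      rw [map_add, map_add, map_add, Pi.add_apply, Pi.add_apply, hz, hz', map_add, mul_add]
  · obtain ⟨k, e', h1, h2⟩ := hei j
    obtain ⟨l, f', h3, h4⟩ := hfi j
    let E' : (ι × κ → Coord J) →ₗ[Coord J] T.carrier :=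
      ∑ p : ι × κ, LinearMap.toSpanSingleton (Coord J) T.carrier
        (β (e' (Pi.single p.1 1)) (f' (Pi.single p.2 1))) ∘ₗ LinearMap.proj p
    have hE' : ∀ y, E' y = ∑ p, y p • β (e' (Pi.single p.1 1)) (f' (Pi.single p.2 1)) := fun y => by
      simp [E', LinearMap.sum_apply]
    have hsing : ∀ {ν : Type} [Fintype ν] [DecidableEq ν] (y : ν → Coord J),
        y = ∑ i, y i • (Pi.single i 1 : ν → Coord J) := fun y => by
      funext i
      simp [Finset.sum_apply, Pi.single_apply]
    refine ⟨k + l, E', fun y => ?_, fun z => ?_⟩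
    · rw [hE', map_sum]
      funext q
      rw [Finset.sum_apply, Finset.sum_eq_single q]
      · rw [map_smul, Pi.smul_apply, hE, h1, h3]
        simp [pow_add]; ring
      · intro p _ hpq
        rw [map_smul, Pi.smul_apply, hE, h1, h3]
        have : p.1 ≠ q.1 ∨ p.2 ≠ q.2 := by
          by_contra! hc
          exact hpq (Prod.ext hc.1 hc.2)
        rcases this with hc | hc
        · simp [Pi.single_eq_of_ne hc.symm]
        · simp [Pi.single_eq_of_ne hc.symm]
      · intro hq
        exact absurd (Finset.mem_univ q) hq
    · induction z using hβ.inductionOn with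
      | zero => simp
      | tmul m n =>
        rw [hE', Fintype.sum_prod_type]
        simp only [hE]
        have e1 : e' (e m) = ∑ i, e m i • e' (Pi.single i 1) := by
          conv_lhs => rw [hsing (e m), map_sum]
          exact Finset.sum_congr rfl fun i _ => map_smul _ _ _
        have e2 : f' (f n) = ∑ i, f n i • f' (Pi.single i 1) := by
          conv_lhs => rw [hsing (f n), map_sum]
          exact Finset.sum_congr rfl fun i _ => map_smul _ _ _
        have e3 : β (e' (e m)) (f' (f n)) = (MvPolynomial.X j ^ (k + l) : Coord J) • β m n := by
          rw [h2, h4, map_smul, map_smul, LinearMap.smul_apply, smul_smul, pow_add, mul_comm]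
        rw [← e3, e1, e2]
        simp only [map_sum, LinearMap.sum_apply, map_smul, LinearMap.smul_apply]
        rw [Finset.sum_comm]
        refine Finset.sum_congr rfl fun i _ => ?_
        rw [Finset.smul_sum]
        refine Finset.sum_congr rfl fun i' _ => ?_
        rw [smul_smul, mul_comm]
      | add z z' hz hz' => rw [map_add, map_add, hz, hz', smul_add]

/-! ### Exterior powers -/

theorem exteriorPower_map_smul {M : Type*} [AddCommGroup M] [Module (Coord J) M] (k : ℕ)
    (f : M →ₗ[Coord J] M) (c : Coord J) (hf : ∀ x, f x = c • x) (z : ⋀[Coord J]^k M) :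
    exteriorPower.map k f z = c ^ k • z := by
  have : exteriorPower.map k f = c ^ k • LinearMap.id := by
    apply exteriorPower.linearMap_ext
    ext1 v
    simp only [LinearMap.compAlternatingMap_apply, exteriorPower.map_apply_ιMulti,
      LinearMap.smul_apply, LinearMap.id_apply]
    have h1 : (f ∘ v) = fun i => c • v i := funext fun i => hf _
    rw [h1, AlternatingMap.map_smul_univ]
    simp
  rw [this]; rfl

theorem sum_ofFinEmbEquiv {r k : ℕ} {B : Type*} [AddCommMonoid B] (s : Set.powersetCard (Fin r) k)
    (a : Fin r → B) :
    ∑ q, a (Set.powersetCard.ofFinEmbEquiv.symm s q) = ∑ i ∈ s.val, a i := by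
  rw [← Finset.sum_coe_sort s.val, ← Equiv.sum_comp (s.val.orderIsoOfFin s.prop).toEquiv]
  refine Finset.sum_congr rfl fun q _ => ?_
  rw [Set.powersetCard.ofFinEmbEquiv_symm_apply]
  rfl

/-- The exterior power of a sum of line bundles is the sum of the tensor products of the families
of `k` distinct summands. -/
theorem Splits.exteriorPower {M T : EquivBundle w J} {r k : ℕ} {a : Fin r → ℤ} (hM : Splits M a)
    (h : IsExteriorPower k M T) :
    Splits T (fun s : Set.powersetCard (Fin r) k => ∑ i ∈ s.val, a i) := by
  obtain ⟨e, he, hiso⟩ := hM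
  obtain ⟨f, hbij, hact⟩ := h
  let Ψ : ⋀[Coord J]^k M.carrier ≃ₗ[Coord J] T.carrier := LinearEquiv.ofBijective _ hbij
  have hΨ : ∀ v, Ψ (exteriorPower.ιMulti (Coord J) k v) = f v := fun v =>
    exteriorPower.alternatingMapLinearEquiv_apply_ιMulti f v
  let b := (Pi.basisFun (Coord J) (Fin r)).exteriorPower k
  let E : T.carrier →ₗ[Coord J] (Set.powersetCard (Fin r) k → Coord J) :=
    b.equivFun.toLinearMap ∘ₗ exteriorPower.map k e ∘ₗ Ψ.symm.toLinearMap
  have hE : ∀ v s, E (f v) s =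
      (Matrix.of fun i j => e (v i) (Set.powersetCard.ofFinEmbEquiv.symm s j)).det := by
    intro v s
    have h1 : Ψ.symm (f v) = exteriorPower.ιMulti (Coord J) k v := by
      rw [← hΨ, LinearEquiv.symm_apply_apply]
    simp only [E, LinearMap.comp_apply, LinearEquiv.coe_coe, h1, exteriorPower.map_apply_ιMulti,
      Module.Basis.equivFun_apply, b, exteriorPower.basis_repr_apply,
      exteriorPower.ιMultiDual_apply_ιMulti]
    simp
  refine ⟨E, fun t z s => ?_, fun j => ?_⟩
  · have hz : z ∈ Submodule.span (Coord J) (Set.range f) := by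
      have h1 : Set.range f = Ψ '' Set.range (exteriorPower.ιMulti (Coord J) k) := by
        rw [← Set.range_comp]
        congr 1
        exact funext fun v => (hΨ v).symm
      rw [h1, ← LinearEquiv.coe_coe, Submodule.span_image, exteriorPower.ιMulti_span,
        Submodule.map_top, LinearEquiv.range]
      trivial
    induction hz using Submodule.span_induction with
    | mem z hz =>
      obtain ⟨v, rfl⟩ := hz
      rw [← hact, hE, hE]
      have h1 : (Matrix.of fun i j => e (M.act t (v i)) (Set.powersetCard.ofFinEmbEquiv.symm s j)) =
          Matrix.of fun i j => (fun j => (MvPolynomial.C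
            ((t ^ a (Set.powersetCard.ofFinEmbEquiv.symm s j) : ℂˣ) : ℂ) : Coord J)) j *
              ((translate w J t).mapMatrix
                (Matrix.of fun i j => e (v i) (Set.powersetCard.ofFinEmbEquiv.symm s j)) :
                  Matrix (Fin k) (Fin k) (Coord J)) i j := by
        ext1 i j
        simp [he]
      rw [h1, Matrix.det_mul_row, ← AlgHom.map_det, ← map_prod, ← Units.coe_prod]
      congr 3
      have h2 : ∀ (F : Finset (Fin k)) (β : Fin k → ℤ), ∏ q ∈ F, t ^ β q = t ^ ∑ q ∈ F, β q := by
        intro F β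
        induction F using Finset.cons_induction with
        | empty => simp
        | cons i F hi ih => rw [Finset.prod_cons, Finset.sum_cons, ih, zpow_add]
      rw [h2, sum_ofFinEmbEquiv]
    | zero => rw [map_zero, map_zero, Pi.zero_apply, map_zero, mul_zero]
    | add z z' _ _ hz hz' =>
      rw [map_add, map_add, map_add, Pi.add_apply, Pi.add_apply, hz, hz', map_add, mul_add]
    | smul c z _ hz =>
      rw [T.act_smul, map_smul, map_smul, Pi.smul_apply, Pi.smul_apply, hz, smul_eq_mul,
        smul_eq_mul, map_mul]
      ring
  · obtain ⟨l, e', h1, h2⟩ := hiso j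
    have hc1 : ∀ z, exteriorPower.map k e (exteriorPower.map k e' z) =
        ((MvPolynomial.X j ^ l : Coord J)) ^ k • z := fun z => by
      rw [← LinearMap.comp_apply, ← exteriorPower.map_comp]
      exact exteriorPower_map_smul k _ _ h1 z
    have hc2 : ∀ z, exteriorPower.map k e' (exteriorPower.map k e z) =
        ((MvPolynomial.X j ^ l : Coord J)) ^ k • z := fun z => by
      rw [← LinearMap.comp_apply, ← exteriorPower.map_comp]
      exact exteriorPower_map_smul k _ _ h2 z
    refine ⟨l * k, Ψ.toLinearMap ∘ₗ exteriorPower.map k e' ∘ₗ b.equivFun.symm.toLinearMap,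
      fun y => ?_, fun z => ?_⟩
    · simp only [E, LinearMap.comp_apply, LinearEquiv.coe_coe, LinearEquiv.symm_apply_apply]
      rw [hc1, map_smul, LinearEquiv.apply_symm_apply, pow_mul]
    · simp only [E, LinearMap.comp_apply, LinearEquiv.coe_coe, LinearEquiv.symm_apply_apply]
      rw [hc2, map_smul, LinearEquiv.apply_symm_apply, pow_mul]

/-! ### The Grothendieck ring is spanned by line bundles -/

theorem cls_extension {M' M M'' : EquivBundle w J} (h : IsExtension M' M M'') :
    cls M = cls M' + cls M'' := by
  rw [cls, cls, cls, ← map_add, Ideal.Quotient.eq]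
  exact Ideal.subset_span (KRel.extension M' M M'' h)

theorem cls_tensor {M N T : EquivBundle w J} (h : IsTensor M N T) : cls T = cls M * cls N := by
  symm
  rw [cls, cls, cls, ← map_mul, Ideal.Quotient.eq]
  exact Ideal.subset_span (KRel.tensor M N T h)

theorem x_zero : x w J 0 = 1 := by
  rw [x, cls, ← map_one (Ideal.Quotient.mk _), Ideal.Quotient.eq]
  exact Ideal.subset_span KRel.unit

theorem x_add (a b : ℤ) : x w J (a + b) = x w J a * x w J b := by
  refine cls_tensor ⟨LinearMap.mul (Coord J) (Coord J), ?_, fun t f g => ?_⟩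
  · have h : TensorProduct.lift (LinearMap.mul (Coord J) (Coord J)) =
        (TensorProduct.lid (Coord J) (Coord J)).toLinearMap := by
      refine TensorProduct.ext' fun f g => ?_
      simp
    change Function.Bijective (TensorProduct.lift (LinearMap.mul (Coord J) (Coord J)))
    rw [h]
    exact (TensorProduct.lid (Coord J) (Coord J)).bijective
  · change Coord J at f g
    change (MvPolynomial.C ((t ^ a : ℂˣ) : ℂ) * translate w J t f) *
      (MvPolynomial.C ((t ^ b : ℂˣ) : ℂ) * translate w J t g) =
      MvPolynomial.C ((t ^ (a + b) : ℂˣ) : ℂ) * translate w J t (f * g)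
    rw [map_mul, zpow_add, Units.val_mul, map_mul]; ring

/-- The class `x` of the line bundle attached to the character `t ↦ t`, as a unit. -/
def xUnit (w : Fin 2 → ℕ) (J : Set (Fin 2)) : (K w J)ˣ where
  val := x w J 1
  inv := x w J (-1)
  val_inv := by rw [← x_add, add_neg_cancel, x_zero]
  inv_val := by rw [← x_add, neg_add_cancel, x_zero]

theorem xUnit_zpow (a : ℤ) : ((xUnit w J ^ a : (K w J)ˣ) : K w J) = x w J a := by
  induction a using Int.induction_on with
  | zero => rw [zpow_zero, x_zero]; rfl
  | succ i ih => rw [zpow_add, zpow_one, Units.val_mul, ih, x_add]; rfl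
  | pred i ih => rw [sub_eq_add_neg, zpow_add, zpow_neg_one, Units.val_mul, ih, x_add]; rfl

theorem x_pow (a : ℕ) : x w J 1 ^ a = x w J a := by
  rw [← xUnit_zpow (a : ℤ), zpow_natCast, Units.val_pow_eq_pow_val]; rfl

theorem isExtension_of_elemExact {M' M M'' : EquivBundle w J}
    (f : M'.carrier →ₗ[Coord J] M.carrier) (g : M.carrier →ₗ[Coord J] M''.carrier)
    (hf : ∀ t s, f (M'.act t s) = M.act t (f s)) (hg : ∀ t s, g (M.act t s) = M''.act t (g s))
    (h : ElemExact f g) : IsExtension M' M M'' :=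
  ⟨f, g, hf, hg, (shortExactOnX_iff f g).2 h⟩

theorem cls_eq_zero (M : EquivBundle w J) [Subsingleton M.carrier] : cls M = 0 := by
  have h : IsExtension M M M := by
    refine ⟨0, 0, fun _ _ => Subsingleton.elim _ _, fun _ _ => Subsingleton.elim _ _, ?_⟩
    rw [shortExactOnX_iff]
    exact ⟨fun j m _ => ⟨0, Subsingleton.elim _ _⟩, fun j m => ⟨0, Subsingleton.elim _ _⟩,
      fun j m _ => ⟨0, 0, Subsingleton.elim _ _⟩, fun j m => ⟨0, 0, Subsingleton.elim _ _⟩⟩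
  have := cls_extension h
  simpa using this

theorem cls_freeBundle {r : ℕ} (a : Fin r → ℤ) : cls (freeBundle w J a) = ∑ i, x w J (a i) := by
  induction r with
  | zero =>
    have : Subsingleton (freeBundle w J a).carrier :=
      inferInstanceAs (Subsingleton (Fin 0 → Coord J))
    rw [cls_eq_zero]; rfl
  | succ r ih =>
    rw [Fin.sum_univ_succ, ← ih (fun i => a i.succ)]
    refine cls_extension (isExtension_of_elemExact
      (LinearMap.single (Coord J) (fun _ : Fin (r + 1) => Coord J) 0 :
        Coord J →ₗ[Coord J] (Fin (r + 1) → Coord J))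
      (LinearMap.funLeft (Coord J) (Coord J) Fin.succ :
        (Fin (r + 1) → Coord J) →ₗ[Coord J] (Fin r → Coord J)) (fun t f => ?_) (fun t s => rfl)
        ⟨fun j f hf => ⟨0, ?_⟩, fun j f => ⟨0, ?_⟩,
          fun j s hs => ⟨0, (s : Fin (r + 1) → Coord J) 0, ?_⟩,
          fun j y => ⟨0, (Fin.cons 0 (y : Fin r → Coord J) : Fin (r + 1) → Coord J), ?_⟩⟩)
    · funext i
      refine Fin.cases ?_ (fun i => ?_) i
      · rfl
      · change (0 : Coord J) = MvPolynomial.C ((t ^ a i.succ : ℂˣ) : ℂ) * translate w J t 0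
        rw [map_zero, mul_zero]
    · rw [pow_zero, one_smul]
      exact congrFun hf (0 : Fin (r + 1))
    · rw [pow_zero, one_smul]
      rfl
    · rw [pow_zero, one_smul]
      funext i
      refine Fin.cases ?_ (fun i => ?_) i
      · rfl
      · exact congrFun hs i
    · rw [pow_zero, one_smul]
      rfl

/-- Classes only depend on the restrictions to `X_J`, so that a splitting over `X_J` is enough. -/
theorem Splits.cls_eq {M : EquivBundle w J} {r : ℕ} {a : Fin r → ℤ} (h : Splits M a) :
    cls M = ∑ i, x w J (a i) := by
  obtain ⟨e, he, hiso⟩ := h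
  let Z : EquivBundle w J := freeBundle w J (fun i : Fin 0 => (0 : ℤ))
  have : Subsingleton Z.carrier := inferInstanceAs (Subsingleton (Fin 0 → Coord J))
  have hext : IsExtension M (freeBundle w J a) Z := by
    exact isExtension_of_elemExact (M := freeBundle w J a) e 0 (fun t s => funext fun i => he t s i)
      (fun _ _ => Subsingleton.elim (α := Z.carrier) _ _) hiso.elemExact
  rw [← cls_freeBundle, cls_extension hext, cls_eq_zero Z, add_zero]

/-- The Koszul relation. -/
theorem x_relation (n : ℕ) [NeZero n] (h1 : (1 : Fin 2) ∈ J) : Admissible n J (xUnit (wt n) J) := by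
  classical
  rw [Admissible]
  change (x (wt n) J 1 ^ n - 1) * (if (0 : Fin 2) ∈ J then x (wt n) J 1 - 1 else 1) = 0
  rw [x_pow]
  have hX : ∀ (j : J) (t : ℂˣ), translate (wt n) J t (MvPolynomial.X j) =
      MvPolynomial.C ((t ^ (-(wt n j : ℤ)) : ℂˣ) : ℂ) * MvPolynomial.X j := fun j =>
    mem_polyWeight_iff.1 (X_mem_polyWeight j)
  have hX1' : ∀ t : ℂˣ, translate (wt n) J t (MvPolynomial.X ⟨1, h1⟩) =
      MvPolynomial.C ((t ^ (-(n : ℤ)) : ℂˣ) : ℂ) * MvPolynomial.X ⟨1, h1⟩ := fun t => hX ⟨1, h1⟩ t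
  have hinv : ∀ (t : ℂˣ) (a : ℤ), (MvPolynomial.C ((t ^ a : ℂˣ) : ℂ) : Coord J) *
      MvPolynomial.C ((t ^ (-a) : ℂˣ) : ℂ) = 1 := fun t a => by
    rw [← map_mul, ← Units.val_mul, ← zpow_add, add_neg_cancel]; simp
  have hC0 : ∀ t : ℂˣ, (MvPolynomial.C ((t ^ (0 : ℤ) : ℂˣ) : ℂ) : Coord J) = 1 := fun t => by simp
  by_cases h0 : (0 : Fin 2) ∈ J
  · rw [if_pos h0]
    have hX0' : ∀ t : ℂˣ, translate (wt n) J t (MvPolynomial.X ⟨0, h0⟩) =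
        MvPolynomial.C ((t ^ (-(1 : ℤ)) : ℂˣ) : ℂ) * MvPolynomial.X ⟨0, h0⟩ :=
      fun t => hX ⟨0, h0⟩ t
    set X0 : Coord J := MvPolynomial.X ⟨0, h0⟩ with hX0
    set X1 : Coord J := MvPolynomial.X ⟨1, h1⟩ with hX1
    let f : Coord J →ₗ[Coord J] (Fin 2 → Coord J) := LinearMap.toSpanSingleton _ _ ![X1, -X0]
    let g : (Fin 2 → Coord J) →ₗ[Coord J] Coord J :=
      X0 • LinearMap.proj 0 + X1 • LinearMap.proj 1
    have hf : ∀ p, f p = ![p * X1, -(p * X0)] := fun p => by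
      simp [f]
    have hg : ∀ s, g s = X0 * s 0 + X1 * s 1 := fun s => by simp [g]
    have hne0 : X0 ≠ 0 := MvPolynomial.X_ne_zero _
    have hne1 : X1 ≠ 0 := MvPolynomial.X_ne_zero _
    have hEx : ElemExact f g := by
      refine ⟨fun j p hp => ⟨0, ?_⟩, fun j p => ⟨0, ?_⟩, fun j s hs => ⟨0, ?_⟩, fun j y => ⟨1, ?_⟩⟩
      · have e1 : p * X1 = 0 := congrFun ((hf p).symm.trans hp) 0
        have e2 : p = 0 := (mul_eq_zero.1 e1).resolve_right hne1
        rw [e2]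
        exact smul_zero _
      · have e1 : g (f p) = 0 := by
          rw [hg, hf]
          simp; ring
        exact (congrArg _ e1).trans (smul_zero _)
      · have e1 : X0 * s 0 + X1 * s 1 = 0 := (hg s).symm.trans hs
        have e2 : X1 ∣ X0 * s 0 := ⟨-s 1, by linear_combination e1⟩
        have e3 : ¬ X1 ∣ X0 := fun h => by
          have := MvPolynomial.X_dvd_X.1 h
          simp at this
        obtain ⟨q, hq⟩ := (MvPolynomial.X_prime.dvd_or_dvd e2).resolve_left e3
        refine ⟨q, ?_⟩
        rw [pow_zero, one_smul]
        refine Eq.trans ?_ (hf q).symm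
        have e4 : s 1 = -(q * X0) := by
          apply mul_left_cancel₀ hne1
          rw [hq] at e1
          linear_combination e1
        funext i
        fin_cases i
        · exact hq.trans (mul_comm _ _)
        · exact e4
      · obtain ⟨j, hj⟩ := j
        fin_cases j
        · refine ⟨![y, 0], ?_⟩
          refine Eq.trans ?_ (hg _).symm
          change X0 ^ 1 * y = _
          simp
        · refine ⟨![0, y], ?_⟩
          refine Eq.trans ?_ (hg _).symm
          change X1 ^ 1 * y = _
          simp
    have hext : IsExtension (lineBundle (wt n) J 0) (freeBundle (wt n) J ![(n : ℤ), 1])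
        (lineBundle (wt n) J (n + 1)) := by
      refine isExtension_of_elemExact (M' := lineBundle (wt n) J 0)
        (M := freeBundle (wt n) J ![(n : ℤ), 1]) (M'' := lineBundle (wt n) J (n + 1)) f g
        (fun t p => ?_) (fun t s => ?_) hEx
      · change Coord J at p
        have e1 := hf (MvPolynomial.C ((t ^ (0 : ℤ) : ℂˣ) : ℂ) * translate (wt n) J t p)
        have e2 := hf p
        refine e1.trans ?_
        funext i
        refine Eq.trans ?_ (freeBundle_act ![(n : ℤ), 1] t (f p) i).symm
        rw [e2]
        fin_cases i
        · change (MvPolynomial.C ((t ^ (0 : ℤ) : ℂˣ) : ℂ) * translate (wt n) J t p) * X1 =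
            MvPolynomial.C ((t ^ (n : ℤ) : ℂˣ) : ℂ) * translate (wt n) J t (p * X1)
          rw [map_mul, hX1' t, hC0]
          linear_combination (-translate (wt n) J t p * X1) * hinv t n
        · change -((MvPolynomial.C ((t ^ (0 : ℤ) : ℂˣ) : ℂ) * translate (wt n) J t p) * X0) =
            MvPolynomial.C ((t ^ (1 : ℤ) : ℂˣ) : ℂ) * translate (wt n) J t (-(p * X0))
          rw [map_neg, map_mul, hX0' t, hC0]
          linear_combination (translate (wt n) J t p * X0) * hinv t 1
      · change Fin 2 → Coord J at s
        refine (hg _).trans ?_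
        have e2 := hg s
        change X0 * (MvPolynomial.C ((t ^ (n : ℤ) : ℂˣ) : ℂ) * translate (wt n) J t (s 0)) +
          X1 * (MvPolynomial.C ((t ^ (1 : ℤ) : ℂˣ) : ℂ) * translate (wt n) J t (s 1)) =
          MvPolynomial.C ((t ^ (n + 1 : ℤ) : ℂˣ) : ℂ) * translate (wt n) J t (g s)
        rw [e2, map_add, map_mul, map_mul, hX0' t, hX1' t]
        have e3 : (MvPolynomial.C ((t ^ (n + 1 : ℤ) : ℂˣ) : ℂ) : Coord J) *
            MvPolynomial.C ((t ^ (-(1 : ℤ)) : ℂˣ) : ℂ) = MvPolynomial.C ((t ^ (n : ℤ) : ℂˣ) : ℂ) := by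
          rw [← map_mul, ← Units.val_mul, ← zpow_add]; simp
        have e4 : (MvPolynomial.C ((t ^ (n + 1 : ℤ) : ℂˣ) : ℂ) : Coord J) *
            MvPolynomial.C ((t ^ (-(n : ℤ)) : ℂˣ) : ℂ) = MvPolynomial.C ((t ^ (1 : ℤ) : ℂˣ) : ℂ) := by
          rw [← map_mul, ← Units.val_mul, ← zpow_add]; simp
        linear_combination (-(X0 * translate (wt n) J t (s 0))) * e3 -
          (X1 * translate (wt n) J t (s 1)) * e4
    have h2 := cls_extension hext
    rw [cls_freeBundle, Fin.sum_univ_two] at h2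
    change x (wt n) J n + x (wt n) J 1 = x (wt n) J 0 + x (wt n) J (n + 1) at h2
    rw [x_add, x_zero] at h2
    linear_combination -h2
  · rw [if_neg h0, mul_one, sub_eq_zero, ← x_zero]
    set X1 : Coord J := MvPolynomial.X ⟨1, h1⟩ with hX1
    let Z : EquivBundle (wt n) J := freeBundle (wt n) J (fun i : Fin 0 => (0 : ℤ))
    have : Subsingleton Z.carrier := inferInstanceAs (Subsingleton (Fin 0 → Coord J))
    let f : Coord J →ₗ[Coord J] Coord J := LinearMap.mulLeft (Coord J) X1
    have hf : IsIsoOnX f := by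
      rintro ⟨j, hj⟩
      fin_cases j
      · exact absurd hj h0
      · exact ⟨1, LinearMap.id, fun y => by rw [pow_one]; rfl, fun y => by rw [pow_one]; rfl⟩
    have hext : IsExtension (lineBundle (wt n) J 0) (lineBundle (wt n) J n) Z := by
      refine isExtension_of_elemExact (M' := lineBundle (wt n) J 0) (M := lineBundle (wt n) J n)
        f 0 (fun t p => ?_) (fun _ _ => Subsingleton.elim (α := Z.carrier) _ _) hf.elemExact
      change Coord J at p
      change X1 * (MvPolynomial.C ((t ^ (0 : ℤ) : ℂˣ) : ℂ) * translate (wt n) J t p) =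
        MvPolynomial.C ((t ^ (n : ℤ) : ℂˣ) : ℂ) * translate (wt n) J t (X1 * p)
      rw [map_mul, hX1' t, hC0]
      linear_combination (-translate (wt n) J t p * X1) * hinv t n
    have := cls_extension hext
    rwa [cls_eq_zero Z, add_zero] at this

/-! ### The universal property of the Grothendieck ring -/

theorem Admissible.mono {n : ℕ} {A : Type*} [CommRing A] (hJ : J ⊆ J') {u : Aˣ}
    (hu : Admissible n J u) : Admissible n J' u := by
  unfold Admissible at hu ⊢
  by_cases h0 : (0 : Fin 2) ∈ J
  · rwa [if_pos (hJ h0), ← if_pos (c := (0 : Fin 2) ∈ J) (t := (u : A) - 1) (e := 1) h0]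
  · rw [if_neg h0, mul_one] at hu
    rw [hu, zero_mul]

section

variable {n : ℕ} [NeZero n] {A : Type*} [CommRing A]

/-- The value on the class of a bundle of the homomorphism that takes the class `x` to `u`. -/
def charSum (h1 : (1 : Fin 2) ∈ J) (u : Aˣ) (M : EquivBundle (wt n) J) : A :=
  ∑ i, ((u ^ (exists_splits (wt_pos n) h1 M).choose_spec.choose i : Aˣ) : A)

/-- The value does not depend on the splitting chosen in the definition. -/
theorem charSum_eq (h1 : (1 : Fin 2) ∈ J) {u : Aˣ} (hu : Admissible n J u)
    {M : EquivBundle (wt n) J} {ι : Type} [Fintype ι] {a : ι → ℤ} (h : Splits M a) :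
    charSum h1 u M = ∑ i, ((u ^ a i : Aˣ) : A) :=
  (exists_splits (wt_pos n) h1 M).choose_spec.choose_spec.sum_zpow_eq h1 hu h

variable [Algebra ℂ A]

/-- The sum of the powers of `u` satisfies the relations of the Grothendieck ring. -/
theorem aeval_charSum_eq_zero (h1 : (1 : Fin 2) ∈ J) {u : Aˣ} (hu : Admissible n J u)
    {p : MvPolynomial (EquivBundle (wt n) J) ℂ} (hp : KRel (wt n) J p) :
    MvPolynomial.aeval (charSum h1 u) p = 0 := by
  cases hp with
  | extension M' M M'' h =>
    obtain ⟨r', a', hM'⟩ := exists_splits (wt_pos n) h1 M'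
    obtain ⟨r, a, hM⟩ := exists_splits (wt_pos n) h1 M
    obtain ⟨r'', a'', hM''⟩ := exists_splits (wt_pos n) h1 M''
    simp only [map_sub, map_add, MvPolynomial.aeval_X]
    rw [charSum_eq h1 hu hM, charSum_eq h1 hu hM', charSum_eq h1 hu hM'',
      h.sum_zpow_eq h1 hu hM' hM hM'', sub_self]
  | tensor M N T h =>
    obtain ⟨r, a, hM⟩ := exists_splits (wt_pos n) h1 M
    obtain ⟨s, b, hN⟩ := exists_splits (wt_pos n) h1 N
    simp only [map_sub, map_mul, MvPolynomial.aeval_X]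
    rw [charSum_eq h1 hu hM, charSum_eq h1 hu hN, charSum_eq h1 hu (hM.tensor hN h),
      Finset.sum_mul_sum, Fintype.sum_prod_type, sub_eq_zero]
    refine Finset.sum_congr rfl fun i _ => Finset.sum_congr rfl fun j _ => ?_
    rw [zpow_add, Units.val_mul]
  | unit =>
    simp only [map_sub, map_one, MvPolynomial.aeval_X]
    rw [charSum_eq h1 hu (splits_lineBundle 0)]
    simp

/-- The homomorphism from `K_G(X_J) ⊗ ℂ` that takes the class `x` to a given unit `u`. -/
def lift (h1 : (1 : Fin 2) ∈ J) (u : Aˣ) (hu : Admissible n J u) : K (wt n) J →ₐ[ℂ] A :=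
  Ideal.Quotient.liftₐ _ (MvPolynomial.aeval (charSum h1 u)) fun p hp => by
    have hle : Ideal.span {p | KRel (wt n) J p} ≤
        RingHom.ker (MvPolynomial.aeval (R := ℂ) (charSum (n := n) h1 u)) :=
      Ideal.span_le.2 fun p hp => aeval_charSum_eq_zero h1 hu hp
    exact hle hp

/-- The homomorphism may be computed from any splitting of the bundle. -/
theorem lift_cls (h1 : (1 : Fin 2) ∈ J) {u : Aˣ} (hu : Admissible n J u)
    {M : EquivBundle (wt n) J} {ι : Type} [Fintype ι] {a : ι → ℤ} (h : Splits M a) :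
    lift h1 u hu (cls M) = ∑ i, ((u ^ a i : Aˣ) : A) := by
  rw [← charSum_eq h1 hu h]
  change MvPolynomial.aeval (charSum h1 u) (MvPolynomial.X M) = _
  rw [MvPolynomial.aeval_X]

theorem lift_x (h1 : (1 : Fin 2) ∈ J) {u : Aˣ} (hu : Admissible n J u) (a : ℤ) :
    lift h1 u hu (x (wt n) J a) = ((u ^ a : Aˣ) : A) := by
  rw [x, lift_cls h1 hu (splits_lineBundle a)]
  simp

/-- The classes of line bundles attached to characters span `K_G(X_J) ⊗ ℂ`, as all bundles split. -/
theorem span_x (h1 : (1 : Fin 2) ∈ J) : Submodule.span ℂ (Set.range (x (wt n) J)) = ⊤ := by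
  rw [eq_top_iff]
  rintro z -
  obtain ⟨p, rfl⟩ := Ideal.Quotient.mk_surjective z
  induction p using MvPolynomial.induction_on with
  | C c =>
    have : (Ideal.Quotient.mk (Ideal.span {p | KRel (wt n) J p})) (MvPolynomial.C c) =
        c • x (wt n) J 0 := by
      rw [x_zero, ← Algebra.algebraMap_eq_smul_one]; rfl
    rw [this]
    exact Submodule.smul_mem _ _ (Submodule.subset_span ⟨0, rfl⟩)
  | add p q hp hq => rw [map_add]; exact add_mem hp hq
  | mul_X p M hp =>
    obtain ⟨r, a, ha⟩ := exists_splits (wt_pos n) h1 M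
    rw [map_mul]
    change _ * cls M ∈ _
    rw [ha.cls_eq, Finset.mul_sum]
    refine Submodule.sum_mem _ fun i _ => ?_
    generalize (Ideal.Quotient.mk (Ideal.span {p | KRel (wt n) J p})) p = z at hp
    induction hp using Submodule.span_induction with
    | mem z hz =>
      obtain ⟨b, rfl⟩ := hz
      rw [← x_add]
      exact Submodule.subset_span ⟨_, rfl⟩
    | zero => rw [zero_mul]; exact zero_mem _
    | add y z _ _ hy hz => rw [add_mul]; exact add_mem hy hz
    | smul c z _ hz => rw [smul_mul_assoc]; exact Submodule.smul_mem _ _ hz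

theorem K_linearMap_ext (h1 : (1 : Fin 2) ∈ J) {V : Type*} [AddCommMonoid V] [Module ℂ V]
    {f g : K (wt n) J →ₗ[ℂ] V} (h : ∀ a, f (x (wt n) J a) = g (x (wt n) J a)) : f = g :=
  LinearMap.ext_on_range (span_x h1) h

theorem K_algHom_ext (h1 : (1 : Fin 2) ∈ J) {B : Type*} [Semiring B] [Algebra ℂ B]
    {f g : K (wt n) J →ₐ[ℂ] B} (h : ∀ a, f (x (wt n) J a) = g (x (wt n) J a)) : f = g :=
  AlgHom.toLinearMap_injective (K_linearMap_ext h1 h)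

theorem Splits.cls_eq_sum (h1 : (1 : Fin 2) ∈ J) {M : EquivBundle (wt n) J} {ι : Type} [Fintype ι]
    {a : ι → ℤ} (h : Splits M a) : cls M = ∑ i, x (wt n) J (a i) := by
  have hid : lift h1 (xUnit (wt n) J) (x_relation n h1) = AlgHom.id ℂ _ :=
    K_algHom_ext h1 fun a => by rw [lift_x, xUnit_zpow]; rfl
  have := lift_cls h1 (x_relation n h1) h
  rw [hid] at this
  rw [AlgHom.id_apply] at this
  rw [this]
  exact Finset.sum_congr rfl fun i _ => xUnit_zpow _

end

/-! ### Restriction -/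

theorem restrict_X_of_mem {j : J'} (h : (j : Fin 2) ∈ J) :
    restrict J J' (MvPolynomial.X j) = MvPolynomial.X ⟨j, h⟩ := by
  rw [restrict, MvPolynomial.aeval_X, dif_pos h]

theorem restrict_X_of_notMem {j : J'} (h : (j : Fin 2) ∉ J) :
    restrict J J' (MvPolynomial.X j) = 0 := by
  rw [restrict, MvPolynomial.aeval_X, dif_neg h]

theorem restrict_translate (t : ℂˣ) (f : Coord J') :
    restrict J J' (translate w J' t f) = translate w J t (restrict J J' f) := by
  have : (restrict J J').comp (translate w J' t) = (translate w J t).comp (restrict J J') := by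
    apply MvPolynomial.algHom_ext
    intro j
    simp only [AlgHom.comp_apply]
    rw [translate, MvPolynomial.aeval_X, map_mul]
    by_cases h : (j : Fin 2) ∈ J
    · rw [restrict_X_of_mem h, translate, MvPolynomial.aeval_X]
      congr 1
      exact (restrict J J').commutes _
    · rw [restrict_X_of_notMem h, mul_zero, map_zero]
  exact DFunLike.congr_fun this f

theorem restrict_C (c : ℂ) : restrict J J' (MvPolynomial.C c) = MvPolynomial.C c :=
  (restrict J J').commutes c

/-- Functions on `V_J` as functions on `V_J'`, for `J ⊆ J'`. -/
def extend (hJ : J ⊆ J') : Coord J →ₐ[ℂ] Coord J' := MvPolynomial.rename (Set.inclusion hJ)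

theorem restrict_extend (hJ : J ⊆ J') (f : Coord J) : restrict J J' (extend hJ f) = f := by
  have : (restrict J J').comp (extend hJ) = AlgHom.id ℂ _ := by
    apply MvPolynomial.algHom_ext
    intro j
    simp only [AlgHom.comp_apply, AlgHom.id_apply]
    rw [extend, MvPolynomial.rename_X, restrict_X_of_mem (J' := J') (j := Set.inclusion hJ j) j.2]
  exact DFunLike.congr_fun this f

theorem restrict_surjective (hJ : J ⊆ J') : Function.Surjective (restrict J J') :=
  fun f => ⟨_, restrict_extend hJ f⟩

theorem restrict_self (f : Coord J) : restrict J J f = f := by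
  have : restrict J J = AlgHom.id ℂ _ := by
    apply MvPolynomial.algHom_ext
    intro j
    rw [restrict_X_of_mem j.2]; rfl
  exact DFunLike.congr_fun this f

theorem isRestriction_lineBundle (hJ : J ⊆ J') (a : ℤ) :
    IsRestriction (lineBundle w J' a) (lineBundle w J a) := by
  have hact : ∀ (t : ℂˣ) (s : Coord J'),
      restrict J J' (MvPolynomial.C ((t ^ a : ℂˣ) : ℂ) * translate w J' t s) =
        MvPolynomial.C ((t ^ a : ℂˣ) : ℂ) * translate w J t (restrict J J' s) := fun t s => by
    rw [map_mul, restrict_translate, restrict_C]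
  have hker : ∀ s : Coord J', restrict J J' s = 0 ↔
      s ∈ (RingHom.ker (restrict J J') • ⊤ : Submodule (Coord J') (Coord J')) := fun s => by
    rw [smul_eq_mul, Ideal.mul_top, RingHom.mem_ker]
  have hmul : ∀ f s : Coord J', restrict J J' (f * s) = restrict J J' f * restrict J J' s :=
    fun f s => map_mul _ f s
  exact ⟨(restrict J J').toRingHom.toAddMonoidHom, hmul, hact, restrict_surjective hJ, hker⟩

/-- The restriction of a sum of line bundles is the sum of the line bundles with the same
characters. -/
theorem IsRestriction.splits (hJ : J ⊆ J') {M : EquivBundle w J'} {N : EquivBundle w J}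
    (h : IsRestriction M N) {ι : Type} [Fintype ι] {a : ι → ℤ} (hM : Splits M a) :
    Splits N a := by
  classical
  obtain ⟨e, he, hiso⟩ := hM
  obtain ⟨r, hr, hact, hsurj, hker⟩ := h
  have hwd : ∀ m m', r m = r m' → ∀ i, restrict J J' (e m i) = restrict J J' (e m' i) := by
    intro m m' hmm i
    have h1 : m - m' ∈ (RingHom.ker (restrict J J') • ⊤ : Submodule (Coord J') M.carrier) := by
      rw [← hker, map_sub, hmm, sub_self]
    have h2 : restrict J J' (e (m - m') i) = 0 := by
      refine Submodule.smul_induction_on (p := fun m => restrict J J' (e m i) = 0) h1 ?_ ?_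
      · intro c hc m _
        rw [map_smul, Pi.smul_apply, smul_eq_mul, map_mul, (RingHom.mem_ker).1 hc, zero_mul]
      · intro m m' hm hm'
        rw [map_add, Pi.add_apply, map_add, hm, hm', add_zero]
    rw [map_sub, Pi.sub_apply, map_sub] at h2
    exact sub_eq_zero.1 h2
  let ρ := Function.surjInv hsurj
  have hρ : ∀ y, r (ρ y) = y := Function.surjInv_eq hsurj
  let E : N.carrier →ₗ[Coord J] (ι → Coord J) :=
    { toFun := fun y i => restrict J J' (e (ρ y) i)
      map_add' := fun y y' => by
        funext i
        rw [hwd (ρ (y + y')) (ρ y + ρ y') (by rw [map_add, hρ, hρ, hρ]), map_add, Pi.add_apply,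
          map_add]; rfl
      map_smul' := fun c y => by
        funext i
        rw [hwd (ρ (c • y)) (extend hJ c • ρ y) (by rw [hr, hρ, hρ, restrict_extend]), map_smul,
          Pi.smul_apply, smul_eq_mul, map_mul, restrict_extend]; rfl }
  have hE : ∀ m i, E (r m) i = restrict J J' (e m i) := fun m i => hwd _ _ (hρ _) i
  refine ⟨E, fun t y i => ?_, fun j => ?_⟩
  · obtain ⟨m, rfl⟩ := hsurj y
    rw [← hact, hE, hE, he, map_mul, restrict_C, restrict_translate]
  · obtain ⟨k, e', h1, h2⟩ := hiso ⟨j, hJ j.2⟩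
    have hXk : restrict J J' (MvPolynomial.X ⟨j, hJ j.2⟩ ^ k) = MvPolynomial.X j ^ k := by
      rw [map_pow, restrict_X_of_mem (J' := J') (j := ⟨j, hJ j.2⟩) j.2]
    let E' : (ι → Coord J) →ₗ[Coord J] N.carrier :=
      ∑ i, LinearMap.toSpanSingleton (Coord J) N.carrier (r (e' (Pi.single i 1))) ∘ₗ
        LinearMap.proj i
    have hE' : ∀ y, E' y = ∑ i, y i • r (e' (Pi.single i 1)) := fun y => by
      simp [E', LinearMap.sum_apply]
    refine ⟨k, E', fun y => ?_, fun y => ?_⟩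
    · rw [hE', map_sum]
      funext q
      rw [Finset.sum_apply, Finset.sum_eq_single q]
      · rw [map_smul, Pi.smul_apply, hE, h1, Pi.smul_apply, Pi.single_eq_same, smul_eq_mul,
          smul_eq_mul, mul_one, hXk, mul_comm]; rfl
      · intro p _ hpq
        rw [map_smul, Pi.smul_apply, hE, h1, Pi.smul_apply, Pi.single_eq_of_ne hpq.symm, smul_zero,
          map_zero, smul_zero]
      · intro hq
        exact absurd (Finset.mem_univ q) hq
    · obtain ⟨m, rfl⟩ := hsurj y
      rw [hE']
      have h3 : e m = ∑ i, e m i • (Pi.single i 1 : ι → Coord J') := by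
        funext i
        simp [Finset.sum_apply, Pi.single_apply]
      rw [← hXk, ← hr, ← h2]
      conv_rhs => rw [h3, map_sum, map_sum]
      refine Finset.sum_congr rfl fun i _ => ?_
      rw [hE, map_smul, hr]

section

variable {n : ℕ} [NeZero n]

/-- The linear map that takes the class of a bundle to the class of its restriction exists by the
universal property, and its value on `x ^ a` is read off from the restriction of a line bundle. -/
theorem pull_x (h1 : (1 : Fin 2) ∈ J) (hJ : J ⊆ J') (a : ℤ) :
    pull (wt n) J J' (x (wt n) J' a) = x (wt n) J a := by
  have hu := (x_relation n h1).mono hJ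
  have hspec : ∃ f : K (wt n) J' →ₗ[ℂ] K (wt n) J, ∀ (M : EquivBundle (wt n) J')
      (N : EquivBundle (wt n) J), IsRestriction M N → f (cls M) = cls N := by
    refine ⟨(lift (hJ h1) _ hu).toLinearMap, fun M N h => ?_⟩
    obtain ⟨r, a, ha⟩ := exists_splits (wt_pos n) (hJ h1) M
    rw [AlgHom.toLinearMap_apply, lift_cls (hJ h1) hu ha, (h.splits hJ ha).cls_eq]
    exact Finset.sum_congr rfl fun i _ => xUnit_zpow _
  exact Classical.epsilon_spec hspec _ _ (isRestriction_lineBundle hJ a)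

end

/-! ### Direct images -/

/-- Functions on `V_J'` act on sections of a direct image through their restrictions to `V_J`. -/
theorem directImage_smul {E : EquivBundle w J} (c : Coord J') (y : E.carrier) :
    @HSMul.hSMul (Coord J') (DirectImage J' E) (DirectImage J' E) _ c y = restrict J J' c • y :=
  rfl

/-- For `J = J'` a resolution of a bundle `E` is an extension, so that `[F₀] - [F₁] = [E]`. -/
theorem push_self_x (a : ℤ) :
    push w J J (x w J a) = x w J a := by
  have hspec : ∃ f : K w J →ₗ[ℂ] K w J, ∀ (F₁ F₀ E : EquivBundle w J),
      IsResolution F₁ F₀ E → f (cls E) = cls F₀ - cls F₁ := by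
    refine ⟨LinearMap.id, fun F₁ F₀ E h => ?_⟩
    obtain ⟨f, g, hf, hg, hex⟩ := h
    have hel := (shortExactOnX_iff f g).1 hex
    have hs : ∀ (c : Coord J) (y : E.carrier),
        @HSMul.hSMul (Coord J) (DirectImage J E) (DirectImage J E) _ c y = c • y := fun c y => by
      rw [directImage_smul, restrict_self]
    let g' : F₀.carrier →ₗ[Coord J] E.carrier :=
      { toFun := g
        map_add' := map_add g
        map_smul' := fun c m => by
          refine (map_smul g c m).trans ((hs c (g m)).trans rfl) }
    have hel' : ElemExact f g' :=
      ⟨hel.inj, fun j m => (hel.comp j m).imp fun k hk => (hs _ _).symm.trans hk, hel.exact,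
        fun j y => (hel.surj j y).imp fun k hk => hk.imp fun m hm => (hs _ _).symm.trans hm⟩
    have := cls_extension (isExtension_of_elemExact f g' hf hg hel')
    rw [this, add_sub_cancel_left]; rfl
  let Z : EquivBundle w J := freeBundle w J (fun i : Fin 0 => (0 : ℤ))
  have : Subsingleton Z.carrier := inferInstanceAs (Subsingleton (Fin 0 → Coord J))
  have hres : IsResolution Z (lineBundle w J a) (lineBundle w J a) := by
    let g : (lineBundle w J a).carrier →ₗ[Coord J]
        DirectImage J (lineBundle w J a) :=
      { toFun := fun y => y
        map_add' := fun _ _ => rfl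
        map_smul' := fun c m => by
          change c • m = restrict J J c • m
          rw [restrict_self] }
    refine ⟨0, g, fun t s => ?_, fun t s => rfl, ?_⟩
    · exact (map_zero ((lineBundle w J a).act t)).symm
    · rw [shortExactOnX_iff]
      refine ⟨fun j m _ => ⟨0, Subsingleton.elim _ _⟩, fun j m => ⟨0, ?_⟩,
        fun j m hm => ⟨0, 0, ?_⟩, fun j y => ⟨0, y, ?_⟩⟩
      · rw [LinearMap.zero_apply, map_zero, smul_zero]
      · rw [pow_zero, one_smul, map_zero]; exact hm
      · rw [pow_zero, one_smul]; rfl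
  have := Classical.epsilon_spec hspec _ _ _ hres
  rw [cls_eq_zero Z, sub_zero] at this
  exact this

/-- The direct image of a bundle, as an equivariant coherent sheaf on the bigger subspace. -/
@[reducible] def directImageGr (hJ : J ⊆ J') (E : EquivBundle w J) : GrMod w J' :=
  letI : Module ℂ E.carrier := E.toGr.moduleC
  haveI : IsScalarTower ℂ (Coord J) E.carrier := E.toGr.tower
  letI : Module ℂ (DirectImage J' E) := E.toGr.moduleC
  haveI : IsScalarTower ℂ (Coord J') (DirectImage J' E) := ⟨fun c f (m : E.carrier) => by
    change restrict J J' (c • f) • m = c • restrict J J' f • m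
    rw [map_smul, smul_assoc]⟩
  haveI : Module.Finite (Coord J') (DirectImage J' E) := by
    obtain ⟨s, hs⟩ := E.finite
    let S : Set (DirectImage J' E) := (s : Set E.carrier)
    refine ⟨⟨s, ?_⟩⟩
    rw [eq_top_iff]
    intro m _
    have hm : (id m : E.carrier) ∈ Submodule.span (Coord J) (s : Set E.carrier) := by
      rw [hs]; trivial
    refine Submodule.span_induction (p := fun (m : E.carrier) _ =>
      (m : DirectImage J' E) ∈ Submodule.span (Coord J') S)
      (fun m hm => Submodule.subset_span hm) (zero_mem _) (fun _ _ _ _ h h' => add_mem h h')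
      (fun c m _ h => ?_) hm
    have h2 := Submodule.smul_mem _ (extend hJ c) h
    have h3 : restrict J J' (extend hJ c) • m = c • m := by rw [restrict_extend]
    exact (congrArg (fun z : DirectImage J' E => z ∈ Submodule.span (Coord J') S) h3).mp h2
  { carrier := DirectImage J' E
    act := E.act
    act_smul := fun t f (s : E.carrier) => by
      change E.act t (restrict J J' f • s) =
        restrict J J' (translate w J' t f) • E.act t s
      rw [E.act_smul, restrict_translate]
    rational := by exact E.toGr.rational }

/-- A function on `V_J'` which vanishes on the hyperplane `V_J` is divisible by its equation. -/
theorem X_dvd_of_restrict_eq_zero (hJ : J ⊆ J') {i : Fin 2} (hi' : i ∈ J')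
    (hJi : ∀ j ∈ J', j ≠ i → j ∈ J) {s : Coord J'} (hs : restrict J J' s = 0) :
    (MvPolynomial.X ⟨i, hi'⟩ : Coord J') ∣ s := by
  have key : ∀ s : Coord J',
      (MvPolynomial.X ⟨i, hi'⟩ : Coord J') ∣ s - extend hJ (restrict J J' s) := by
    intro s
    induction s using MvPolynomial.induction_on with
    | C c =>
      rw [restrict_C]
      have : extend hJ (MvPolynomial.C c) = MvPolynomial.C c := (extend hJ).commutes c
      rw [this, sub_self]
      exact dvd_zero _
    | add p q hp hq =>
      rw [map_add, map_add, add_sub_add_comm]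
      exact dvd_add hp hq
    | mul_X p j hp =>
      rw [map_mul, map_mul]
      by_cases hj : (j : Fin 2) = i
      · obtain ⟨j, hj'⟩ := j
        subst hj
        by_cases hjJ : j ∈ J
        · rw [restrict_X_of_mem hjJ]
          have : extend hJ (MvPolynomial.X ⟨j, hjJ⟩) = MvPolynomial.X ⟨j, hj'⟩ :=
            MvPolynomial.rename_X _ _
          rw [this, ← sub_mul]
          exact dvd_mul_of_dvd_left hp _
        · rw [restrict_X_of_notMem hjJ, map_zero, mul_zero, sub_zero]
          exact dvd_mul_left _ _
      · have hjJ := hJi j j.2 hj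
        rw [restrict_X_of_mem hjJ]
        have : extend hJ (MvPolynomial.X ⟨j, hjJ⟩) = MvPolynomial.X j :=
          MvPolynomial.rename_X _ _
        rw [this, ← sub_mul]
        exact dvd_mul_of_dvd_left hp _
  have := key s
  rwa [hs, map_zero, sub_zero] at this

/-- The direct image of a line bundle from the hyperplane `{z i = 0}` is resolved by
multiplication by the coordinate function `z i`. -/
theorem isResolution_lineBundle (hJ : J ⊆ J') {i : Fin 2} (hi : i ∉ J) (hi' : i ∈ J')
    (hJi : ∀ j ∈ J', j ≠ i → j ∈ J) (a : ℤ) :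
    IsResolution (lineBundle w J' (a - w i)) (lineBundle w J' a) (lineBundle w J a) := by
  set X : Coord J' := MvPolynomial.X ⟨i, hi'⟩ with hX
  have hXt : ∀ t : ℂˣ, translate w J' t X = MvPolynomial.C ((t ^ (-(w i : ℤ)) : ℂˣ) : ℂ) * X :=
    fun t => mem_polyWeight_iff.1 (X_mem_polyWeight ⟨i, hi'⟩) t
  have hX0 : X ≠ 0 := MvPolynomial.X_ne_zero _
  let f : Coord J' →ₗ[Coord J'] Coord J' := LinearMap.mulLeft (Coord J') X
  let g : Coord J' →ₗ[Coord J'] DirectImage J' (lineBundle w J a) :=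
    { toFun := fun s => restrict J J' s
      map_add' := fun s s' => map_add (restrict J J') s s'
      map_smul' := fun c s => map_mul (restrict J J') c s }
  have hf : ∀ (t : ℂˣ) (s : Coord J'),
      X * (MvPolynomial.C ((t ^ (a - w i) : ℂˣ) : ℂ) * translate w J' t s) =
        MvPolynomial.C ((t ^ a : ℂˣ) : ℂ) * translate w J' t (X * s) := fun t s => by
    rw [map_mul, hXt, sub_eq_add_neg, zpow_add, Units.val_mul, map_mul]
    ring
  have hg : ∀ (t : ℂˣ) (s : Coord J'),
      restrict J J' (MvPolynomial.C ((t ^ a : ℂˣ) : ℂ) * translate w J' t s) =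
        MvPolynomial.C ((t ^ a : ℂˣ) : ℂ) * translate w J t (restrict J J' s) := fun t s => by
    rw [map_mul, restrict_translate, restrict_C]
  have hex : ElemExact f g := by
    refine ⟨fun j s hs => ⟨0, ?_⟩, fun j s => ⟨0, ?_⟩, fun j s hs => ⟨0, ?_⟩, fun j y => ⟨0, ?_⟩⟩
    · have : s = 0 := (mul_eq_zero.1 hs).resolve_left hX0
      rw [this, smul_zero]
    · have : restrict J J' (X * s) = 0 := by
        rw [map_mul, hX, restrict_X_of_notMem hi, zero_mul]
      rw [pow_zero, one_smul]; exact this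
    · obtain ⟨q, hq⟩ := X_dvd_of_restrict_eq_zero hJ hi' hJi hs
      exact ⟨q, by rw [pow_zero, one_smul]; exact hq⟩
    · obtain ⟨s, hs⟩ := restrict_surjective hJ y
      exact ⟨s, by rw [pow_zero, one_smul]; exact hs.symm⟩
  exact ⟨f, g, hf, hg, (shortExactOnX_iff _ _).2 hex⟩

section

variable {n : ℕ} [NeZero n]

/-- Comparison of the Hilbert functions in the exact sequence given by multiplication by `z₀`. -/
theorem hilb_add (h1 : (1 : Fin 2) ∈ J) (h1' : (1 : Fin 2) ∈ J') (h0 : (0 : Fin 2) ∉ J)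
    (h0' : (0 : Fin 2) ∈ J') {c : ℤ} (hc : c ≤ -1) :
    hilb n J c + hilb n J' (c + 1) = hilb n J' c := by
  obtain ⟨d, rfl⟩ : ∃ d : ℕ, c = -((d + 1 : ℕ) : ℤ) := ⟨(-c).toNat - 1, by omega⟩
  have h2 : -((d + 1 : ℕ) : ℤ) + 1 = -(d : ℤ) := by push_cast; ring
  rw [h2, hilb_of_mem n h0' h1', hilb_of_mem n h0' h1', hilb_of_notMem n h0 h1, Nat.succ_div]
  split_ifs <;> ring

/-- For a resolution of the direct image of `E`, the difference of the classes of `F₀` and `F₁` is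
the class of `E` times the Euler class of the normal bundle of `X_J`, by comparison of Hilbert
functions. -/
theorem IsResolution.sum_zpow_eq (h1 : (1 : Fin 2) ∈ J) (hJ : J ⊆ J') (h0 : (0 : Fin 2) ∉ J)
    (h0' : (0 : Fin 2) ∈ J') {A : Type*} [CommRing A] {v : Aˣ} (hv : Admissible n J' v)
    {F₁ F₀ : EquivBundle (wt n) J'} {E : EquivBundle (wt n) J} (h : IsResolution F₁ F₀ E)
    {ι ι₀ ι₁ : Type} [Fintype ι] [Fintype ι₀] [Fintype ι₁] {a : ι → ℤ} {b₀ : ι₀ → ℤ}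
    {b₁ : ι₁ → ℤ} (hE : Splits E a) (hF₀ : Splits F₀ b₀) (hF₁ : Splits F₁ b₁) :
    ∑ i, ((v ^ b₀ i : Aˣ) : A) + ∑ i, ((v ^ (a i - 1) : Aˣ) : A) =
      ∑ i, ((v ^ b₁ i : Aˣ) : A) + ∑ i, ((v ^ a i : Aˣ) : A) := by
  obtain ⟨f, g, hf, hg, hex⟩ := h
  obtain ⟨c₀, hc₀⟩ := GrMod.finrank_weight_add (wt_pos n) (A := F₁.toGr) (B := F₀.toGr)
    (C := directImageGr hJ E) f g hf hg ((shortExactOnX_iff f g).1 hex)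
  obtain ⟨c₁, hc₁⟩ := hF₁.finrank_weight
  obtain ⟨c₂, hc₂⟩ := hF₀.finrank_weight
  obtain ⟨c₃, hc₃⟩ := hE.finrank_weight
  obtain ⟨c₄, hc₄⟩ := Finite.bddBelow_range a
  have hc₄' : ∀ i, c₄ ≤ a i := fun i => hc₄ ⟨i, rfl⟩
  have := sum_zpow_eq_of_hilb n (hJ h1) hv (Sum.elim b₀ fun i => a i - 1) (Sum.elim b₁ a)
    (min (min c₀ c₁) (min (min c₂ c₃) (c₄ - 1))) fun c hc => by
      simp only [Fintype.sum_sum_type, Sum.elim_inl, Sum.elim_inr]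
      have h2 : Module.finrank ℂ (F₀.toGr.weight c) = Module.finrank ℂ (F₁.toGr.weight c) +
        Module.finrank ℂ (E.toGr.weight c) := hc₀ c (by omega)
      rw [← hc₁ c (by omega), ← hc₂ c (by omega), h2, hc₃ c (by omega), add_assoc,
        ← Finset.sum_add_distrib]
      congr 1
      refine Finset.sum_congr rfl fun i _ => ?_
      have := hc₄' i
      rw [← hilb_add h1 (hJ h1) h0 h0' (n := n) (c := c - a i) (by omega)]
      congr 2
      ring
  simpa only [Fintype.sum_sum_type, Sum.elim_inl, Sum.elim_inr] using this

/-- Let `v` be a unit of an algebra and `y` an element annihilated by `v ^ n - 1`. As `v ^ n = 1`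
modulo the annihilator of `y`, a linear map takes `x ^ a` to `v ^ a * y`. -/
theorem exists_linearMap_mul (h1 : (1 : Fin 2) ∈ J) (h0 : (0 : Fin 2) ∉ J) {R : Type*} [CommRing R]
    [Algebra ℂ R] (v : Rˣ) (y : R) (hy : ((v : R) ^ n - 1) * y = 0) :
    ∃ f : K (wt n) J →ₗ[ℂ] R, ∀ (M : EquivBundle (wt n) J) {r : ℕ} {a : Fin r → ℤ},
      Splits M a → f (cls M) = ∑ i, ((v ^ a i : Rˣ) : R) * y := by
  let μ : R →ₗ[R] R := LinearMap.toSpanSingleton _ _ y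
  let I : Ideal R := LinearMap.ker μ
  let v' : (R ⧸ I)ˣ := Units.map (Ideal.Quotient.mk I : R →* R ⧸ I) v
  have hvz : ∀ a : ℤ, ((v' ^ a : (R ⧸ I)ˣ) : R ⧸ I) =
      Ideal.Quotient.mk I ((v ^ a : Rˣ) : R) := fun a => by
    rw [← map_zpow]; rfl
  have hv : Admissible n J v' := by
    rw [Admissible, if_neg h0, mul_one]
    change Ideal.Quotient.mk I (v : R) ^ n - 1 = 0
    rw [← map_pow, ← map_one (Ideal.Quotient.mk I), ← map_sub, Ideal.Quotient.eq_zero_iff_mem]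
    exact hy
  let μ' : (R ⧸ I) →ₗ[R] R := Submodule.liftQ I μ le_rfl
  have hμ' : ∀ z, μ' (Ideal.Quotient.mk I z) = z * y := fun z => Submodule.liftQ_apply I μ z
  refine ⟨(μ'.restrictScalars ℂ) ∘ₗ (lift h1 v' hv).toLinearMap, fun M r a ha => ?_⟩
  rw [LinearMap.comp_apply, AlgHom.toLinearMap_apply, lift_cls h1 hv ha, map_sum]
  exact Finset.sum_congr rfl fun i _ => by
    rw [hvz, LinearMap.restrictScalars_apply, hμ']

/-- The direct image from the hyperplane `{z₀ = 0}` exists as a linear map, and its value on `x ^ a`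
is read off from the resolution of a line bundle by multiplication by `z₀`. -/
theorem push_x (h1 : (1 : Fin 2) ∈ J) (hJ : J ⊆ J') (h0 : (0 : Fin 2) ∉ J)
    (h0' : (0 : Fin 2) ∈ J') (a : ℤ) :
    push (wt n) J J' (x (wt n) J a) = x (wt n) J' a - x (wt n) J' (a - 1) := by
  have hspec : ∃ f : K (wt n) J →ₗ[ℂ] K (wt n) J',
      ∀ (F₁ F₀ : EquivBundle (wt n) J') (E : EquivBundle (wt n) J),
      IsResolution F₁ F₀ E → f (cls E) = cls F₀ - cls F₁ := by
    -- By the projection formula the direct image is the product with the Euler class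
    -- `1 - x ^ (-1)` of the normal bundle.
    have hy : (((xUnit (wt n) J' : (K (wt n) J')ˣ) : K (wt n) J') ^ n - 1) *
        (1 - x (wt n) J' (-1)) = 0 := by
      have h := x_relation n (hJ h1)
      rw [Admissible, if_pos h0'] at h
      change (x (wt n) J' 1 ^ n - 1) * (x (wt n) J' 1 - 1) = 0 at h
      change (x (wt n) J' 1 ^ n - 1) * (1 - x (wt n) J' (-1)) = 0
      have h3 : 1 - x (wt n) J' (-1) = x (wt n) J' (-1) * (x (wt n) J' 1 - 1) := by
        rw [mul_sub, ← x_add, neg_add_cancel, x_zero, mul_one]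
      rw [h3]
      linear_combination x (wt n) J' (-1) * h
    obtain ⟨μ, hμ⟩ := exists_linearMap_mul h1 h0 _ _ hy
    refine ⟨μ, fun F₁ F₀ E h => ?_⟩
    obtain ⟨r, a, ha⟩ := exists_splits (wt_pos n) h1 E
    obtain ⟨r₀, b₀, hb₀⟩ := exists_splits (wt_pos n) (hJ h1) F₀
    obtain ⟨r₁, b₁, hb₁⟩ := exists_splits (wt_pos n) (hJ h1) F₁
    have key := h.sum_zpow_eq h1 hJ h0 h0' (x_relation n (hJ h1)) ha hb₀ hb₁
    simp only [xUnit_zpow] at key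
    have h4 : ∀ i, x (wt n) J' (a i) * (1 - x (wt n) J' (-1)) =
        x (wt n) J' (a i) - x (wt n) J' (a i - 1) := fun i => by
      rw [mul_sub, mul_one, ← x_add, sub_eq_add_neg (a i)]
    rw [hμ E ha, hb₀.cls_eq, hb₁.cls_eq]
    simp only [xUnit_zpow]
    rw [Finset.sum_congr rfl fun i _ => h4 i, Finset.sum_sub_distrib]
    linear_combination -key
  have := Classical.epsilon_spec hspec _ _ _ (isResolution_lineBundle hJ h0 h0' (fun j _ hj => by
    fin_cases j
    · exact absurd rfl hj
    · exact h1) a)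
  have h2 : ((wt n 0 : ℕ) : ℤ) = 1 := rfl
  rw [h2] at this
  exact this

end

/-! ### Adams operations -/

/-- Newton's identity, as a sum over the degree of the power sum. -/
theorem esymm_newton (σ R : Type*) [CommRing R] [Fintype σ] (k : ℕ) :
    (k : MvPolynomial σ R) * MvPolynomial.esymm σ R k = ∑ i ∈ Finset.Icc 1 k,
      (-1) ^ (i - 1) * MvPolynomial.esymm σ R (k - i) * MvPolynomial.psum σ R i := by
  classical
  rw [MvPolynomial.mul_esymm_eq_sum, Finset.mul_sum]
  refine Finset.sum_bij' (fun p _ => p.2) (fun i _ => (k - i, i)) ?_ ?_ ?_ ?_ ?_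
  · rintro ⟨p, q⟩ h
    rw [Finset.mem_filter] at h
    have h1 : p + q = k := Finset.HasAntidiagonal.mem_antidiagonal.1 h.1
    have h2 : p < k := h.2
    rw [Finset.mem_Icc]
    omega
  · intro i h
    rw [Finset.mem_Icc] at h
    exact Finset.mem_filter.2 ⟨Finset.HasAntidiagonal.mem_antidiagonal.2 (by omega), by simp; omega⟩
  · rintro ⟨p, q⟩ h
    rw [Finset.mem_filter] at h
    have h1 : p + q = k := Finset.HasAntidiagonal.mem_antidiagonal.1 h.1
    have h2 : p < k := h.2
    simp only [Prod.mk.injEq, and_true]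
    omega
  · intro i _
    rfl
  · rintro ⟨p, q⟩ h
    rw [Finset.mem_filter] at h
    have h1 : p + q = k := Finset.HasAntidiagonal.mem_antidiagonal.1 h.1
    have h2 : p < k := h.2
    obtain ⟨m, rfl⟩ : ∃ m, q = m + 1 := ⟨q - 1, by omega⟩
    obtain rfl : k = p + (m + 1) := h1.symm
    have h3 : p + (m + 1) - (m + 1) = p := by omega
    have h4 : (-1 : MvPolynomial σ R) ^ (p + (m + 1) + 1) * (-1) ^ p = (-1) ^ m := by
      rw [← pow_add, show p + (m + 1) + 1 + p = m + 2 * (p + 1) by ring, pow_add, pow_mul]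
      simp
    simp only [h3, Nat.add_sub_cancel]
    rw [← h4]
    ring

theorem isExteriorPower_of_equiv {M T : EquivBundle w J} {k : ℕ}
    (Ψ : ⋀[Coord J]^k M.carrier ≃ₗ[Coord J] T.carrier)
    (h : ∀ (t : ℂˣ) (v : Fin k → M.carrier),
      Ψ (exteriorPower.ιMulti (Coord J) k fun i => M.act t (v i)) =
        T.act t (Ψ (exteriorPower.ιMulti (Coord J) k v))) : IsExteriorPower k M T := by
  refine ⟨Ψ.toLinearMap.compAlternatingMap (exteriorPower.ιMulti (Coord J) k), ?_, h⟩
  have : exteriorPower.alternatingMapLinearEquiv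
      (Ψ.toLinearMap.compAlternatingMap (exteriorPower.ιMulti (Coord J) k)) = Ψ.toLinearMap := by
    apply exteriorPower.linearMap_ext
    ext1 v
    simp
  rw [this]
  exact Ψ.bijective

theorem subsingleton_exteriorPower {R : Type*} [CommRing R] (k : ℕ) :
    Subsingleton (⋀[R]^(k + 2) R) := by
  have h0 : (LinearMap.id : ⋀[R]^(k + 2) R →ₗ[R] _) = 0 := by
    refine exteriorPower.linearMap_ext (AlternatingMap.ext fun v => ?_)
    have h1 : v = fun i => v i • (1 : R) := by funext i; simp
    have h2 : exteriorPower.ιMulti R (k + 2) (fun _ : Fin (k + 2) => (1 : R)) = 0 :=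
      AlternatingMap.map_eq_zero_of_eq _ _ (i := 0) (j := 1) rfl (by simp)
    rw [LinearMap.compAlternatingMap_apply, LinearMap.compAlternatingMap_apply, h1,
      AlternatingMap.map_smul_univ, h2, smul_zero, map_zero, map_zero]
  exact ⟨fun a b => by
    rw [← LinearMap.id_apply (R := R) a, ← LinearMap.id_apply (R := R) b, h0]; rfl⟩

theorem isExteriorPower_zero (a : ℤ) :
    IsExteriorPower 0 (lineBundle w J a) (lineBundle w J 0) := by
  have h (v : Fin 0 → (lineBundle w J a).carrier) :=
    exteriorPower.zeroEquiv_ιMulti (R := Coord J) v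
  have h2 (t : ℂˣ) :
      (1 : Coord J) = MvPolynomial.C ((t ^ (0 : ℤ) : ℂˣ) : ℂ) * translate w J t 1 := by simp
  refine isExteriorPower_of_equiv
    (exteriorPower.zeroEquiv (Coord J) (lineBundle w J a).carrier) fun t v => ?_
  exact (h _).trans ((h2 t).trans (congrArg ((lineBundle w J 0).act t) (h v)).symm)

theorem isExteriorPower_one (a : ℤ) :
    IsExteriorPower 1 (lineBundle w J a) (lineBundle w J a) := by
  refine isExteriorPower_of_equiv
    (exteriorPower.oneEquiv (Coord J) (lineBundle w J a).carrier) fun t v => ?_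
  rw [exteriorPower.oneEquiv_ιMulti, exteriorPower.oneEquiv_ιMulti]

theorem isExteriorPower_add_two (a : ℤ) (k : ℕ) : IsExteriorPower (k + 2) (lineBundle w J a)
    (freeBundle w J (fun _ : Fin 0 => (0 : ℤ))) := by
  have h1 : Subsingleton (freeBundle w J (fun _ : Fin 0 => (0 : ℤ))).carrier :=
    inferInstanceAs (Subsingleton (Fin 0 → Coord J))
  have h2 : Subsingleton (⋀[Coord J]^(k + 2) (lineBundle w J a).carrier) :=
    subsingleton_exteriorPower (R := Coord J) k
  exact isExteriorPower_of_equiv 0 fun t v => Subsingleton.elim _ _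

/-- The relations allow the substitution `x ↦ x ^ k` that defines the Adams operations. -/
theorem Admissible.pow {n : ℕ} {A : Type*} [CommRing A] {u : Aˣ} (hu : Admissible n J u) (k : ℕ) :
    Admissible n J (u ^ k) := by
  classical
  unfold Admissible at hu ⊢
  have h1 : (u : A) ^ n - 1 ∣ ((u ^ k : Aˣ) : A) ^ n - 1 := by
    rw [Units.val_pow_eq_pow_val, ← pow_mul, mul_comm, pow_mul]
    exact sub_one_dvd_pow_sub_one _ _
  have h2 : (if (0 : Fin 2) ∈ J then (u : A) - 1 else 1) ∣
      (if (0 : Fin 2) ∈ J then ((u ^ k : Aˣ) : A) - 1 else 1) := by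
    split_ifs
    · rw [Units.val_pow_eq_pow_val]
      exact sub_one_dvd_pow_sub_one _ _
    · exact dvd_rfl
  have := mul_dvd_mul h1 h2
  rw [hu] at this
  exact zero_dvd_iff.1 this

section

variable {n : ℕ} [NeZero n]

/-- The class of the exterior power is the elementary symmetric polynomial of the classes of the
summands. -/
theorem Splits.cls_exteriorPower (h1 : (1 : Fin 2) ∈ J) {M T : EquivBundle (wt n) J} {r k : ℕ}
    {a : Fin r → ℤ} (hM : Splits M a) (h : IsExteriorPower k M T) :
    cls T = MvPolynomial.aeval (fun i => x (wt n) J (a i)) (MvPolynomial.esymm (Fin r) ℂ k) := by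
  classical
  have hprod : ∀ s : Finset (Fin r), x (wt n) J (∑ i ∈ s, a i) = ∏ i ∈ s, x (wt n) J (a i) := by
    intro s
    induction s using Finset.induction_on with
    | empty => simp [x_zero]
    | insert i s hi ih => rw [Finset.sum_insert hi, Finset.prod_insert hi, x_add, ih]
  rw [(hM.exteriorPower h).cls_eq_sum h1, MvPolynomial.esymm, map_sum]
  simp only [map_prod, MvPolynomial.aeval_X, hprod]
  exact (Finset.sum_subtype (p := fun s => s ∈ Set.powersetCard (Fin r) k) _ (fun s => by
    rw [Finset.mem_powersetCard_univ, Set.powersetCard.mem_iff])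
    fun s => ∏ i ∈ s, x (wt n) J (a i)).symm

/-- The Adams operations exist: the homomorphism with `x ↦ x ^ k` turns the classes of the summands
of a split bundle into their `k`-th powers, so that Newton's identity holds. Conversely Newton's
identity determines the values on a line bundle, whose exterior powers vanish in degrees greater
than one. -/
theorem adams_x (h1 : (1 : Fin 2) ∈ J) {k : ℕ} (hk : 1 ≤ k) (a : ℤ) :
    adams (wt n) J k (x (wt n) J a) = x (wt n) J (k * a) := by
  have hspec : ∃ ψ : ℕ → K (wt n) J →ₗ[ℂ] K (wt n) J,
      ∀ (M : EquivBundle (wt n) J) (T : ℕ → EquivBundle (wt n) J),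
      (∀ i, IsExteriorPower i M (T i)) → ∀ k : ℕ, 1 ≤ k →
      (k : K (wt n) J) * cls (T k) =
        ∑ i ∈ Finset.Icc 1 k, (-1) ^ (i - 1) * cls (T (k - i)) * ψ i (cls M) := by
    refine ⟨fun k => (lift h1 _ ((x_relation n h1).pow k)).toLinearMap, fun M T hT k _ => ?_⟩
    obtain ⟨r, a, ha⟩ := exists_splits (wt_pos n) h1 M
    have := congrArg (MvPolynomial.aeval fun i => x (wt n) J (a i)) (esymm_newton (Fin r) ℂ k)
    simp only [map_mul, map_natCast, map_sum, map_pow, map_neg, map_one] at this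
    rw [ha.cls_exteriorPower h1 (hT k), this]
    refine Finset.sum_congr rfl fun i _ => ?_
    rw [ha.cls_exteriorPower h1 (hT _), AlgHom.toLinearMap_apply, lift_cls h1 _ ha,
      MvPolynomial.psum, map_sum]
    congr 1
    refine Finset.sum_congr rfl fun j _ => ?_
    rw [map_pow, MvPolynomial.aeval_X, ← xUnit_zpow, ← Units.val_pow_eq_pow_val, ← zpow_natCast,
      ← zpow_natCast, ← zpow_mul, ← zpow_mul, mul_comm]
  have hadams := Classical.epsilon_spec hspec
  change ∀ (M : EquivBundle (wt n) J) (T : ℕ → EquivBundle (wt n) J),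
    (∀ i, IsExteriorPower i M (T i)) → ∀ k : ℕ, 1 ≤ k → (k : K (wt n) J) * cls (T k) =
      ∑ i ∈ Finset.Icc 1 k, (-1) ^ (i - 1) * cls (T (k - i)) * adams (wt n) J i (cls M) at hadams
  let Z : EquivBundle (wt n) J := freeBundle (wt n) J (fun _ : Fin 0 => (0 : ℤ))
  have hZs : Subsingleton Z.carrier := inferInstanceAs (Subsingleton (Fin 0 → Coord J))
  have hZ : cls Z = 0 := cls_eq_zero Z
  let T : ℕ → EquivBundle (wt n) J := fun
    | 0 => lineBundle (wt n) J 0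
    | 1 => lineBundle (wt n) J a
    | _ + 2 => Z
  have hT := hadams (lineBundle (wt n) J a) T fun
    | 0 => isExteriorPower_zero a
    | 1 => isExteriorPower_one a
    | k + 2 => isExteriorPower_add_two a k
  have hT0 : cls (T 0) = 1 := x_zero
  have hT1 : cls (T 1) = x (wt n) J a := rfl
  have hT2 : ∀ i, 2 ≤ i → cls (T i) = 0 := fun i hi => by
    obtain ⟨j, rfl⟩ : ∃ j, i = j + 2 := ⟨i - 2, by omega⟩
    exact hZ
  induction k, hk using Nat.le_induction with
  | base =>
    have := hT 1 le_rfl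
    simp only [Finset.Icc_self, Finset.sum_singleton, Nat.cast_one, one_mul, Nat.sub_self, pow_zero,
      hT0, hT1] at this
    rw [Nat.cast_one, one_mul]
    exact this.symm
  | succ k hk ih =>
    obtain ⟨k, rfl⟩ : ∃ m, k = m + 1 := ⟨k - 1, by omega⟩
    have := hT (k + 1 + 1) (by omega)
    rw [Finset.sum_Icc_succ_top (by omega), Finset.sum_Icc_succ_top (by omega),
      Finset.sum_eq_zero, hT2 (k + 1 + 1) (by omega)] at this
    · have e1 : k + 1 + 1 - (k + 1) = 1 := by omega
      rw [e1, Nat.sub_self, hT0, hT1, Nat.add_sub_cancel, Nat.add_sub_cancel] at this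
      change _ = _ + (-1) ^ k * _ * adams (wt n) J (k + 1) (x (wt n) J a) +
        (-1) ^ (k + 1) * 1 * adams (wt n) J (k + 1 + 1) (x (wt n) J a) at this
      rw [ih] at this
      have h3 : (-1 : K (wt n) J) ^ k * (-1) ^ k = 1 := pow_mul_pow_eq_one k (by ring)
      have h4 : (((k + 1 + 1 : ℕ) : ℤ)) * a = a + ((k + 1 : ℕ) : ℤ) * a := by push_cast; ring
      rw [h4, x_add]
      linear_combination (-1) ^ k * this + (adams (wt n) J (k + 1 + 1) (x (wt n) J a) -
        x (wt n) J a * x (wt n) J (((k + 1 : ℕ) : ℤ) * a)) * (-h3)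
    · intro i hi
      rw [Finset.mem_Icc] at hi
      rw [hT2 _ (by omega), mul_zero, zero_mul]

end

/-! ### Evaluation at the roots of unity -/

/-- The unit `1 + ε` of the dual numbers. -/
def dualUnit : (DualNumber ℂ)ˣ where
  val := 1 + DualNumber.eps
  inv := 1 - DualNumber.eps
  val_inv := by linear_combination (-1 : DualNumber ℂ) * DualNumber.eps_mul_eps (R := ℂ)
  inv_val := by linear_combination (-1 : DualNumber ℂ) * DualNumber.eps_mul_eps (R := ℂ)

theorem dualUnit_zpow (a : ℤ) :
    ((dualUnit ^ a : (DualNumber ℂ)ˣ) : DualNumber ℂ) = 1 + (a : DualNumber ℂ) * DualNumber.eps := by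
  have h := DualNumber.eps_mul_eps (R := ℂ)
  induction a using Int.induction_on with
  | zero => simp
  | succ i ih =>
    rw [zpow_add_one, Units.val_mul, ih, dualUnit]
    push_cast
    linear_combination (i : DualNumber ℂ) * h
  | pred i ih =>
    rw [zpow_sub_one, Units.val_mul, ih]
    change _ * (1 - DualNumber.eps) = _
    push_cast
    linear_combination (i : DualNumber ℂ) * h

theorem admissible_dualUnit {n : ℕ} (h0 : (0 : Fin 2) ∈ J) : Admissible n J dualUnit := by
  have h := DualNumber.eps_mul_eps (R := ℂ)
  rw [Admissible, if_pos h0, ← Units.val_pow_eq_pow_val, ← zpow_natCast, dualUnit_zpow, dualUnit]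
  linear_combination ((n : ℤ) : DualNumber ℂ) * h

section

variable {n : ℕ} [NeZero n]

variable (n) in
/-- The character `l ↦ ζ ^ l` of `ℤ/n`. -/
abbrev chi : AddChar (ZMod n) ℂ := ZMod.stdAddChar

theorem zeta_pow (k : ℕ) : zeta n ^ k = chi n k := by
  have h : chi n (1 : ℤ) = zeta n := by
    rw [ZMod.stdAddChar_coe, zeta]; simp
  rw [← h, ← AddChar.map_nsmul_eq_pow]
  simp

theorem zeta_pow_val (l : ZMod n) : zeta n ^ l.val = chi n l := by
  rw [zeta_pow, ZMod.natCast_zmod_val]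

theorem chi_ne_zero (l : ZMod n) : chi n l ≠ 0 := by
  rw [ZMod.stdAddChar_apply]; exact Circle.coe_ne_zero _

theorem chi_eq_one_iff {l : ZMod n} : chi n l = 1 ↔ l = 0 := by
  rw [← AddChar.map_zero_eq_one (chi n)]
  exact ZMod.injective_stdAddChar.eq_iff

theorem chi_pow (l : ZMod n) (k : ℕ) : chi n l ^ k = chi n (k * l) := by
  rw [← AddChar.map_nsmul_eq_pow, nsmul_eq_mul]

theorem chi_zpow (l : ZMod n) (k : ℤ) : chi n l ^ k = chi n (k * l) := by
  rw [← AddChar.map_zsmul_eq_zpow, zsmul_eq_mul]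

theorem chi_neg (l : ZMod n) : chi n (-l) = (chi n l)⁻¹ := AddChar.map_neg_eq_inv _ _

theorem sum_chi_mul (b : ZMod n) : ∑ i : ZMod n, chi n (i * b) = if b = 0 then (n : ℂ) else 0 := by
  rw [AddChar.sum_mulShift b (ZMod.isPrimitive_stdAddChar n), ZMod.card]
  simp

theorem eq_zero_of_sum_chi_mul {c : ZMod n → ℂ} (h : ∀ q, ∑ m, chi n (m * q) * c m = 0) :
    c = 0 := by
  apply (ZMod.dft (E := ℂ)).injective
  rw [map_zero]
  funext k
  rw [ZMod.dft_apply, Pi.zero_apply, ← h (-k)]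
  exact Finset.sum_congr rfl fun m _ => by rw [mul_neg, smul_eq_mul]

theorem mem_fixedBy_one (m : ZMod n) : (1 : Fin 2) ∈ fixedBy n m := by
  change (zeta n ^ m.val) ^ n = 1
  rw [← pow_mul, zeta_pow]
  simp

theorem mem_fixedBy_zero {m : ZMod n} : (0 : Fin 2) ∈ fixedBy n m ↔ m = 0 := by
  change (zeta n ^ m.val) ^ 1 = 1 ↔ _
  rw [pow_one, zeta_pow_val, chi_eq_one_iff]

/-- `ζ ^ l` as a unit. -/
def chiUnit (l : ZMod n) : ℂˣ := Units.mk0 (chi n l) (chi_ne_zero l)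

theorem admissible_chiUnit (l : ZMod n) : Admissible n J (chiUnit l) := by
  have : chi n l ^ n = 1 := by rw [chi_pow]; simp
  rw [Admissible, chiUnit, Units.val_mk0, this, sub_self, zero_mul]

/-- The homomorphism `K_G(X_J) ⊗ ℂ → ℂ` that evaluates characters at `ζ ^ l`. -/
def evalAt (h1 : (1 : Fin 2) ∈ J) (l : ZMod n) : K (wt n) J →ₐ[ℂ] ℂ :=
  lift h1 (chiUnit l) (admissible_chiUnit l)

theorem evalAt_x (h1 : (1 : Fin 2) ∈ J) (l : ZMod n) (a : ℤ) :
    evalAt h1 l (x (wt n) J a) = chi n (a * l) := by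
  rw [evalAt, lift_x, Units.val_zpow_eq_zpow_val, chiUnit, Units.val_mk0, chi_zpow]

/-- The homomorphism from `K_G(X_J) ⊗ ℂ` to the dual numbers that takes `x` to `1 + ε`. -/
def evalDual (h1 : (1 : Fin 2) ∈ J) (h0 : (0 : Fin 2) ∈ J) : K (wt n) J →ₐ[ℂ] DualNumber ℂ :=
  lift h1 dualUnit (admissible_dualUnit h0)

theorem evalDual_x (h1 : (1 : Fin 2) ∈ J) (h0 : (0 : Fin 2) ∈ J) (a : ℤ) :
    evalDual (n := n) h1 h0 (x (wt n) J a) = 1 + (a : DualNumber ℂ) * DualNumber.eps := by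
  rw [evalDual, lift_x, dualUnit_zpow]

theorem fst_evalDual (h1 : (1 : Fin 2) ∈ J) (h0 : (0 : Fin 2) ∈ J) (z : K (wt n) J) :
    (evalDual h1 h0 z).fst = evalAt h1 0 z := by
  have : (TrivSqZeroExt.fstHom ℂ ℂ ℂ).comp (evalDual (n := n) h1 h0) = evalAt h1 0 :=
    K_algHom_ext h1 fun a => by
      rw [AlgHom.comp_apply, evalDual_x, evalAt_x, mul_zero, AddChar.map_zero_eq_one, map_add,
        map_mul, map_one]
      change 1 + _ * DualNumber.eps.fst = (1 : ℂ)
      rw [DualNumber.fst_eps, mul_zero, add_zero]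
  exact DFunLike.congr_fun this z

/-- The derivative at `x = 1` on `K_G(X_J) ⊗ ℂ`. -/
def derivAt (h1 : (1 : Fin 2) ∈ J) (h0 : (0 : Fin 2) ∈ J) : K (wt n) J →ₗ[ℂ] ℂ :=
  TrivSqZeroExt.sndHom ℂ ℂ ∘ₗ (evalDual h1 h0).toLinearMap

theorem derivAt_x (h1 : (1 : Fin 2) ∈ J) (h0 : (0 : Fin 2) ∈ J) (a : ℤ) :
    derivAt (n := n) h1 h0 (x (wt n) J a) = a := by
  change (evalDual h1 h0 (x (wt n) J a)).snd = a
  have h : (a : DualNumber ℂ) = TrivSqZeroExt.inl (a : ℂ) := (TrivSqZeroExt.inl_intCast a).symm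
  rw [evalDual_x, h]
  simp

theorem derivAt_mul (h1 : (1 : Fin 2) ∈ J) (h0 : (0 : Fin 2) ∈ J) (z z' : K (wt n) J) :
    derivAt h1 h0 (z * z') = evalAt h1 0 z * derivAt h1 h0 z' + evalAt h1 0 z' * derivAt h1 h0 z := by
  change (evalDual h1 h0 (z * z')).snd = _
  rw [map_mul, TrivSqZeroExt.snd_mul, fst_evalDual, fst_evalDual, smul_eq_mul, op_smul_eq_mul,
    mul_comm (evalDual h1 h0 z).snd]
  rfl

theorem derivAt_one (h1 : (1 : Fin 2) ∈ J) (h0 : (0 : Fin 2) ∈ J) :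
    derivAt (n := n) h1 h0 1 = 0 := by
  rw [← x_zero, derivAt_x, Int.cast_zero]

/-! ### Elements of the Grothendieck ring are determined by their evaluations -/

/-- Every element is a polynomial in `x`, as the relations make `x` integral and invertible. -/
theorem exists_aeval_eq (h1 : (1 : Fin 2) ∈ J) (z : K (wt n) J) :
    ∃ p : Polynomial ℂ, Polynomial.aeval (x (wt n) J 1) p = z := by
  have hn : 0 < n := Nat.pos_of_ne_zero (NeZero.ne n)
  have hinv : ∃ p : Polynomial ℂ, Polynomial.aeval (x (wt n) J 1) p = x (wt n) J (-1) := by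
    have h := x_relation n h1
    have h2 : (x (wt n) J 1 ^ n - 1) * (x (wt n) J 1 - 1) = 0 := by
      have := h.mono (Set.subset_univ J)
      rwa [Admissible, if_pos (Set.mem_univ _)] at this
    have h3 : x (wt n) J 1 * x (wt n) J (-1) = 1 := by
      rw [← x_add]; exact x_zero
    refine ⟨1 + Polynomial.X ^ (n - 1) - Polynomial.X ^ n, ?_⟩
    have h4 : x (wt n) J 1 ^ n = x (wt n) J 1 * x (wt n) J 1 ^ (n - 1) := by
      rw [← pow_succ', Nat.sub_add_cancel hn]
    simp only [map_sub, map_add, map_one, map_pow, Polynomial.aeval_X]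
    linear_combination (x (wt n) J (-1)) * (-h2 - h4) -
      (1 - x (wt n) J 1 ^ n + x (wt n) J 1 ^ (n - 1)) * h3
  obtain ⟨q, hq⟩ := hinv
  have hx : ∀ a : ℤ, x (wt n) J a ∈ (Polynomial.aeval (R := ℂ) (x (wt n) J 1)).range := fun a => by
    rcases Int.eq_nat_or_neg a with ⟨k, rfl | rfl⟩
    · rw [← x_pow]
      exact pow_mem ((AlgHom.mem_range _).2 ⟨Polynomial.X, Polynomial.aeval_X _⟩) k
    · have : x (wt n) J (-(k : ℤ)) = x (wt n) J (-1) ^ k := by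
        rw [← xUnit_zpow, ← xUnit_zpow, zpow_neg, zpow_natCast, zpow_neg_one, ← inv_pow,
          Units.val_pow_eq_pow_val]
      rw [this]
      exact pow_mem ((AlgHom.mem_range _).2 ⟨q, hq⟩) k
  have hle : Submodule.span ℂ (Set.range (x (wt n) J)) ≤
      Subalgebra.toSubmodule (Polynomial.aeval (R := ℂ) (x (wt n) J 1)).range :=
    Submodule.span_le.2 (by rintro _ ⟨a, rfl⟩; exact hx a)
  rw [span_x h1] at hle
  exact hle (Submodule.mem_top (x := z))

variable (n) in
theorem prod_X_sub_chi : ∏ i : ZMod n, (Polynomial.X - Polynomial.C (chi n i)) =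
    Polynomial.X ^ n - 1 := by
  have hn : 0 < n := Nat.pos_of_ne_zero (NeZero.ne n)
  have hz : IsPrimitiveRoot (zeta n) n := Complex.isPrimitiveRoot_exp n (NeZero.ne n)
  rw [Polynomial.X_pow_sub_one_eq_prod hn hz]
  refine Finset.prod_bij (fun i _ => chi n i) (fun i _ => ?_)
    (fun i _ j _ h => ZMod.injective_stdAddChar h) (fun b hb => ?_) (fun _ _ => rfl)
  · rw [Polynomial.mem_nthRootsFinset hn, chi_pow]
    simp
  · rw [Polynomial.mem_nthRootsFinset hn] at hb
    obtain ⟨i, -, hi⟩ := hz.eq_pow_of_pow_eq_one hb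
    exact ⟨i, Finset.mem_univ _, by rw [← hi, zeta_pow]⟩

theorem evalAt_aeval (h1 : (1 : Fin 2) ∈ J) (l : ZMod n) (p : Polynomial ℂ) :
    evalAt h1 l (Polynomial.aeval (x (wt n) J 1) p) = p.eval (chi n l) := by
  rw [← Polynomial.aeval_algHom_apply, evalAt_x, Int.cast_one, one_mul, Polynomial.coe_aeval_eq_eval]

theorem X_pow_sub_one_dvd {p : Polynomial ℂ} (h : ∀ l : ZMod n, p.eval (chi n l) = 0) :
    Polynomial.X ^ n - 1 ∣ p := by
  rw [← prod_X_sub_chi n]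
  refine Finset.prod_dvd_of_coprime (fun i _ j _ hij => ?_) fun i _ => Polynomial.dvd_iff_isRoot.2 (h i)
  exact Polynomial.isCoprime_X_sub_C_of_isUnit_sub
    (sub_ne_zero.2 fun hc => hij (ZMod.injective_stdAddChar hc)).isUnit

/-- The polynomial `X ^ n - 1` has simple roots, so that elements are determined by their values
there. -/
theorem eq_zero_of_evalAt (h1 : (1 : Fin 2) ∈ J) (h0 : (0 : Fin 2) ∉ J) {z : K (wt n) J}
    (h : ∀ l, evalAt h1 l z = 0) : z = 0 := by
  obtain ⟨p, rfl⟩ := exists_aeval_eq h1 z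
  simp only [evalAt_aeval] at h
  obtain ⟨q, rfl⟩ := X_pow_sub_one_dvd h
  have hx := x_relation n h1
  rw [Admissible, if_neg h0, mul_one] at hx
  change x (wt n) J 1 ^ n - 1 = 0 at hx
  simp only [map_mul, map_sub, map_one, map_pow, Polynomial.aeval_X]
  rw [hx, zero_mul]

/-- The polynomial `(X ^ n - 1) (X - 1)` has a double root at `1` and no other multiple root. -/
theorem eq_zero_of_evalAt_of_derivAt (h1 : (1 : Fin 2) ∈ J) (h0 : (0 : Fin 2) ∈ J) {z : K (wt n) J}
    (h : ∀ l, evalAt h1 l z = 0) (hd : derivAt h1 h0 z = 0) : z = 0 := by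
  obtain ⟨p, rfl⟩ := exists_aeval_eq h1 z
  simp only [evalAt_aeval] at h
  obtain ⟨q, rfl⟩ := X_pow_sub_one_dvd h
  have hx := x_relation n h1
  rw [Admissible, if_pos h0] at hx
  change (x (wt n) J 1 ^ n - 1) * (x (wt n) J 1 - 1) = 0 at hx
  have hq : q.eval 1 = 0 := by
    rw [map_mul, derivAt_mul, map_sub, map_sub, map_pow, map_one, map_one,
      Polynomial.aeval_X, map_sub, x_pow,
      derivAt_x, derivAt_one, evalAt_x, evalAt_aeval, mul_zero, AddChar.map_zero_eq_one, sub_self,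
      zero_mul, zero_add, sub_zero] at hd
    exact (mul_eq_zero.1 hd).resolve_right (by simpa using NeZero.ne n)
  obtain ⟨r, rfl⟩ := Polynomial.dvd_iff_isRoot.2 hq
  simp only [map_mul, map_sub, map_one, map_pow, Polynomial.aeval_X]
  rw [← mul_assoc, hx, zero_mul]

end

section

variable {n : ℕ} [NeZero n]

/-! ### Evaluations, restrictions and direct images -/

theorem evalAt_pull (h1 : (1 : Fin 2) ∈ J) (hJ : J ⊆ J') (l : ZMod n) (z : K (wt n) J') :
    evalAt h1 l (pull (wt n) J J' z) = evalAt (hJ h1) l z := by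
  have : (evalAt h1 l).toLinearMap ∘ₗ pull (wt n) J J' = (evalAt (hJ h1) l).toLinearMap :=
    K_linearMap_ext (hJ h1) fun a => by
      rw [LinearMap.comp_apply, pull_x h1 hJ, AlgHom.toLinearMap_apply, AlgHom.toLinearMap_apply,
        evalAt_x, evalAt_x]
  exact DFunLike.congr_fun this z

theorem eq_of_mem_of_subset (h0 : (0 : Fin 2) ∈ J ∨ (0 : Fin 2) ∉ J') (h1 : (1 : Fin 2) ∈ J)
    (hJ : J ⊆ J') : J = J' := by
  refine hJ.antisymm fun j hj => ?_
  fin_cases j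
  · exact h0.resolve_right fun h => h hj
  · exact h1

theorem push_self (h1 : (1 : Fin 2) ∈ J) (z : K (wt n) J) : push (wt n) J J z = z := by
  have : push (wt n) J J = LinearMap.id := K_linearMap_ext h1 fun a => push_self_x a
  rw [this, LinearMap.id_apply]

theorem pull_self (h1 : (1 : Fin 2) ∈ J) (z : K (wt n) J) : pull (wt n) J J z = z := by
  have : pull (wt n) J J = LinearMap.id := K_linearMap_ext h1 fun a => pull_x h1 subset_rfl a
  rw [this, LinearMap.id_apply]

open Classical in
/-- The direct image multiplies evaluations by the Euler class of the normal bundle. -/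
theorem evalAt_push (h1 : (1 : Fin 2) ∈ J) (hJ : J ⊆ J') (l : ZMod n) (z : K (wt n) J) :
    evalAt (hJ h1) l (push (wt n) J J' z) =
      (if (0 : Fin 2) ∈ J ∨ (0 : Fin 2) ∉ J' then 1 else 1 - chi n (-l)) * evalAt h1 l z := by
  split_ifs with h
  · obtain rfl := eq_of_mem_of_subset h h1 hJ
    rw [push_self h1, one_mul]
  · push Not at h
    have : (evalAt (hJ h1) l).toLinearMap ∘ₗ push (wt n) J J' =
        (1 - chi n (-l)) • (evalAt h1 l).toLinearMap :=
      K_linearMap_ext h1 fun a => by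
        rw [LinearMap.comp_apply, push_x h1 hJ h.1 h.2, LinearMap.smul_apply,
          AlgHom.toLinearMap_apply, AlgHom.toLinearMap_apply, map_sub, evalAt_x, evalAt_x, evalAt_x,
          smul_eq_mul, sub_mul, one_mul, ← AddChar.map_add_eq_mul]
        congr 2
        push_cast
        ring
    exact DFunLike.congr_fun this z

/-- The Euler class `1 - x ^ (-1)` of the normal bundle vanishes at `1`, with derivative `1`. -/
theorem derivAt_push (h1 : (1 : Fin 2) ∈ J) (hJ : J ⊆ J') (h0 : (0 : Fin 2) ∉ J)
    (h0' : (0 : Fin 2) ∈ J') (z : K (wt n) J) :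
    derivAt (hJ h1) h0' (push (wt n) J J' z) = evalAt h1 0 z := by
  have : derivAt (hJ h1) h0' ∘ₗ push (wt n) J J' = (evalAt h1 0).toLinearMap :=
    K_linearMap_ext h1 fun a => by
      rw [LinearMap.comp_apply, push_x h1 hJ h0 h0', AlgHom.toLinearMap_apply, map_sub, derivAt_x,
        derivAt_x, evalAt_x, mul_zero, AddChar.map_zero_eq_one]
      push_cast
      ring
  exact DFunLike.congr_fun this z

theorem derivAt_push_of_mem (h1 : (1 : Fin 2) ∈ J) (hJ : J ⊆ J') (h0 : (0 : Fin 2) ∈ J)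
    (z : K (wt n) J) : derivAt (hJ h1) (hJ h0) (push (wt n) J J' z) = derivAt h1 h0 z := by
  obtain rfl := eq_of_mem_of_subset (Or.inl h0) h1 hJ
  rw [push_self h1]

theorem derivAt_pull (h1 : (1 : Fin 2) ∈ J) (hJ : J ⊆ J') (h0 : (0 : Fin 2) ∈ J)
    (z : K (wt n) J') : derivAt h1 h0 (pull (wt n) J J' z) = derivAt (hJ h1) (hJ h0) z := by
  obtain rfl := eq_of_mem_of_subset (Or.inl h0) h1 hJ
  rw [pull_self h1]

/-! ### Evaluations of the virtual product -/

theorem fixedBy₂_subset_left {n : ℕ} (m₁ m₂ : ZMod n) : fixedBy₂ n m₁ m₂ ⊆ fixedBy n m₁ :=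
  Set.inter_subset_left

theorem fixedBy₂_subset_right {n : ℕ} (m₁ m₂ : ZMod n) : fixedBy₂ n m₁ m₂ ⊆ fixedBy n m₂ :=
  Set.inter_subset_right

theorem mem_fixedBy₂_one (m₁ m₂ : ZMod n) : (1 : Fin 2) ∈ fixedBy₂ n m₁ m₂ :=
  ⟨mem_fixedBy_one m₁, mem_fixedBy_one m₂⟩

theorem mem_fixedBy₂_zero {m₁ m₂ : ZMod n} :
    (0 : Fin 2) ∈ fixedBy₂ n m₁ m₂ ↔ m₁ = 0 ∧ m₂ = 0 :=
  and_congr mem_fixedBy_zero mem_fixedBy_zero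

theorem fixedBy₂_subset {m₁ m₂ m : ZMod n} (h : m₁ + m₂ = m) :
    fixedBy₂ n m₁ m₂ ⊆ fixedBy n m := by
  intro j hj
  fin_cases j
  · obtain ⟨h1, h2⟩ := mem_fixedBy₂_zero.1 hj
    refine mem_fixedBy_zero.2 ?_
    rw [← h, h1, h2, add_zero]
  · exact mem_fixedBy_one m

theorem obstructionMult_one (m₁ m₂ : ZMod n) : obstructionMult n m₁ m₂ 1 = 0 := by
  rw [obstructionMult, Set.indicator_of_mem (mem_fixedBy₂_one m₁ m₂),
    Set.indicator_of_mem (mem_fixedBy_one m₁), Set.indicator_of_mem (mem_fixedBy_one m₂)]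
  simp

theorem obstructionMult_zero (m₁ m₂ : ZMod n) :
    obstructionMult n m₁ m₂ 0 = if m₁ = 0 ∨ m₂ = 0 then 0 else 1 := by
  classical
  rw [obstructionMult, Set.indicator_apply, Set.indicator_apply, Set.indicator_apply]
  simp only [mem_fixedBy₂_zero, mem_fixedBy_zero]
  by_cases h1 : m₁ = 0 <;> by_cases h2 : m₂ = 0 <;> simp [h1, h2]

theorem eulerObstruction_eq (m₁ m₂ : ZMod n) : eulerObstruction n m₁ m₂ =
    if m₁ = 0 ∨ m₂ = 0 then 1 else 1 - x (wt n) (fixedBy₂ n m₁ m₂) (-1) := by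
  rw [eulerObstruction, Fin.prod_univ_two, obstructionMult_one, obstructionMult_zero]
  split_ifs
  · simp
  · simp only [Int.toNat_one, pow_one, Int.toNat_zero, pow_zero, mul_one]
    rfl

/-- The structure constants of the virtual product in terms of evaluations at `ζ ^ l`. -/
def structConst (m₁ m₂ l : ZMod n) : ℂ :=
  if m₁ = 0 ∨ m₂ = 0 then 1 else
    if m₁ + m₂ = 0 then (1 - chi n (-l)) ^ 2 else 1 - chi n (-l)

/-- The evaluation at `ζ ^ l` on the sector of index `m`. -/
def ev (m l : ZMod n) : Sector n m →ₐ[ℂ] ℂ := evalAt (mem_fixedBy_one m) l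

variable (n) in
/-- The derivative at `1` on the untwisted sector. -/
def der : Sector n 0 →ₗ[ℂ] ℂ := derivAt (mem_fixedBy_one 0) (mem_fixedBy_zero.2 rfl)

/-- The evaluations of a virtual product: the obstruction class contributes a factor `1 - ζ ^ (-l)`
for two twisted sectors, and the direct image another one if their product is untwisted. -/
theorem ev_vmul (a b : KI n) (m l : ZMod n) : ev m l (vmul n a b m) =
    ∑ m₁, ∑ m₂, if m₁ + m₂ = m then
      structConst m₁ m₂ l * (ev m₁ l (a m₁) * ev m₂ l (b m₂)) else 0 := by
  classical
  rw [vmul, map_sum]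
  refine Finset.sum_congr rfl fun m₁ _ => ?_
  rw [map_sum]
  refine Finset.sum_congr rfl fun m₂ _ => ?_
  split_ifs with h
  · rw [ev, evalAt_push (mem_fixedBy₂_one m₁ m₂) (fixedBy₂_subset h), map_mul, map_mul,
      evalAt_pull _ (fixedBy₂_subset_left _ _), evalAt_pull _ (fixedBy₂_subset_right _ _),
      eulerObstruction_eq, apply_ite (evalAt (mem_fixedBy₂_one m₁ m₂) l), map_one, map_sub, map_one,
      evalAt_x, mem_fixedBy₂_zero, mem_fixedBy_zero, structConst, ← h]
    change _ * (ev m₁ l (a m₁) * ev m₂ l (b m₂) * _) = _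
    have hl : (((-1 : ℤ) : ZMod n)) * l = -l := by push_cast; ring
    rw [hl]
    by_cases h1 : m₁ = 0 <;> by_cases h2 : m₂ = 0
    · simp [h1, h2]
    · simp [h1, h2]
    · simp [h1, h2]
    · by_cases h3 : m₁ + m₂ = 0
      · simp only [h1, h2, h3, false_and, not_true, if_false, if_true, or_self]
        ring
      · simp only [h1, h2, h3, false_and, false_or, not_false_eq_true, if_false, if_true, or_self]
        ring
  · rw [map_zero]

/-- Products of twisted sectors do not contribute to the derivative: the direct image and the
obstruction class both provide a factor that vanishes at `1`. -/
theorem der_vmul (a b : KI n) : der n (vmul n a b 0) =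
    ev 0 0 (a 0) * der n (b 0) + ev 0 0 (b 0) * der n (a 0) := by
  rw [vmul, map_sum, Finset.sum_eq_single 0, map_sum, Finset.sum_eq_single 0, if_pos (add_zero 0)]
  · have h0 : (0 : Fin 2) ∈ fixedBy₂ n 0 0 := mem_fixedBy₂_zero.2 ⟨rfl, rfl⟩
    rw [der, derivAt_push_of_mem (mem_fixedBy₂_one 0 0) (fixedBy₂_subset (add_zero 0)) h0,
      eulerObstruction_eq, if_pos (Or.inl rfl), mul_one, derivAt_mul,
      evalAt_pull _ (fixedBy₂_subset_left _ _), evalAt_pull _ (fixedBy₂_subset_right _ _),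
      derivAt_pull _ (fixedBy₂_subset_left _ _), derivAt_pull _ (fixedBy₂_subset_right _ _)]
    rfl
  · intro m₂ _ hm
    rw [if_neg (by rwa [zero_add]), map_zero]
  · intro h
    exact absurd (Finset.mem_univ _) h
  · intro m₁ _ hm
    rw [map_sum]
    refine Finset.sum_eq_zero fun m₂ _ => ?_
    split_ifs with h
    · have hm₂ : m₂ ≠ 0 := by
        rintro rfl
        exact hm (by rwa [add_zero] at h)
      have h0 : (0 : Fin 2) ∉ fixedBy₂ n m₁ m₂ := fun h => hm (mem_fixedBy₂_zero.1 h).1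
      rw [der, derivAt_push (mem_fixedBy₂_one m₁ m₂) (fixedBy₂_subset h) h0, eulerObstruction_eq,
        if_neg (by tauto), map_mul, map_sub, map_one, evalAt_x, mul_zero, AddChar.map_zero_eq_one,
        sub_self, mul_zero]
    · rw [map_zero]
  · intro h
    exact absurd (Finset.mem_univ _) h

/-- The factors rescaling the evaluations at `ζ ^ l` to a ring homomorphism for the products of
the inertia group. -/
def scale (m l : ZMod n) : ℂ := if m = 0 then 1 else 1 - chi n (-l)

/-- The rescaling trivializes the structure constants: for `l ≠ 0` they are the coboundary of
`scale`. -/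
theorem scale_mul_structConst (m₁ m₂ l : ZMod n) :
    scale (m₁ + m₂) l * structConst m₁ m₂ l = scale m₁ l * scale m₂ l := by
  unfold scale structConst
  by_cases h1 : m₁ = 0 <;> by_cases h2 : m₂ = 0
  · simp [h1, h2]
  · simp [h1, h2]
  · simp [h1, h2]
  · by_cases h3 : m₁ + m₂ = 0
    · simp only [h1, h2, h3, if_false, if_true, or_self]
      ring
    · simp only [h1, h2, h3, if_false, or_self]

/-- The `q`-th Fourier coefficient of the rescaled evaluations at `ζ ^ l` of an element. -/
def fourier (q l : ZMod n) : KI n →ₗ[ℂ] ℂ :=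
  ∑ m, (chi n (m * q) * scale m l) • (ev m l).toLinearMap ∘ₗ LinearMap.proj m

theorem fourier_apply (q l : ZMod n) (a : KI n) :
    fourier q l a = ∑ m, chi n (m * q) * scale m l * ev m l (a m) := by
  rw [fourier, LinearMap.sum_apply]
  rfl

theorem fourier_single (q l m : ZMod n) (z : Sector n m) :
    fourier q l (Pi.single m z) = chi n (m * q) * scale m l * ev m l z := by
  rw [fourier_apply, Finset.sum_eq_single m]
  · rw [Pi.single_eq_same]
  · intro m' _ h
    rw [Pi.single_eq_of_ne h, map_zero, mul_zero]
  · intro h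
    exact absurd (Finset.mem_univ _) h

/-- For `l = 0` the rescaling factors of the twisted sectors vanish. -/
theorem fourier_zero (q : ZMod n) (a : KI n) : fourier q 0 a = ev 0 0 (a 0) := by
  rw [fourier_apply, Finset.sum_eq_single 0]
  · simp [scale]
  · intro m _ hm
    simp [scale, hm]
  · intro h
    exact absurd (Finset.mem_univ _) h

theorem fourier_vone (q l : ZMod n) : fourier q l (vone n) = 1 := by
  rw [vone, fourier_single, map_one]
  simp [scale]

/-- After rescaling the product is a convolution over `ℤ/n`. -/
theorem fourier_vmul (q l : ZMod n) (a b : KI n) :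
    fourier q l (vmul n a b) = fourier q l a * fourier q l b := by
  simp only [fourier_apply, ev_vmul]
  rw [Finset.sum_mul_sum]
  simp only [Finset.mul_sum]
  refine Finset.sum_comm.trans (Finset.sum_congr rfl fun m₁ _ =>
    Finset.sum_comm.trans (Finset.sum_congr rfl fun m₂ _ => ?_))
  simp only [mul_ite, mul_zero, Finset.sum_ite_eq, Finset.mem_univ, if_true]
  rw [add_mul, AddChar.map_add_eq_mul]
  linear_combination (chi n (m₁ * q) * chi n (m₂ * q) * ev m₁ l (a m₁) * ev m₂ l (b m₂)) *
    scale_mul_structConst m₁ m₂ l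

/-- The components of an element that are nilpotent for the virtual product. -/
def nilpart : KI n →ₗ[ℂ] ZMod n → ℂ :=
  LinearMap.pi fun q => if q = 0 then der n ∘ₗ LinearMap.proj 0
    else (ev q 0).toLinearMap ∘ₗ LinearMap.proj q

theorem nilpart_zero (a : KI n) : nilpart a 0 = der n (a 0) := by
  rw [nilpart, LinearMap.pi_apply, if_pos rfl]; rfl

theorem nilpart_of_ne (a : KI n) {q : ZMod n} (hq : q ≠ 0) : nilpart a q = ev q 0 (a q) := by
  rw [nilpart, LinearMap.pi_apply, if_neg hq]; rfl

theorem nilpart_vone : nilpart (vone n) = 0 := by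
  funext q
  by_cases hq : q = 0
  · subst hq
    rw [nilpart_zero, vone, Pi.single_eq_same]
    exact derivAt_one _ _
  · rw [nilpart_of_ne _ hq, vone, Pi.single_eq_of_ne hq, map_zero]; rfl

/-- The nilpotent part is a derivation along the evaluation at `1` on the untwisted sector, since
the structure constants of two twisted sectors vanish at `1`. -/
theorem nilpart_vmul (a b : KI n) : nilpart (vmul n a b) =
    ev 0 0 (a 0) • nilpart b + ev 0 0 (b 0) • nilpart a := by
  funext q
  rw [Pi.add_apply, Pi.smul_apply, Pi.smul_apply, smul_eq_mul, smul_eq_mul]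
  by_cases hq : q = 0
  · subst hq
    rw [nilpart_zero, nilpart_zero, nilpart_zero, der_vmul]
  · rw [nilpart_of_ne _ hq, nilpart_of_ne _ hq, nilpart_of_ne _ hq, ev_vmul]
    have h : ∀ m₁ m₂ : ZMod n, m₁ + m₂ = q ↔ m₂ = q - m₁ := fun m₁ m₂ => eq_sub_iff_add_eq'.symm
    simp only [h, Finset.sum_ite_eq', Finset.mem_univ, if_true]
    have key : ∀ A B : ZMod n → ℂ,
        ∑ m, structConst m (q - m) 0 * (A m * B (q - m)) = A 0 * B q + B 0 * A q := by
      intro A B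
      rw [Finset.sum_eq_add 0 q (Ne.symm hq)]
      · rw [structConst, if_pos (Or.inl rfl), structConst, if_pos (Or.inr (sub_self q)), sub_zero,
          sub_self]
        ring
      · rintro m - ⟨h1, h2⟩
        have h3 : q - m ≠ 0 := fun h => h2 (sub_eq_zero.1 h).symm
        simp [structConst, h1, h3, hq]
      · exact fun h => absurd (Finset.mem_univ _) h
      · exact fun h => absurd (Finset.mem_univ _) h
    exact key (fun m => ev m 0 (a m)) fun m => ev m 0 (b m)

end

section

variable {n : ℕ} [NeZero n]

/-! ### The localized generators -/

theorem natCast_ne_zero : (n : ℂ) ≠ 0 := Nat.cast_ne_zero.2 (NeZero.ne n)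

theorem one_sub_chi_neg_ne_zero {l : ZMod n} (hl : l ≠ 0) : 1 - chi n (-l) ≠ 0 := fun h =>
  hl (neg_eq_zero.1 (chi_eq_one_iff.1 (sub_eq_zero.1 h).symm))

/-- The polynomial `(X ^ n - 1) / (X - ζ ^ l)`. -/
def cycloPoly (l : ZMod n) : Polynomial ℂ :=
  ∏ i ∈ (Finset.univ : Finset (ZMod n)).erase l, (Polynomial.X - Polynomial.C (chi n i))

theorem sub_mul_cycloPoly (l : ZMod n) :
    (Polynomial.X - Polynomial.C (chi n l)) * cycloPoly l = Polynomial.X ^ n - 1 := by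
  rw [cycloPoly, ← prod_X_sub_chi n]
  exact Finset.mul_prod_erase _ (fun i => Polynomial.X - Polynomial.C (chi n i)) (Finset.mem_univ l)

/-- The value at `ζ ^ l` is the derivative of `X ^ n - 1` there. -/
theorem eval_cycloPoly (l l' : ZMod n) :
    (cycloPoly l).eval (chi n l') = if l' = l then n * chi n (-l) else 0 := by
  split_ifs with h
  · subst h
    have h := congrArg (fun p => (Polynomial.derivative p).eval (chi n l')) (sub_mul_cycloPoly l')
    simp only [Polynomial.derivative_mul, Polynomial.derivative_sub, Polynomial.derivative_X,
      Polynomial.derivative_C, Polynomial.derivative_X_pow, Polynomial.derivative_one,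
      Polynomial.eval_add, Polynomial.eval_mul, Polynomial.eval_sub, Polynomial.eval_X,
      Polynomial.eval_C, Polynomial.eval_pow, sub_self, zero_mul, add_zero, sub_zero, one_mul] at h
    have h1 : 1 ≤ n := Nat.pos_of_ne_zero (NeZero.ne n)
    rw [h, chi_pow, Nat.cast_sub h1]
    simp
  · have h2 := congrArg (fun p => p.eval (chi n l')) (sub_mul_cycloPoly l)
    simp only [Polynomial.eval_mul, Polynomial.eval_sub, Polynomial.eval_X, Polynomial.eval_C,
      Polynomial.eval_one, Polynomial.eval_pow] at h2
    have h3 : chi n l' ^ n = 1 := by rw [chi_pow]; simp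
    rw [h3, sub_self] at h2
    exact (mul_eq_zero.1 h2).resolve_left
      (sub_ne_zero.2 fun hc => h (ZMod.injective_stdAddChar hc))

theorem cycloPoly_zero : cycloPoly (0 : ZMod n) = ∑ i ∈ Finset.range n, Polynomial.X ^ i := by
  have h := sub_mul_cycloPoly (0 : ZMod n)
  rw [← mul_geom_sum, AddChar.map_zero_eq_one, map_one] at h
  exact mul_left_cancel₀ (Polynomial.X_sub_C_ne_zero (1 : ℂ)) h

theorem cyclo_eq (m l : ZMod n) :
    cyclo n m l = Polynomial.aeval (x (wt n) (fixedBy n m) 1) (cycloPoly l) := by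
  rw [cyclo, cycloPoly, map_prod]
  refine Finset.prod_congr rfl fun i _ => ?_
  rw [map_sub, Polynomial.aeval_X, Polynomial.aeval_C, zeta_pow_val]

theorem ev_x (m l : ZMod n) : ev m l (x (wt n) (fixedBy n m) 1) = chi n l := by
  rw [ev, evalAt_x, Int.cast_one, one_mul]

theorem ev_cyclo (m l l' : ZMod n) :
    ev m l' (cyclo n m l) = if l' = l then n * chi n (-l) else 0 := by
  rw [cyclo_eq, ev, evalAt_aeval, eval_cycloPoly]

theorem der_cyclo : der n (cyclo n 0 0) = n * (n - 1) / 2 := by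
  rw [cyclo_eq, cycloPoly_zero, map_sum, map_sum]
  have h : ∀ i : ℕ, der n (Polynomial.aeval (x (wt n) (fixedBy n 0) 1)
      (Polynomial.X ^ i : Polynomial ℂ)) = i := fun i => by
    rw [map_pow, Polynomial.aeval_X, x_pow, der, derivAt_x, Int.cast_natCast]
  rw [Finset.sum_congr rfl fun i _ => h i, eq_div_iff two_ne_zero]
  have h2 := congrArg (Nat.cast (R := ℂ)) (Finset.sum_range_id_mul_two n)
  rw [Nat.cast_mul, Nat.cast_mul, Nat.cast_sub (Nat.pos_of_ne_zero (NeZero.ne n)),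
    Nat.cast_sum] at h2
  simpa using h2

theorem der_mul (z z' : Sector n 0) :
    der n (z * z') = ev 0 0 z * der n z' + ev 0 0 z' * der n z := derivAt_mul _ _ z z'

theorem der_x : der n (x (wt n) (fixedBy n 0) 1) = 1 := by
  rw [der, derivAt_x, Int.cast_one]

theorem der_one : der n 1 = 0 := derivAt_one _ _

theorem ev_oneLoc (m l l' : ZMod n) : ev m l' (oneLoc n m l) = if l' = l then 1 else 0 := by
  have hn := natCast_ne_zero (n := n)
  have hc : chi n l * chi n (-l) = 1 := by
    rw [← AddChar.map_add_eq_mul, add_neg_cancel, AddChar.map_zero_eq_one]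
  unfold oneLoc
  split_ifs with hm hl h h h
  · subst hm hl h
    simp only [map_smul, map_mul, map_add, map_one, ev_x, ev_cyclo, if_true, smul_eq_mul, neg_zero,
      AddChar.map_zero_eq_one]
    field_simp
    ring
  · subst hm hl
    simp only [map_smul, map_mul, ev_cyclo, if_neg h, mul_zero, smul_zero]
  · subst hm h
    have h2 : chi n l' - 1 ≠ 0 := fun h => hl (chi_eq_one_iff.1 (sub_eq_zero.1 h))
    simp only [map_smul, map_mul, map_sub, map_one, ev_x, ev_cyclo, if_true, smul_eq_mul,
      zeta_pow_val]
    field_simp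
    exact hc
  · subst hm
    simp only [map_smul, map_mul, ev_cyclo, if_neg h, mul_zero, smul_zero]
  · subst h
    simp only [map_smul, ev_cyclo, if_true, smul_eq_mul, zeta_pow_val]
    field_simp
    exact hc
  · simp only [map_smul, ev_cyclo, if_neg h, smul_zero]

theorem ev_xLoc (l : ZMod n) : ev 0 l (xLoc n) = if l = 0 then 1 else 0 := by
  have hn := natCast_ne_zero (n := n)
  unfold xLoc
  split_ifs with h
  · subst h
    simp only [map_smul, map_mul, map_add, map_one, ev_x, ev_cyclo, if_true, smul_eq_mul, neg_zero,
      AddChar.map_zero_eq_one]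
    field_simp
    ring
  · simp only [map_smul, map_mul, ev_cyclo, if_neg h, mul_zero, smul_zero]

theorem der_oneLoc (l : ZMod n) : der n (oneLoc n 0 l) = 0 := by
  have hn := natCast_ne_zero (n := n)
  unfold oneLoc
  rw [if_pos rfl]
  split_ifs with hl
  · subst hl
    simp only [map_smul, der_mul, map_add, map_one, ev_x, ev_cyclo, if_true, smul_eq_mul, neg_zero,
      AddChar.map_zero_eq_one, der_cyclo, der_x, der_one]
    field_simp
    ring
  · simp only [map_smul, der_mul, map_sub, map_one, ev_x, ev_cyclo, if_neg (Ne.symm hl),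
      smul_eq_mul, AddChar.map_zero_eq_one, sub_self, zero_mul, add_zero, mul_zero]

theorem der_xLoc : der n (xLoc n) = 1 := by
  have hn := natCast_ne_zero (n := n)
  unfold xLoc
  simp only [map_smul, der_mul, map_add, map_one, ev_x, ev_cyclo, if_true, smul_eq_mul, neg_zero,
    AddChar.map_zero_eq_one, der_cyclo, der_x, der_one]
  field_simp
  ring

theorem scale_mul_ev_oneHat (m : ZMod n) {l : ZMod n} (hl : l ≠ 0) (l' : ZMod n) :
    scale m l' * ev m l' (oneHat n m l) = if l' = l then 1 else 0 := by
  unfold oneHat scale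
  by_cases hm : m = 0
  · subst hm
    simp only [ne_eq, not_true, false_and, if_false, if_true, one_mul, ev_oneLoc]
  · rw [if_neg hm, if_pos ⟨hm, hl⟩, map_smul, ev_oneLoc, zeta_pow_val, ← chi_neg]
    split_ifs with h
    · subst h
      have := one_sub_chi_neg_ne_zero hl
      rw [smul_eq_mul, mul_one, mul_one_div, div_self this]
    · rw [smul_zero, mul_zero]

theorem u_of_ne {l : ZMod n} (hl : l ≠ 0) (q : ZMod n) : u n l q = (1 / n : ℂ) •
    ∑ i : ZMod n, chi n (-(i * q)) • (Pi.single i (oneHat n i l) : KI n) := by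
  rw [u, if_neg hl]
  congr 1
  refine Finset.sum_congr rfl fun i _ => ?_
  rw [zeta_pow, chi_neg, Nat.cast_mul, ZMod.natCast_zmod_val, ZMod.natCast_zmod_val]

theorem fourier_u {l : ZMod n} (hl : l ≠ 0) (q q' l' : ZMod n) :
    fourier q' l' (u n l q) = if q' = q ∧ l' = l then 1 else 0 := by
  have hn := natCast_ne_zero (n := n)
  simp only [u_of_ne hl, map_smul, map_sum, fourier_single, smul_eq_mul, mul_assoc,
    scale_mul_ev_oneHat _ hl]
  by_cases h : l' = l
  · have h2 : ∀ i : ZMod n, chi n (-(i * q)) * (chi n (i * q') * 1) = chi n (i * (q' - q)) :=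
      fun i => by
        rw [mul_one, ← AddChar.map_add_eq_mul]
        congr 1
        ring
    simp only [h, if_true, and_true, h2, sum_chi_mul, sub_eq_zero]
    split_ifs
    · rw [one_div, inv_mul_cancel₀ hn]
    · rw [mul_zero]
  · simp only [h, if_false, and_false, mul_zero, Finset.sum_const_zero]

theorem nilpart_single_of_ne {q : ZMod n} (hq : q ≠ 0) (z : Sector n q) :
    nilpart (Pi.single q z) = Pi.single q (ev q 0 z) := by
  funext q'
  by_cases h : q' = q
  · subst h
    rw [nilpart_of_ne _ hq, Pi.single_eq_same, Pi.single_eq_same]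
  · rw [Pi.single_eq_of_ne h]
    by_cases h0 : q' = 0
    · subst h0
      rw [nilpart_zero, Pi.single_eq_of_ne h, map_zero]
    · rw [nilpart_of_ne _ h0, Pi.single_eq_of_ne h, map_zero]

theorem nilpart_single_zero (z : Sector n 0) :
    nilpart (Pi.single 0 z) = Pi.single 0 (der n z) := by
  funext q
  by_cases h : q = 0
  · subst h
    rw [nilpart_zero, Pi.single_eq_same, Pi.single_eq_same]
  · rw [Pi.single_eq_of_ne h, nilpart_of_ne _ h, Pi.single_eq_of_ne h, map_zero]

theorem nilpart_u {l : ZMod n} (hl : l ≠ 0) (q : ZMod n) : nilpart (u n l q) = 0 := by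
  rw [u_of_ne hl, map_smul, map_sum, Finset.sum_eq_zero, smul_zero]
  intro i _
  rw [map_smul]
  by_cases hi : i = 0
  · subst hi
    rw [nilpart_single_zero, oneHat, if_neg (by simp), der_oneLoc, Pi.single_zero, smul_zero]
  · rw [nilpart_single_of_ne hi, oneHat, if_pos ⟨hi, hl⟩, map_smul, ev_oneLoc, if_neg (Ne.symm hl),
      smul_zero, Pi.single_zero, smul_zero]

theorem fourier_u_zero (q q' l : ZMod n) : fourier q' l (u n 0 q) = 0 := by
  rw [u, if_pos rfl]
  split_ifs with h
  · rw [fourier_single, map_sub, ev_xLoc, ev_oneLoc, sub_self, mul_zero]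
  · rw [fourier_single, ev_oneLoc, scale, if_neg h]
    split_ifs with hl
    · rw [hl, neg_zero, AddChar.map_zero_eq_one, sub_self, mul_zero, zero_mul]
    · rw [mul_zero]

theorem nilpart_u_zero (q : ZMod n) : nilpart (u n 0 q) = Pi.single q 1 := by
  rw [u, if_pos rfl]
  split_ifs with h
  · subst h
    rw [nilpart_single_zero, map_sub, der_xLoc, der_oneLoc, sub_zero]
  · rw [nilpart_single_of_ne h, ev_oneLoc, if_pos rfl]

/-- The elements with prescribed evaluations and nilpotent part. -/
def combination (c : ℂ) (g : ZMod n → ZMod n → ℂ) (β : ZMod n → ℂ) : KI n :=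
  c • vone n + ∑ q : ZMod n, ∑ l ∈ (Finset.univ : Finset (ZMod n)).erase 0, (g q l - c) • u n l q +
    ∑ q : ZMod n, β q • u n 0 q

theorem fourier_combination (c : ℂ) (g : ZMod n → ZMod n → ℂ) (β : ZMod n → ℂ) (q l : ZMod n) :
    fourier q l (combination c g β) = if l = 0 then c else g q l := by
  have h1 : ∀ q', ∀ l' ∈ (Finset.univ : Finset (ZMod n)).erase 0,
      fourier q l ((g q' l' - c) • u n l' q') =
        if q = q' then (if l = l' then g q' l' - c else 0) else 0 := fun q' l' hl => by
    rw [map_smul, fourier_u (Finset.ne_of_mem_erase hl), smul_eq_mul, mul_ite, mul_one, mul_zero,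
      ite_and]
  rw [combination, map_add, map_add, map_smul, fourier_vone, map_sum, map_sum]
  simp only [map_sum, map_smul, fourier_u_zero, smul_zero, Finset.sum_const_zero, add_zero]
  have h2 : ∀ q', ∑ l' ∈ (Finset.univ : Finset (ZMod n)).erase 0,
      (g q' l' - c) • fourier q l (u n l' q') =
        if q = q' then (if l = 0 then 0 else g q' l - c) else 0 := fun q' => by
    simp only [map_smul] at h1
    rw [Finset.sum_congr rfl (h1 q')]
    split_ifs with hq hl
    · exact Finset.sum_eq_zero fun l' hl' =>
        if_neg (hl ▸ Ne.symm (Finset.ne_of_mem_erase hl'))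
    · rw [Finset.sum_ite_eq, if_pos (Finset.mem_erase.2 ⟨hl, Finset.mem_univ _⟩)]
    · rw [Finset.sum_const_zero]
  rw [Finset.sum_congr rfl fun q' _ => h2 q', Finset.sum_ite_eq, if_pos (Finset.mem_univ _),
    smul_eq_mul, mul_one]
  split_ifs <;> ring

theorem nilpart_combination (c : ℂ) (g : ZMod n → ZMod n → ℂ) (β : ZMod n → ℂ) :
    nilpart (combination c g β) = β := by
  have h1 : ∀ q : ZMod n, ∑ l ∈ (Finset.univ : Finset (ZMod n)).erase 0,
      nilpart ((g q l - c) • u n l q) = 0 := fun q => Finset.sum_eq_zero fun l hl => by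
    rw [map_smul, nilpart_u (Finset.ne_of_mem_erase hl), smul_zero]
  rw [combination, map_add, map_add, map_smul, nilpart_vone, smul_zero, zero_add, map_sum, map_sum]
  simp only [map_sum] at h1 ⊢
  rw [Finset.sum_congr rfl fun q _ => h1 q, Finset.sum_const_zero, zero_add]
  simp only [map_smul, nilpart_u_zero]
  funext q
  rw [Finset.sum_apply, Finset.sum_eq_single q]
  · simp
  · intro q' _ h
    rw [Pi.smul_apply, Pi.single_eq_of_ne h.symm, smul_zero]
  · exact fun h => absurd (Finset.mem_univ _) h

theorem lineElt_eq (f : ZMod n → ZMod n) (β : ZMod n → ℂ) :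
    lineElt n f β = combination 1 (fun q l => chi n (l * f q)) β := by
  rw [lineElt, combination, one_smul]
  simp only [zeta_pow, Nat.cast_mul, ZMod.natCast_zmod_val]

theorem fourier_lineElt (f : ZMod n → ZMod n) (β : ZMod n → ℂ) (q l : ZMod n) :
    fourier q l (lineElt n f β) = chi n (l * f q) := by
  rw [lineElt_eq, fourier_combination]
  split_ifs with h
  · rw [h, zero_mul, AddChar.map_zero_eq_one]
  · rfl

theorem nilpart_lineElt (f : ZMod n → ZMod n) (β : ZMod n → ℂ) :
    nilpart (lineElt n f β) = β := by
  rw [lineElt_eq, nilpart_combination]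

theorem ev_lineElt (f : ZMod n → ZMod n) (β : ZMod n → ℂ) : ev 0 0 (lineElt n f β 0) = 1 := by
  rw [← fourier_zero 0, fourier_lineElt, zero_mul, AddChar.map_zero_eq_one]

/-! ### Virtual line elements -/

/-- Elements are determined by their Fourier coefficients and nilpotent parts. The evaluations at
`1` on the twisted sectors, which the rescaling kills, are components of the nilpotent part. -/
theorem eq_of_fourier_of_nilpart {a b : KI n} (h : ∀ q l, fourier q l a = fourier q l b)
    (h' : nilpart a = nilpart b) : a = b := by
  rw [← sub_eq_zero]
  set z := a - b with hz
  replace h : ∀ q l, fourier q l z = 0 := fun q l => by rw [hz, map_sub, h, sub_self]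
  replace h' : nilpart z = 0 := by rw [hz, map_sub, h', sub_self]
  have h1 : ∀ m l, scale m l * ev m l (z m) = 0 := fun m l => by
    refine congrFun (eq_zero_of_sum_chi_mul (c := fun m => scale m l * ev m l (z m)) fun q => ?_) m
    rw [← h q l, fourier_apply]
    exact Finset.sum_congr rfl fun m _ => (mul_assoc _ _ _).symm
  funext m
  by_cases hm : m = 0
  · subst hm
    refine eq_zero_of_evalAt_of_derivAt (mem_fixedBy_one 0) (mem_fixedBy_zero.2 rfl)
      (fun l => ?_) ?_
    · have := h1 0 l
      rwa [scale, if_pos rfl, one_mul] at this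
    · have := congrFun h' 0
      rwa [nilpart_zero] at this
  · refine eq_zero_of_evalAt (mem_fixedBy_one m) (mt mem_fixedBy_zero.1 hm) fun l => ?_
    by_cases hl : l = 0
    · subst hl
      have := congrFun h' m
      rwa [nilpart_of_ne _ hm] at this
    · have := h1 m l
      rw [scale, if_neg hm] at this
      exact (mul_eq_zero.1 this).resolve_left (one_sub_chi_neg_ne_zero hl)

theorem ev_adams {k : ℕ} (hk : 1 ≤ k) (m l : ZMod n) (z : Sector n m) :
    ev m l (adams (wt n) (fixedBy n m) k z) = ev m (k * l) z := by
  have : (ev m l).toLinearMap ∘ₗ adams (wt n) (fixedBy n m) k = (ev m (k * l)).toLinearMap :=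
    K_linearMap_ext (mem_fixedBy_one m) fun a => by
      rw [LinearMap.comp_apply, adams_x (mem_fixedBy_one m) hk, AlgHom.toLinearMap_apply,
        AlgHom.toLinearMap_apply, ev, ev, evalAt_x, evalAt_x]
      congr 1
      push_cast
      ring
  exact DFunLike.congr_fun this z

theorem der_adams {k : ℕ} (hk : 1 ≤ k) (z : Sector n 0) :
    der n (adams (wt n) (fixedBy n 0) k z) = k * der n z := by
  have : der n ∘ₗ adams (wt n) (fixedBy n 0) k = (k : ℂ) • der n :=
    K_linearMap_ext (mem_fixedBy_one 0) fun a => by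
      rw [LinearMap.comp_apply, adams_x (mem_fixedBy_one 0) hk, LinearMap.smul_apply, der,
        derivAt_x, derivAt_x, smul_eq_mul]
      push_cast
      ring
  exact DFunLike.congr_fun this z

theorem virtualAdams_zero (k : ℕ) (a : KI n) :
    virtualAdams n k a 0 = adams (wt n) (fixedBy n 0) k (a 0) := by
  classical
  rw [virtualAdams, Fin.prod_univ_two, if_pos (mem_fixedBy_zero.2 rfl), if_pos (mem_fixedBy_one 0),
    mul_one, mul_one]

theorem virtualAdams_of_ne (k : ℕ) (a : KI n) {m : ZMod n} (hm : m ≠ 0) : virtualAdams n k a m =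
    adams (wt n) (fixedBy n m) k (a m) * ∑ i ∈ Finset.range k, x (wt n) (fixedBy n m) (-1) ^ i := by
  classical
  rw [virtualAdams, Fin.prod_univ_two, if_neg (mt mem_fixedBy_zero.1 hm),
    if_pos (mem_fixedBy_one m), mul_one]
  rfl

/-- The Bott class `∑ i < k, x ^ (-i)` changes the factor `1 - x ^ (-1)` into `1 - x ^ (-k)`. -/
theorem scale_mul_ev_virtualAdams {k : ℕ} (hk : 1 ≤ k) (a : KI n) (m l : ZMod n) :
    scale m l * ev m l (virtualAdams n k a m) = scale m (k * l) * ev m (k * l) (a m) := by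
  by_cases hm : m = 0
  · subst hm
    rw [virtualAdams_zero, ev_adams hk, scale, scale, if_pos rfl, if_pos rfl]
  · rw [virtualAdams_of_ne k a hm, map_mul, ev_adams hk, map_sum, scale, scale, if_neg hm, if_neg hm]
    have h1 : ∀ i : ℕ, ev m l (x (wt n) (fixedBy n m) (-1) ^ i) = chi n (-l) ^ i := fun i => by
      rw [map_pow, ev, evalAt_x]
      congr 2
      push_cast
      ring
    rw [Finset.sum_congr rfl fun i _ => h1 i]
    have h2 := mul_neg_geom_sum (chi n (-l)) k
    rw [chi_pow, mul_neg] at h2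
    rw [← h2]
    ring

theorem fourier_virtualAdams {k : ℕ} (hk : 1 ≤ k) (a : KI n) (q l : ZMod n) :
    fourier q l (virtualAdams n k a) = fourier q (k * l) a := by
  rw [fourier_apply, fourier_apply]
  refine Finset.sum_congr rfl fun m _ => ?_
  rw [mul_assoc, scale_mul_ev_virtualAdams hk, mul_assoc]

theorem nilpart_virtualAdams {k : ℕ} (hk : 1 ≤ k) (a : KI n) :
    nilpart (virtualAdams n k a) = (k : ℂ) • nilpart a := by
  funext q
  rw [Pi.smul_apply, smul_eq_mul]
  by_cases hq : q = 0
  · subst hq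
    rw [nilpart_zero, nilpart_zero, virtualAdams_zero, der_adams hk]
  · rw [nilpart_of_ne _ hq, nilpart_of_ne _ hq, virtualAdams_of_ne k a hq, map_mul, ev_adams hk,
      mul_zero, map_sum, mul_comm]
    congr 1
    have h1 : ∀ i : ℕ, ev q 0 (x (wt n) (fixedBy n q) (-1) ^ i) = 1 := fun i => by
      rw [map_pow, ev, evalAt_x, mul_zero, AddChar.map_zero_eq_one, one_pow]
    rw [Finset.sum_congr rfl fun i _ => h1 i]
    simp

theorem fourier_vpow (a : KI n) (k : ℕ) (q l : ZMod n) :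
    fourier q l (vpow n a k) = fourier q l a ^ k := by
  induction k with
  | zero => rw [vpow, fourier_vone, pow_zero]
  | succ k ih => rw [vpow, fourier_vmul, ih, pow_succ]

theorem nilpart_vpow {a : KI n} (ha : ev 0 0 (a 0) = 1) (k : ℕ) :
    nilpart (vpow n a k) = (k : ℂ) • nilpart a := by
  induction k with
  | zero => rw [vpow, nilpart_vone, Nat.cast_zero, zero_smul]
  | succ k ih =>
    have h : ev 0 0 (vpow n a k 0) = 1 := by
      rw [← fourier_zero 0, fourier_vpow, fourier_zero, ha, one_pow]
    rw [vpow, nilpart_vmul, ih, h, ha, one_smul, one_smul, Nat.cast_succ, add_smul, one_smul,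
      add_comm]

theorem vmul_lineElt (f f' : ZMod n → ZMod n) (β β' : ZMod n → ℂ) :
    vmul n (lineElt n f β) (lineElt n f' β') = lineElt n (f + f') (β + β') := by
  refine eq_of_fourier_of_nilpart (fun q l => ?_) ?_
  · rw [fourier_vmul, fourier_lineElt, fourier_lineElt, fourier_lineElt, ← AddChar.map_add_eq_mul,
      Pi.add_apply, mul_add]
  · rw [nilpart_vmul, nilpart_lineElt, nilpart_lineElt, nilpart_lineElt, ev_lineElt, ev_lineElt,
      one_smul, one_smul, add_comm]

theorem lineElt_zero : lineElt n 0 0 = vone n := by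
  refine eq_of_fourier_of_nilpart (fun q l => ?_) ?_
  · rw [fourier_lineElt, fourier_vone, Pi.zero_apply, mul_zero, AddChar.map_zero_eq_one]
  · rw [nilpart_lineElt, nilpart_vone]

/-- Both the virtual Adams operation and the `k`-th power raise the Fourier coefficients
`ζ ^ (l f_q)` to the `k`-th power and multiply the nilpotent part by `k`. -/
theorem isVirtualLineElement_lineElt (f : ZMod n → ZMod n) (β : ZMod n → ℂ) :
    IsVirtualLineElement n (lineElt n f β) := by
  refine ⟨⟨lineElt n (-f) (-β), ?_, ?_⟩, fun k hk => eq_of_fourier_of_nilpart (fun q l => ?_) ?_⟩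
  · rw [vmul_lineElt, add_neg_cancel, add_neg_cancel, lineElt_zero]
  · rw [vmul_lineElt, neg_add_cancel, neg_add_cancel, lineElt_zero]
  · rw [fourier_virtualAdams hk, fourier_vpow, fourier_lineElt, fourier_lineElt, chi_pow, mul_assoc]
  · rw [nilpart_virtualAdams hk, nilpart_vpow (ev_lineElt f β)]

theorem nu_eq (j : ZMod n) : nu n j = lineElt n 0 (Pi.single j 1) := by
  rw [nu, add_sub_cancel]

end

/-! ### The ring with the given presentation -/

/-- The pairs `(q, l)` of indices in `ℤ/n` with `l ≠ 0`. -/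
abbrev Index (n : ℕ) : Type := {p : ZMod n × ZMod n // p.2 ≠ 0}

section

variable {n : ℕ}

variable (n) in
/-- The class of `σ_i` in the ring with the given presentation. -/
def sigmaCls (i : ZMod n) : LaurentRing n ⧸ relIdeal n := Ideal.Quotient.mk _ (sigmaVar n i)

variable (n) in
/-- The class of `ν_j` in the ring with the given presentation. -/
def nuCls (j : ZMod n) : LaurentRing n ⧸ relIdeal n := Ideal.Quotient.mk _ (nuVar n j)

/-- The elements `1`, `σ_q ^ l - 1` for `l ≠ 0`, and `ν_j - 1`, which span the ring with the given
presentation. -/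
def spanningFamily (n : ℕ) : Index n ⊕ (Unit ⊕ ZMod n) → LaurentRing n ⧸ relIdeal n :=
  Sum.elim (fun p => sigmaCls n p.1.1 ^ p.1.2.val - 1)
    (Sum.elim (fun _ => 1) fun j => nuCls n j - 1)

theorem sigmaCls_pow (i : ZMod n) : sigmaCls n i ^ n = 1 := by
  rw [← sub_eq_zero]
  exact Ideal.Quotient.eq_zero_iff_mem.2
    (Ideal.subset_span (Or.inl (Or.inl (Or.inl ⟨i, rfl⟩))))

theorem nuCls_mul (i j : ZMod n) : (nuCls n i - 1) * (nuCls n j - 1) = 0 :=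
  Ideal.Quotient.eq_zero_iff_mem.2 (Ideal.subset_span (Or.inl (Or.inl (Or.inr ⟨i, j, rfl⟩))))

theorem sigmaCls_mul_nuCls (i j : ZMod n) : sigmaCls n i * (nuCls n j - 1) = nuCls n j - 1 := by
  rw [← sub_eq_zero]
  exact Ideal.Quotient.eq_zero_iff_mem.2 (Ideal.subset_span (Or.inl (Or.inr ⟨i, j, rfl⟩)))

theorem sigmaCls_mul_sigmaCls {i j : ZMod n} (h : i ≠ j) :
    (sigmaCls n i - 1) * (sigmaCls n j - 1) = 0 :=
  Ideal.Quotient.eq_zero_iff_mem.2 (Ideal.subset_span (Or.inr ⟨i, j, h, rfl⟩))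

/-- As `σ_i ^ n = 1`, the exponents may be reduced modulo `n`. -/
theorem sigmaCls_pow_sub_one_mem (i : ZMod n) (k : ℕ) :
    sigmaCls n i ^ k - 1 ∈ Submodule.span ℂ (Set.range (spanningFamily n)) := by
  have h : sigmaCls n i ^ k = sigmaCls n i ^ (k : ZMod n).val := by
    conv_lhs => rw [← Nat.div_add_mod k n, pow_add, pow_mul, sigmaCls_pow, one_pow, one_mul]
    rw [ZMod.val_natCast]
  rw [h]
  by_cases hk : (k : ZMod n) = 0
  · rw [hk, ZMod.val_zero, pow_zero, sub_self]
    exact zero_mem _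
  · exact Submodule.subset_span ⟨Sum.inl ⟨(i, k), hk⟩, rfl⟩

theorem one_mem_span : 1 ∈ Submodule.span ℂ (Set.range (spanningFamily n)) :=
  Submodule.subset_span ⟨Sum.inr (Sum.inl ()), rfl⟩

theorem nuCls_sub_one_mem (j : ZMod n) :
    nuCls n j - 1 ∈ Submodule.span ℂ (Set.range (spanningFamily n)) :=
  Submodule.subset_span ⟨Sum.inr (Sum.inr j), rfl⟩

theorem sigmaCls_mul_mem (i : ZMod n) {z : LaurentRing n ⧸ relIdeal n}
    (hz : z ∈ Submodule.span ℂ (Set.range (spanningFamily n))) :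
    sigmaCls n i * z ∈ Submodule.span ℂ (Set.range (spanningFamily n)) := by
  induction hz using Submodule.span_induction with
  | mem z hz =>
    obtain ⟨p | _ | j, rfl⟩ := hz
    · change sigmaCls n i * (sigmaCls n p.1.1 ^ p.1.2.val - 1) ∈ _
      by_cases h : i = p.1.1
      · have h2 : sigmaCls n i * (sigmaCls n p.1.1 ^ p.1.2.val - 1) =
            (sigmaCls n i ^ (p.1.2.val + 1) - 1) - (sigmaCls n i ^ 1 - 1) := by
          rw [← h]; ring
        rw [h2]
        exact sub_mem (sigmaCls_pow_sub_one_mem _ _) (sigmaCls_pow_sub_one_mem _ _)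
      · obtain ⟨c, hc⟩ := sub_one_dvd_pow_sub_one (sigmaCls n p.1.1) p.1.2.val
        have h2 : sigmaCls n i * (sigmaCls n p.1.1 ^ p.1.2.val - 1) =
            sigmaCls n p.1.1 ^ p.1.2.val - 1 := by
          rw [hc]
          linear_combination c * sigmaCls_mul_sigmaCls h
        rw [h2]
        exact sigmaCls_pow_sub_one_mem _ _
    · change sigmaCls n i * 1 ∈ _
      have h2 : sigmaCls n i * 1 = (sigmaCls n i ^ 1 - 1) + 1 := by ring
      rw [h2]
      exact add_mem (sigmaCls_pow_sub_one_mem _ _) one_mem_span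
    · change sigmaCls n i * (nuCls n j - 1) ∈ _
      rw [sigmaCls_mul_nuCls]
      exact nuCls_sub_one_mem j
  | zero => rw [mul_zero]; exact zero_mem _
  | add y z _ _ hy hz => rw [mul_add]; exact add_mem hy hz
  | smul c z _ hz => rw [mul_smul_comm]; exact Submodule.smul_mem _ _ hz

theorem nuCls_mul_mem (j : ZMod n) {z : LaurentRing n ⧸ relIdeal n}
    (hz : z ∈ Submodule.span ℂ (Set.range (spanningFamily n))) :
    nuCls n j * z ∈ Submodule.span ℂ (Set.range (spanningFamily n)) := by
  induction hz using Submodule.span_induction with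
  | mem z hz =>
    obtain ⟨p | _ | i, rfl⟩ := hz
    · change nuCls n j * (sigmaCls n p.1.1 ^ p.1.2.val - 1) ∈ _
      obtain ⟨c, hc⟩ := sub_one_dvd_pow_sub_one (sigmaCls n p.1.1) p.1.2.val
      have h2 : nuCls n j * (sigmaCls n p.1.1 ^ p.1.2.val - 1) =
          sigmaCls n p.1.1 ^ p.1.2.val - 1 := by
        rw [hc]
        linear_combination c * sigmaCls_mul_nuCls p.1.1 j
      rw [h2]
      exact sigmaCls_pow_sub_one_mem _ _
    · change nuCls n j * 1 ∈ _
      have h2 : nuCls n j * 1 = (nuCls n j - 1) + 1 := by ring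
      rw [h2]
      exact add_mem (nuCls_sub_one_mem j) one_mem_span
    · change nuCls n j * (nuCls n i - 1) ∈ _
      have h2 : nuCls n j * (nuCls n i - 1) = nuCls n i - 1 := by
        linear_combination nuCls_mul j i
      rw [h2]
      exact nuCls_sub_one_mem i
  | zero => rw [mul_zero]; exact zero_mem _
  | add y z _ _ hy hz => rw [mul_add]; exact add_mem hy hz
  | smul c z _ hz => rw [mul_smul_comm]; exact Submodule.smul_mem _ _ hz

variable (n) in
/-- The class of a monomial in the ring with the given presentation. -/
def monomialCls (g : ZMod n ⊕ ZMod n →₀ ℤ) : LaurentRing n ⧸ relIdeal n :=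
  Ideal.Quotient.mk _ (AddMonoidAlgebra.single g 1)

theorem monomialCls_add (g h : ZMod n ⊕ ZMod n →₀ ℤ) :
    monomialCls n (g + h) = monomialCls n g * monomialCls n h := by
  rw [monomialCls, monomialCls, monomialCls, ← map_mul, AddMonoidAlgebra.single_mul_single, one_mul]

theorem monomialCls_zero : monomialCls n 0 = 1 := rfl

end

section

variable {n : ℕ} [NeZero n]

/-! ### The virtual K-theory as a split algebra -/

/-- The algebra `ℂ ^ (n (n - 1)) × ℂ[ε_0, …, ε_{n-1}] / (ε_i ε_j)`. -/
abbrev SplitAlgebra (n : ℕ) : Type := (Index n → ℂ) × TrivSqZeroExt ℂ (ZMod n → ℂ)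

variable (n) in
/-- The Fourier coefficients and the nilpotent part of an element of the virtual K-theory. -/
def evaluation : KI n →ₗ[ℂ] SplitAlgebra n where
  toFun a := (fun p => fourier p.1.1 p.1.2 a,
    TrivSqZeroExt.inl (ev 0 0 (a 0)) + TrivSqZeroExt.inr (nilpart a))
  map_add' a b := by
    refine Prod.ext (funext fun p => map_add _ a b) (TrivSqZeroExt.ext ?_ ?_)
    · simp
    · simp
  map_smul' c a := by
    refine Prod.ext (funext fun p => map_smul _ c a) (TrivSqZeroExt.ext ?_ ?_)
    · simp
    · simp

theorem fst_evaluation (a : KI n) (p : Index n) :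
    (evaluation n a).1 p = fourier p.1.1 p.1.2 a := rfl

theorem fst_snd_evaluation (a : KI n) : (evaluation n a).2.fst = ev 0 0 (a 0) := by
  change (TrivSqZeroExt.inl (ev 0 0 (a 0)) + TrivSqZeroExt.inr (nilpart a)).fst = _
  simp

theorem snd_snd_evaluation (a : KI n) : (evaluation n a).2.snd = nilpart a := by
  change (TrivSqZeroExt.inl (ev 0 0 (a 0)) + TrivSqZeroExt.inr (nilpart a)).snd = _
  simp

theorem evaluation_vone : evaluation n (vone n) = 1 := by
  refine Prod.ext (funext fun p => fourier_vone _ _) (TrivSqZeroExt.ext ?_ ?_)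
  · rw [fst_snd_evaluation, ← fourier_zero 0, fourier_vone]; rfl
  · rw [snd_snd_evaluation, nilpart_vone]; rfl

theorem evaluation_vmul (a b : KI n) :
    evaluation n (vmul n a b) = evaluation n a * evaluation n b := by
  refine Prod.ext (funext fun p => fourier_vmul _ _ _ _) (TrivSqZeroExt.ext ?_ ?_)
  · rw [Prod.snd_mul, TrivSqZeroExt.fst_mul, fst_snd_evaluation, fst_snd_evaluation,
      fst_snd_evaluation, ← fourier_zero 0, fourier_vmul, fourier_zero, fourier_zero]
  · rw [Prod.snd_mul, TrivSqZeroExt.snd_mul, snd_snd_evaluation, snd_snd_evaluation,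
      snd_snd_evaluation, fst_snd_evaluation, fst_snd_evaluation, nilpart_vmul, op_smul_eq_smul]

theorem evaluation_injective : Function.Injective (evaluation n) := by
  intro a b h
  refine eq_of_fourier_of_nilpart (fun q l => ?_) ?_
  · by_cases hl : l = 0
    · rw [hl, fourier_zero, fourier_zero, ← fst_snd_evaluation, h, fst_snd_evaluation]
    · exact congrFun (congrArg Prod.fst h) ⟨(q, l), hl⟩
  · rw [← snd_snd_evaluation, h, snd_snd_evaluation]

theorem evaluation_surjective : Function.Surjective (evaluation n) := by
  classical
  intro t
  refine ⟨combination t.2.fst (fun q l => if h : l ≠ 0 then t.1 ⟨(q, l), h⟩ else 0) t.2.snd,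
    Prod.ext (funext fun p => ?_) (TrivSqZeroExt.ext ?_ ?_)⟩
  · rw [fst_evaluation, fourier_combination, if_neg p.2, dif_pos p.2]
  · rw [fst_snd_evaluation, ← fourier_zero 0, fourier_combination, if_pos rfl]
  · rw [snd_snd_evaluation, nilpart_combination]

theorem evaluation_lineElt (f : ZMod n → ZMod n) (β : ZMod n → ℂ) : evaluation n (lineElt n f β) =
    (fun p => chi n (p.1.2 * f p.1.1), 1 + TrivSqZeroExt.inr β) := by
  refine Prod.ext (funext fun p => fourier_lineElt _ _ _ _) (TrivSqZeroExt.ext ?_ ?_)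
  · rw [fst_snd_evaluation, ev_lineElt]; simp
  · rw [snd_snd_evaluation, nilpart_lineElt]; simp

theorem evaluation_sigma (i : ZMod n) : evaluation n (sigma n i) =
    (fun p => if p.1.1 = i then chi n p.1.2 else 1, 1) := by
  rw [sigma, evaluation_lineElt]
  refine Prod.ext (funext fun p => ?_) ?_
  · by_cases h : p.1.1 = i
    · simp only [h, Pi.single_eq_same, mul_one, if_true]
    · simp only [Pi.single_eq_of_ne h, mul_zero, AddChar.map_zero_eq_one, if_neg h]
  · simp

theorem evaluation_nu (j : ZMod n) : evaluation n (nu n j) =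
    (1, 1 + TrivSqZeroExt.inr (Pi.single j 1)) := by
  rw [nu_eq, evaluation_lineElt]
  refine Prod.ext (funext fun p => ?_) rfl
  simp

/-! ### The presentation -/

variable (n) in
/-- The homomorphism from the Laurent polynomial ring to the split algebra that takes monomials to
the evaluations of the corresponding virtual line elements. -/
def laurentHom : LaurentRing n →ₐ[ℂ] SplitAlgebra n :=
  AddMonoidAlgebra.lift ℂ (SplitAlgebra n) (ZMod n ⊕ ZMod n →₀ ℤ)
    { toFun := fun g => evaluation n (lineElt n (fun q => (g.toAdd (Sum.inl q) : ZMod n))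
        fun j => (g.toAdd (Sum.inr j) : ℂ))
      map_one' := by
        rw [← evaluation_vone, ← lineElt_zero]
        congr 2
        · funext q
          simp
        · funext j
          simp
      map_mul' := fun g h => by
        rw [← evaluation_vmul, vmul_lineElt]
        congr 2
        · funext q
          simp
        · funext j
          simp }

theorem laurentHom_sigmaVar (i : ZMod n) :
    laurentHom n (sigmaVar n i) = evaluation n (sigma n i) := by
  rw [laurentHom, sigmaVar, AddMonoidAlgebra.lift_single, one_smul, sigma]
  change evaluation n (lineElt n (fun q => ((Finsupp.single (Sum.inl i) (1 : ℤ) (Sum.inl q) : ℤ) :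
    ZMod n)) fun j => ((Finsupp.single (Sum.inl i) (1 : ℤ) (Sum.inr j) : ℤ) : ℂ)) = _
  congr 2
  · funext q
    by_cases h : q = i
    · subst h; simp
    · rw [Finsupp.single_eq_of_ne (fun hc => h (Sum.inl_injective hc)), Pi.single_eq_of_ne h,
        Int.cast_zero]
  · funext j
    simp

theorem laurentHom_nuVar (j : ZMod n) : laurentHom n (nuVar n j) = evaluation n (nu n j) := by
  rw [laurentHom, nuVar, AddMonoidAlgebra.lift_single, one_smul, nu_eq]
  change evaluation n (lineElt n (fun q => ((Finsupp.single (Sum.inr j) (1 : ℤ) (Sum.inl q) : ℤ) :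
    ZMod n)) fun i => ((Finsupp.single (Sum.inr j) (1 : ℤ) (Sum.inr i) : ℤ) : ℂ)) = _
  congr 2
  · funext q
    simp
  · funext i
    by_cases h : i = j
    · subst h; simp
    · rw [Finsupp.single_eq_of_ne (fun hc => h (Sum.inr_injective hc)), Pi.single_eq_of_ne h,
        Int.cast_zero]

theorem relIdeal_le_ker : relIdeal n ≤ RingHom.ker (laurentHom n) := by
  rw [relIdeal, Ideal.span_le]
  rintro p (((⟨i, rfl⟩ | ⟨i, j, rfl⟩) | ⟨i, j, rfl⟩) | ⟨i, j, hij, rfl⟩) <;>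
    rw [SetLike.mem_coe, RingHom.mem_ker] <;>
    simp only [map_sub, map_mul, map_pow, map_one, laurentHom_sigmaVar, laurentHom_nuVar,
      evaluation_sigma, evaluation_nu]
  · refine Prod.ext (funext fun p => ?_) ?_
    · change (if p.1.1 = i then chi n p.1.2 else 1) ^ n - 1 = 0
      split_ifs
      · rw [chi_pow]; simp
      · simp
    · change (1 : TrivSqZeroExt ℂ (ZMod n → ℂ)) ^ n - 1 = 0
      simp
  · refine Prod.ext (funext fun p => ?_) ?_
    · change ((1 : ℂ) - 1) * (1 - 1) = 0
      simp
    · change (1 + TrivSqZeroExt.inr (Pi.single i 1) - 1) *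
        (1 + TrivSqZeroExt.inr (Pi.single j 1) - 1) = (0 : TrivSqZeroExt ℂ (ZMod n → ℂ))
      rw [add_sub_cancel_left, add_sub_cancel_left, TrivSqZeroExt.inr_mul_inr]
  · refine Prod.ext (funext fun p => ?_) ?_
    · change (if p.1.1 = i then chi n p.1.2 else 1) * ((1 : ℂ) - 1) - (1 - 1) = 0
      simp
    · change 1 * (1 + TrivSqZeroExt.inr (Pi.single j 1) - 1) -
        (1 + TrivSqZeroExt.inr (Pi.single j 1) - 1) = (0 : TrivSqZeroExt ℂ (ZMod n → ℂ))
      rw [one_mul, sub_self]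
  · refine Prod.ext (funext fun p => ?_) ?_
    · change ((if p.1.1 = i then chi n p.1.2 else 1) - 1) *
        ((if p.1.1 = j then chi n p.1.2 else 1) - 1) = 0
      by_cases h : p.1.1 = i
      · rw [if_neg (fun h' => hij (h.symm.trans h')), sub_self, mul_zero]
      · rw [if_neg h, sub_self, zero_mul]
    · change ((1 : TrivSqZeroExt ℂ (ZMod n → ℂ)) - 1) * (1 - 1) = 0
      simp

variable (n) in
/-- The homomorphism from the ring with the given presentation to the split algebra. -/
def presentationHom : (LaurentRing n ⧸ relIdeal n) →ₐ[ℂ] SplitAlgebra n :=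
  Ideal.Quotient.liftₐ _ (laurentHom n) fun _ h => relIdeal_le_ker h

theorem presentationHom_mk (p : LaurentRing n) :
    presentationHom n (Ideal.Quotient.mk _ p) = laurentHom n p := rfl

/-- The Fourier inversion formula over the powers of `σ_q` gives the idempotents of the factors `ℂ`,
and the elements `ν_j - 1` map to the generators `ε_j`. -/
theorem presentationHom_surjective : Function.Surjective (presentationHom n) := by
  have hn := natCast_ne_zero (n := n)
  have hσ : ∀ i, presentationHom n (sigmaCls n i) =
      (fun p => if p.1.1 = i then chi n p.1.2 else 1, 1) := fun i => by
    rw [sigmaCls, presentationHom_mk, laurentHom_sigmaVar, evaluation_sigma]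
  have hν : ∀ j, presentationHom n (nuCls n j) =
      (1, 1 + TrivSqZeroExt.inr (Pi.single j 1)) := fun j => by
    rw [nuCls, presentationHom_mk, laurentHom_nuVar, evaluation_nu]
  let R : Submodule ℂ (SplitAlgebra n) := LinearMap.range (presentationHom n).toLinearMap
  have h1 : (1 : SplitAlgebra n) ∈ R := ⟨1, map_one (presentationHom n)⟩
  -- The idempotent at `(q, l)` is the Fourier transform of the powers of `σ_q`.
  have h2 : ∀ p : Index n, (Pi.single p 1, 0) ∈ R := fun p => by
    refine ⟨(1 / n : ℂ) • ∑ k : ZMod n, chi n (-(k * p.1.2)) • (sigmaCls n p.1.1 ^ k.val - 1), ?_⟩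
    rw [AlgHom.toLinearMap_apply, map_smul, map_sum]
    simp only [map_smul, map_sub, map_pow, map_one, hσ]
    refine Prod.ext (funext fun p' => ?_) ?_
    · rw [Prod.smul_fst, Prod.fst_sum, Pi.smul_apply, Finset.sum_apply]
      change (1 / n : ℂ) * ∑ k : ZMod n, chi n (-(k * p.1.2)) *
        ((if p'.1.1 = p.1.1 then chi n p'.1.2 else 1) ^ k.val - 1) = _
      by_cases h : p'.1.1 = p.1.1
      · have h3 : ∀ k : ZMod n, chi n (-(k * p.1.2)) * (chi n p'.1.2 ^ k.val - 1) =
            chi n (k * (p'.1.2 - p.1.2)) - chi n (k * (-p.1.2)) := fun k => by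
          rw [chi_pow, ZMod.natCast_zmod_val, mul_sub, mul_one, ← AddChar.map_add_eq_mul]
          congr 2 <;> ring
        simp only [if_pos h, h3, Finset.sum_sub_distrib, sum_chi_mul, neg_eq_zero, if_neg p.2,
          sub_zero]
        by_cases h4 : p'.1.2 = p.1.2
        · have h5 : p' = p := Subtype.ext (Prod.ext h h4)
          rw [h5, Pi.single_eq_same, sub_self, if_pos rfl, one_div, inv_mul_cancel₀ hn]
        · rw [if_neg (sub_ne_zero.2 h4), mul_zero, Pi.single_eq_of_ne]
          rintro rfl
          exact h4 rfl
      · simp only [if_neg h, one_pow, sub_self, mul_zero, Finset.sum_const_zero]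
        rw [Pi.single_eq_of_ne]
        rintro rfl
        exact h rfl
    · rw [Prod.smul_snd, Prod.snd_sum]
      simp
  have h3 : ∀ j : ZMod n, ((0, TrivSqZeroExt.inr (Pi.single j 1)) : SplitAlgebra n) ∈ R :=
    fun j => by
      refine ⟨nuCls n j - 1, ?_⟩
      rw [AlgHom.toLinearMap_apply, map_sub, hν, map_one]
      refine Prod.ext (sub_self _) ?_
      exact add_sub_cancel_left _ _
  intro t
  have h4 : t = t.2.fst • 1 + ∑ p, (t.1 p - t.2.fst) • ((Pi.single p 1, 0) : SplitAlgebra n) +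
      ∑ j, t.2.snd j • ((0, TrivSqZeroExt.inr (Pi.single j 1)) : SplitAlgebra n) := by
    refine Prod.ext (funext fun p => ?_) (TrivSqZeroExt.ext ?_ ?_)
    · simp only [Prod.fst_add, Prod.fst_sum, Prod.smul_fst, Pi.add_apply, Finset.sum_apply,
        Pi.smul_apply, Prod.fst_one, Pi.one_apply, smul_zero, Finset.sum_const_zero, smul_eq_mul,
        Pi.zero_apply, add_zero, mul_one, Pi.single_apply, mul_ite, mul_zero, Finset.sum_ite_eq,
        Finset.mem_univ, if_true]
      ring
    · simp [Prod.snd_sum, TrivSqZeroExt.fst_sum]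
    · funext j
      simp [Prod.snd_sum, TrivSqZeroExt.snd_sum, Finset.sum_apply, Pi.single_apply]
  have h5 : t ∈ R := by
    rw [h4]
    exact add_mem (add_mem (R.smul_mem _ h1) (R.sum_mem fun p _ => R.smul_mem _ (h2 p)))
      (R.sum_mem fun j _ => R.smul_mem _ (h3 j))
  exact h5

/-- The span of the family is stable under multiplication by the variables and their inverses: the
inverse of `σ_i` is `σ_i ^ (n - 1)`, and that of `ν_j` is `2 - ν_j`. -/
theorem monomialCls_mul_mem (g : ZMod n ⊕ ZMod n →₀ ℤ) {z : LaurentRing n ⧸ relIdeal n}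
    (hz : z ∈ Submodule.span ℂ (Set.range (spanningFamily n))) :
    monomialCls n g * z ∈ Submodule.span ℂ (Set.range (spanningFamily n)) := by
  have hpos : ∀ (s : ZMod n ⊕ ZMod n), ∀ z ∈ Submodule.span ℂ (Set.range (spanningFamily n)),
      monomialCls n (Finsupp.single s 1) * z ∈ Submodule.span ℂ (Set.range (spanningFamily n)) := by
    rintro (i | j) z hz
    · exact sigmaCls_mul_mem i hz
    · exact nuCls_mul_mem j hz
  have hinv : ∀ s : ZMod n ⊕ ZMod n,
      monomialCls n (Finsupp.single s 1) * monomialCls n (Finsupp.single s (-1)) = 1 := fun s => by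
    rw [← monomialCls_add, ← Finsupp.single_add, add_neg_cancel, Finsupp.single_zero,
      monomialCls_zero]
  have hneg : ∀ (s : ZMod n ⊕ ZMod n), ∀ z ∈ Submodule.span ℂ (Set.range (spanningFamily n)),
      monomialCls n (Finsupp.single s (-1)) * z ∈
        Submodule.span ℂ (Set.range (spanningFamily n)) := by
    rintro (i | j) z hz
    · have h1 : monomialCls n (Finsupp.single (Sum.inl i) (-1)) = sigmaCls n i ^ (n - 1) := by
        have h2 : sigmaCls n i ^ (n - 1) * sigmaCls n i = 1 := by
          rw [← pow_succ, Nat.sub_add_cancel (Nat.pos_of_ne_zero (NeZero.ne n)), sigmaCls_pow]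
        have h3 : sigmaCls n i * monomialCls n (Finsupp.single (Sum.inl i) (-1)) = 1 :=
          hinv (Sum.inl i)
        exact (left_inv_eq_right_inv h2 h3).symm
      rw [h1]
      generalize n - 1 = k
      induction k with
      | zero => rwa [pow_zero, one_mul]
      | succ k ih => rw [pow_succ', mul_assoc]; exact sigmaCls_mul_mem i ih
    · have h1 : monomialCls n (Finsupp.single (Sum.inr j) (-1)) = 2 - nuCls n j := by
        have h2 : (2 - nuCls n j) * nuCls n j = 1 := by linear_combination -nuCls_mul j j
        have h3 : nuCls n j * monomialCls n (Finsupp.single (Sum.inr j) (-1)) = 1 :=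
          hinv (Sum.inr j)
        exact (left_inv_eq_right_inv h2 h3).symm
      have h4 : (2 - nuCls n j) * z = z + z - nuCls n j * z := by ring
      rw [h1, h4]
      exact sub_mem (add_mem hz hz) (nuCls_mul_mem j hz)
  have hsingle : ∀ (s : ZMod n ⊕ ZMod n) (k : ℤ),
      ∀ z ∈ Submodule.span ℂ (Set.range (spanningFamily n)),
      monomialCls n (Finsupp.single s k) * z ∈
        Submodule.span ℂ (Set.range (spanningFamily n)) := by
    intro s k
    induction k using Int.induction_on with
    | zero =>
      intro z hz
      rwa [Finsupp.single_zero, monomialCls_zero, one_mul]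
    | succ k ih =>
      intro z hz
      rw [Finsupp.single_add, monomialCls_add, mul_assoc]
      exact ih _ (hpos s z hz)
    | pred k ih =>
      intro z hz
      rw [sub_eq_add_neg, Finsupp.single_add, monomialCls_add, mul_assoc]
      exact ih _ (hneg s z hz)
  induction g using Finsupp.induction generalizing z with
  | zero => rwa [monomialCls_zero, one_mul]
  | single_add s k g _ _ ih =>
    rw [monomialCls_add, mul_assoc]
    exact hsingle s k _ (ih hz)

theorem span_spanningFamily : Submodule.span ℂ (Set.range (spanningFamily n)) = ⊤ := by
  rw [eq_top_iff]
  rintro z -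
  obtain ⟨p, rfl⟩ := Ideal.Quotient.mk_surjective z
  induction p using AddMonoidAlgebra.induction_linear with
  | zero => rw [map_zero]; exact zero_mem _
  | add p q hp hq => rw [map_add]; exact add_mem hp hq
  | single g c =>
    have h : Ideal.Quotient.mk (relIdeal n) (AddMonoidAlgebra.single g c) =
        c • (monomialCls n g * 1) := by
      rw [mul_one, monomialCls]
      change _ = Ideal.Quotient.mk (relIdeal n) (c • AddMonoidAlgebra.single g 1)
      rw [AddMonoidAlgebra.smul_single, smul_eq_mul, mul_one]
    rw [h]
    exact Submodule.smul_mem _ _ (monomialCls_mul_mem g one_mem_span)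

theorem finrank_splitAlgebra :
    Module.finrank ℂ (SplitAlgebra n) = Fintype.card (Index n ⊕ (Unit ⊕ ZMod n)) := by
  change Module.finrank ℂ ((Index n → ℂ) × (ℂ × (ZMod n → ℂ))) = _
  simp

/-- A surjective map onto a space whose dimension is the number of generators is injective. -/
theorem presentationHom_bijective : Function.Bijective (presentationHom n) := by
  have hfin : Module.Finite ℂ (LaurentRing n ⧸ relIdeal n) :=
    ⟨Submodule.fg_def.2 ⟨_, Set.finite_range _, span_spanningFamily⟩⟩
  have hfin' : Module.Finite ℂ (SplitAlgebra n) :=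
    inferInstanceAs (Module.Finite ℂ ((Index n → ℂ) × (ℂ × (ZMod n → ℂ))))
  have hle : Module.finrank ℂ (LaurentRing n ⧸ relIdeal n) ≤ Module.finrank ℂ (SplitAlgebra n) := by
    rw [finrank_splitAlgebra, ← finrank_top, ← span_spanningFamily]
    exact finrank_range_le_card _
  have hge := LinearMap.finrank_le_finrank_of_surjective (f := (presentationHom n).toLinearMap)
    presentationHom_surjective
  exact ⟨(LinearMap.injective_iff_surjective_of_finrank_eq_finrank (hle.antisymm hge)
    (f := (presentationHom n).toLinearMap)).2 presentationHom_surjective,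
    presentationHom_surjective⟩

end

end VirtualK

end

open VirtualK in
theorem theorem8p1 (n : ℕ) [NeZero n] (hn : 2 ≤ n) :
    (∀ i : ZMod n, IsVirtualLineElement n (sigma n i)) ∧
    (∀ j : ZMod n, IsVirtualLineElement n (nu n j)) ∧
    ∃ φ : (LaurentRing n ⧸ relIdeal n) ≃ₗ[ℂ] KI n,
      φ 1 = vone n ∧
      (∀ a b, φ (a * b) = vmul n (φ a) (φ b)) ∧
      (∀ i, φ (Ideal.Quotient.mk _ (sigmaVar n i)) = sigma n i) ∧
      (∀ j, φ (Ideal.Quotient.mk _ (nuVar n j)) = nu n j) := by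
  refine ⟨fun i => isVirtualLineElement_lineElt _ _,
    fun j => nu_eq j ▸ isVirtualLineElement_lineElt _ _, ?_⟩
  let e₁ : (LaurentRing n ⧸ relIdeal n) ≃ₗ[ℂ] SplitAlgebra n :=
    LinearEquiv.ofBijective (presentationHom n).toLinearMap presentationHom_bijective
  let e₂ : KI n ≃ₗ[ℂ] SplitAlgebra n :=
    LinearEquiv.ofBijective (evaluation n) ⟨evaluation_injective, evaluation_surjective⟩
  have h : ∀ a, evaluation n ((e₁.trans e₂.symm) a) = presentationHom n a := fun a =>
    e₂.apply_symm_apply (e₁ a)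
  refine ⟨e₁.trans e₂.symm, ?_, fun a b => ?_, fun i => ?_, fun j => ?_⟩ <;>
    apply evaluation_injective
  · rw [h, map_one, evaluation_vone]
  · rw [h, map_mul, evaluation_vmul, h, h]
  · rw [h, presentationHom_mk, laurentHom_sigmaVar]
  · rw [h, presentationHom_mk, laurentHom_nuVar]
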